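/- Let $M$ be a von Neumann algebra on a complex Hilbert space $H$ with center $Z(M)$, and identify $Z(M)$, by a $*$-isomorphism, with $L^\infty(\Omega,\Sigma,\mu)$, where $\mu$ is a semifinite measure with the direct sum property: there is a family $\{\Omega_i\}_{i\in J}\subset\Sigma$ with $0<\mu(\Omega_i)<\infty$ such that every $A\in\Sigma$ with $\mu(A)<\infty$ is, up to a null set, covered by countably many of the $\Omega_i$. Correspondingly the algebra $S(Z(M))$ of measurable operators with respect to $Z(M)$ is identified with the algebra $L^0(\Omega,\Sigma,\mu)$ of all classes of complex measurable functions. Let $LS(M)$ be the $*$-algebra of locally measurable operators with respect to $M$ (with strong addition and multiplication), and let $E(M)$, the central extension of $M$, be the $*$-subalgebra of all $x\in LS(M)$ for which there are mutually orthogonal projections $z_i\in Z(M)$, $i\in I$, with $\bigvee_i z_i=\mathbf 1$ and $z_ix\in M$ for all $i\in I$. For $x\in E(M)$ put $\|x\|=\inf\{f\in S(Z(M)) : |x|\le f\}\in S(Z(M))$. Let $t_c(M)$ be the topology on $E(M)$ in which the sets $x+O(A,\varepsilon,\delta)$, with $\varepsilon,\delta>0$, $A\in\Sigma$, $\mu(A)<\infty$,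 form a base of neighborhoods of $x$, where $$O(A,\varepsilon,\delta)=\{y\in E(M): \exists B\in\Sigma,\ B\subseteq A,\ \mu(A\setminus B)\le\delta,\ \big\|\,\|y\|\chi_B\big\|_{L^\infty}\le\varepsilon\}.$$ Then the following are equivalent: (i) the topology $t_c(M)$ is locally convex; (ii) $M$ is $*$-isomorphic to a $C^*$-product $\bigoplus_{j\in J}M_j$ (the algebra of all norm-bounded families) of factors $M_j$; (iii) the center $Z(M)$ is atomic, i.e. every nonzero projection of $Z(M)$ dominates a minimal nonzero projection of $Z(M)$. -/

import Mathlib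

open MeasureTheory
open scoped ENNReal Topology

universe u v

namespace CentralExtension

section Operators

variable {H : Type u} [NormedAddCommGroup H] [InnerProductSpace ℂ H] [CompleteSpace H]

/-- The center `Z(M) = M ∩ M'` of a von Neumann algebra `M`, again as a von Neumann algebra. -/
noncomputable def center (M : VonNeumannAlgebra H) : VonNeumannAlgebra H where
  toStarSubalgebra := M.toStarSubalgebra ⊓ M.commutant.toStarSubalgebra
  centralizer_centralizer' := by
    apply Set.Subset.antisymm _ Set.subset_centralizer_centralizer
    have h1 : Set.centralizer (Set.centralizer ((M : Set (H →L[ℂ] H)) ∩ M.commutant)) ⊆ M := by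
      conv_rhs => rw [← M.centralizer_centralizer]
      exact Set.centralizer_subset (Set.centralizer_subset Set.inter_subset_left)
    have h2 : Set.centralizer (Set.centralizer ((M : Set (H →L[ℂ] H)) ∩ M.commutant)) ⊆
        M.commutant := by
      conv_rhs => rw [← M.commutant.centralizer_centralizer]
      exact Set.centralizer_subset (Set.centralizer_subset Set.inter_subset_right)
    exact fun a ha => ⟨h1 ha, h2 ha⟩

/-- `p ∈ P(M)`: `p` is an (orthogonal) projection of the von Neumann algebra `M`. -/
def IsProj (M : VonNeumannAlgebra H) (p : H →L[ℂ] H) : Prop :=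
  p ∈ M ∧ IsStarProjection p

/-- `p` is a finite projection of `M`: it is not Murray-von Neumann equivalent in `M` to a proper
subprojection of itself. -/
def IsFiniteProj (M : VonNeumannAlgebra H) (p : H →L[ℂ] H) : Prop :=
  IsProj M p ∧ ∀ u ∈ M, star u * u = p → u * star u ≤ p → u * star u = p

/-- The supremum of the projections `p i` is the identity: their ranges span a dense subspace. -/
def SupEqOne {ι : Type*} (p : ι → H →L[ℂ] H) : Prop :=
  (⨆ i, LinearMap.range (p i : H →ₗ[ℂ] H)).topologicalClosure = ⊤

/-- The subspace `D` is affiliated with `M`. -/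
def SubspaceAffiliated (M : VonNeumannAlgebra H) (D : Submodule ℂ H) : Prop :=
  ∀ w ∈ M.commutant, w ∈ unitary (H →L[ℂ] H) → ∀ ξ ∈ D, w ξ ∈ D

/-- The linear operator `x` with domain `x.domain` is affiliated with `M`. -/
def Affiliated (M : VonNeumannAlgebra H) (x : H →ₗ.[ℂ] H) : Prop :=
  SubspaceAffiliated M x.domain ∧
    ∀ w ∈ M.commutant, w ∈ unitary (H →L[ℂ] H) →
      ∀ ξ η : x.domain, (η : H) = w ξ → x η = w (x ξ)

/-- The subspace `D` is strongly dense with respect to `M`. -/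
def StronglyDense (M : VonNeumannAlgebra H) (D : Submodule ℂ H) : Prop :=
  SubspaceAffiliated M D ∧
    ∃ p : ℕ → H →L[ℂ] H, (∀ n, IsProj M (p n)) ∧ Monotone p ∧ SupEqOne p ∧
      (∀ n ξ, p n ξ ∈ D) ∧ ∀ n, IsFiniteProj M (1 - p n)

/-- `x ∈ S(M)`: `x` is a measurable operator with respect to `M`. -/
def IsMeasurableOp (M : VonNeumannAlgebra H) (x : H →ₗ.[ℂ] H) : Prop :=
  x.IsClosed ∧ Affiliated M x ∧ StronglyDense M x.domain

/-- Strong product `a x` of a bounded operator `a` and an operator `x`: the closure of the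
composition. -/
noncomputable def strongMul (a : H →L[ℂ] H) (x : H →ₗ.[ℂ] H) : H →ₗ.[ℂ] H :=
  ((a : H →ₗ[ℂ] H).compPMap x).closure

/-- Strong sum: the closure of the operator `x + y` with domain `D(x) ∩ D(y)`. -/
noncomputable def strongAdd (x y : H →ₗ.[ℂ] H) : H →ₗ.[ℂ] H := (x + y).closure

/-- Strong difference: the closure of the operator `x - y` with domain `D(x) ∩ D(y)`. -/
noncomputable def strongSub (x y : H →ₗ.[ℂ] H) : H →ₗ.[ℂ] H := (x - y).closure

/-- `x ∈ LS(M)`: `x` is a locally measurable operator with respect to `M`. -/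
def IsLocallyMeasurableOp (M : VonNeumannAlgebra H) (x : H →ₗ.[ℂ] H) : Prop :=
  x.IsClosed ∧ Affiliated M x ∧
    ∃ z : ℕ → H →L[ℂ] H, (∀ n, IsProj (center M) (z n)) ∧ Monotone z ∧ SupEqOne z ∧
      ∀ n, IsMeasurableOp M (strongMul (z n) x)

/-- A bounded operator, regarded as an operator with domain `H`. -/
def ofBounded (a : H →L[ℂ] H) : H →ₗ.[ℂ] H := (a : H →ₗ[ℂ] H).toPMap ⊤

/-- The central extension `E(M)`: the locally measurable operators `x` for which there are mutually
orthogonal central projections `z i` with supremum `1` and `z i * x ∈ M` for all `i`. -/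
def centralExtension (M : VonNeumannAlgebra H) : Set (H →ₗ.[ℂ] H) :=
  {x | IsLocallyMeasurableOp M x ∧
    ∃ (I : Type u) (z : I → H →L[ℂ] H), (∀ i, IsProj (center M) (z i)) ∧
      (∀ i j, i ≠ j → z i * z j = 0) ∧ SupEqOne z ∧
      ∀ i, ∃ a ∈ M, strongMul (z i) x = ofBounded a}

/-- Positive self-adjoint operators. -/
def IsPositiveOp (x : H →ₗ.[ℂ] H) : Prop :=
  IsSelfAdjoint x ∧ ∀ ξ : x.domain, 0 ≤ (inner ℂ (x ξ) (ξ : H)).re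

/-- The order `x ≤ y` on self-adjoint operators of `LS(M)`: the strong difference `y - x` is
positive. -/
def OpLE (x y : H →ₗ.[ℂ] H) : Prop :=
  IsSelfAdjoint x ∧ IsSelfAdjoint y ∧ IsPositiveOp (strongSub y x)

/-- `h = |x| = (x* x)^(1/2)`: `h` is the positive operator in `LS(M)` whose square is `x* x`, both
products being compositions of operators with their natural domains, given by their graphs. -/
def IsModulus (M : VonNeumannAlgebra H) (x h : H →ₗ.[ℂ] H) : Prop :=
  IsLocallyMeasurableOp M h ∧ IsPositiveOp h ∧
    ∀ ξ ζ : H, (∃ η, (ξ, η) ∈ h.graph ∧ (η, ζ) ∈ h.graph) ↔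
      ∃ η, (ξ, η) ∈ x.graph ∧ (η, ζ) ∈ x.adjoint.graph

/-- `f = ‖x‖ = inf {g ∈ S(Z(M)) : |x| ≤ g}`, the center-valued norm of `x`, the infimum being the
greatest lower bound among the self-adjoint elements of `S(Z(M))`. -/
def IsCenterNorm (M : VonNeumannAlgebra H) (x f : H →ₗ.[ℂ] H) : Prop :=
  IsMeasurableOp (center M) f ∧ IsSelfAdjoint f ∧
    ∃ h, IsModulus M x h ∧
      (∀ g, IsMeasurableOp (center M) g → OpLE h g → OpLE f g) ∧
      ∀ f', IsMeasurableOp (center M) f' → IsSelfAdjoint f' →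
        (∀ g, IsMeasurableOp (center M) g → OpLE h g → OpLE f' g) → OpLE f' f

/-- `M` is a factor: it acts on a nonzero Hilbert space and its center consists of scalars. -/
def IsFactor (M : VonNeumannAlgebra H) : Prop :=
  Nontrivial H ∧ ∀ a ∈ center M, ∃ c : ℂ, a = c • (1 : H →L[ℂ] H)

/-- The C*-product of the von Neumann algebras `N j`: the *-algebra of all norm-bounded families
`a j ∈ N j`, with the coordinatewise operations. -/
def cstarProduct {J : Type u} {K : J → Type u}
    [∀ j, NormedAddCommGroup (K j)] [∀ j, InnerProductSpace ℂ (K j)] [∀ j, CompleteSpace (K j)]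
    (N : ∀ j, VonNeumannAlgebra (K j)) : StarSubalgebra ℂ (∀ j, (N j).toStarSubalgebra) where
  carrier := {a | ∃ C : ℝ, ∀ j, ‖(a j : K j →L[ℂ] K j)‖ ≤ C}
  mul_mem' := by
    rintro a b ⟨C, hC⟩ ⟨D, hD⟩
    exact ⟨C * D, fun j => (norm_mul_le _ _).trans
      (mul_le_mul (hC j) (hD j) (norm_nonneg _) ((norm_nonneg _).trans (hC j)))⟩
  add_mem' := by
    rintro a b ⟨C, hC⟩ ⟨D, hD⟩
    exact ⟨C + D, fun j => (norm_add_le _ _).trans (add_le_add (hC j) (hD j))⟩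
  algebraMap_mem' c := ⟨‖c‖, fun j => by
    refine ContinuousLinearMap.opNorm_le_bound _ (norm_nonneg c) fun ξ => ?_
    exact (norm_smul c ξ).le⟩
  star_mem' := by
    rintro a ⟨C, hC⟩
    exact ⟨C, fun j => (norm_star (a j : K j →L[ℂ] K j)).trans_le (hC j)⟩

/-- `M` is *-isomorphic to the C*-product of a family of factors. -/
def IsProductOfFactors (M : VonNeumannAlgebra H) : Prop :=
  ∃ (J : Type u) (K : J → Type u) (_ : ∀ j, NormedAddCommGroup (K j))
    (_ : ∀ j, InnerProductSpace ℂ (K j)) (_ : ∀ j, CompleteSpace (K j))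
    (N : ∀ j, VonNeumannAlgebra (K j)), (∀ j, IsFactor (N j)) ∧
      Nonempty (M.toStarSubalgebra ≃⋆ₐ[ℂ] cstarProduct N)

/-- The von Neumann algebra `M` is atomic: every nonzero projection of `M` dominates a minimal
one. -/
def IsAtomicAlgebra (M : VonNeumannAlgebra H) : Prop :=
  ∀ p, IsProj M p → p ≠ 0 → ∃ q, IsProj M q ∧ q ≠ 0 ∧ q ≤ p ∧
    ∀ r, IsProj M r → r ≤ q → r = 0 ∨ r = q

end Operators

section Measure

variable {Ω : Type v} [MeasurableSpace Ω]

/-- The direct sum property: there is a family of sets of finite positive measure such that every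
set of finite measure is covered, up to a null set, by countably many of them. -/
def HasDirectSumProperty (μ : Measure Ω) : Prop :=
  ∃ 𝓕 : Set (Set Ω), (∀ S ∈ 𝓕, MeasurableSet S ∧ 0 < μ S ∧ μ S < ∞) ∧
    ∀ A, MeasurableSet A → μ A < ∞ →
      ∃ 𝓒 ⊆ 𝓕, 𝓒.Countable ∧ ∃ B, MeasurableSet B ∧ μ B = 0 ∧ A = (⋃ S ∈ 𝓒, A ∩ S) ∪ B

/-- Every measurable set of positive measure has a measurable subset of finite positive measure. -/
def IsSemifiniteMeasure (μ : Measure Ω) : Prop :=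
  ∀ A, MeasurableSet A → 0 < μ A → ∃ B ⊆ A, MeasurableSet B ∧ 0 < μ B ∧ μ B < ∞

/-- The basic neighborhood `W(A, ε, δ)` of zero in `L⁰(Ω, Σ, μ)`. -/
def nhdW (μ : Measure Ω) (A : Set Ω) (ε δ : ℝ) : Set (Ω →ₘ[μ] ℂ) :=
  {f | ∃ B ⊆ A, MeasurableSet B ∧ μ (A \ B) ≤ ENNReal.ofReal δ ∧
    eLpNorm (B.indicator f) ∞ μ ≤ ENNReal.ofReal ε}

end Measure

section Topology

variable {H : Type u} [NormedAddCommGroup H] [InnerProductSpace ℂ H] [CompleteSpace H]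
variable {Ω : Type v} [MeasurableSpace Ω]

/-- A *-isomorphism of the center `Z(M)` onto `L^∞(Ω, Σ, μ)`, the algebra of essentially bounded
elements of `L⁰(Ω, Σ, μ)`. -/
structure CenterIso (M : VonNeumannAlgebra H) (μ : Measure Ω) where
  toFun : (center M).toStarSubalgebra → (Ω →ₘ[μ] ℂ)
  injective : Function.Injective toFun
  range_eq : Set.range toFun = {f : Ω →ₘ[μ] ℂ | eLpNorm f ∞ μ < ∞}
  map_add : ∀ a b, toFun (a + b) = toFun a + toFun b
  map_mul : ∀ a b, toFun (a * b) = toFun a * toFun b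
  map_smul : ∀ (c : ℂ) a, toFun (c • a) = c • toFun a
  map_star : ∀ a, toFun (star a) = star (toFun a)

/-- The identification of `S(Z(M))` with `L⁰(Ω, Σ, μ)` that extends `Φ : Z(M) ≃ L^∞(Ω, Σ, μ)`:
the operator `f` corresponds to the function `g` if `Φ (z f) = Φ (z) g` for every central
projection `z` such that `z f` is bounded. -/
def Represents {M : VonNeumannAlgebra H} {μ : Measure Ω} (Φ : CenterIso M μ)
    (f : H →ₗ.[ℂ] H) (g : Ω →ₘ[μ] ℂ) : Prop :=
  ∀ z a : (center M).toStarSubalgebra, IsStarProjection (z : H →L[ℂ] H) →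
    strongMul (z : H →L[ℂ] H) f = ofBounded (a : H →L[ℂ] H) → Φ.toFun a = Φ.toFun z * g

/-- The set `O(A, ε, δ)` of all `x ∈ E(M)` with `‖x‖ ∈ W(A, ε, δ)`. -/
def nhdO {M : VonNeumannAlgebra H} {μ : Measure Ω} (Φ : CenterIso M μ)
    (A : Set Ω) (ε δ : ℝ) : Set (H →ₗ.[ℂ] H) :=
  {x | x ∈ centralExtension M ∧
    ∃ f g, IsCenterNorm M x f ∧ Represents Φ f g ∧ g ∈ nhdW μ A ε δ}

/-- The topology `t_c(M)` on `E(M)`, for which the sets `x + O(A, ε, δ)` with `ε, δ > 0` and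
`μ(A) < ∞` form a base of neighborhoods of `x`. -/
@[reducible]
def tc {M : VonNeumannAlgebra H} {μ : Measure Ω} (Φ : CenterIso M μ) :
    TopologicalSpace (centralExtension M) where
  IsOpen U := ∀ x ∈ U, ∃ A ε δ, MeasurableSet A ∧ μ A < ∞ ∧ 0 < ε ∧ 0 < δ ∧
    ∀ y : centralExtension M, strongSub (y : H →ₗ.[ℂ] H) x ∈ nhdO Φ A ε δ → y ∈ U
  isOpen_univ := fun _ _ => ⟨∅, 1, 1, by simp⟩
  isOpen_inter := by
    have mono : ∀ (A B : Set Ω) (ε ε' δ δ' : ℝ), MeasurableSet A → A ⊆ B → ε' ≤ ε → δ' ≤ δ →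
        nhdO Φ B ε' δ' ⊆ nhdO Φ A ε δ := by
      rintro A B ε ε' δ δ' hA hAB hε hδ x ⟨hx, f, g, hf, hg, C, hCB, hC, hμ, hn⟩
      refine ⟨hx, f, g, hf, hg, C ∩ A, Set.inter_subset_right, hC.inter hA, ?_, ?_⟩
      · refine (measure_mono ?_).trans (hμ.trans (ENNReal.ofReal_le_ofReal hδ))
        exact fun ω hω => ⟨hAB hω.1, fun h => hω.2 ⟨h, hω.1⟩⟩
      · refine le_trans (eLpNorm_mono fun ω => ?_) (hn.trans (ENNReal.ofReal_le_ofReal hε))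
        exact norm_indicator_le_of_subset Set.inter_subset_left _ _
    rintro U V hU hV x ⟨hxU, hxV⟩
    obtain ⟨A, ε, δ, hA, hμA, hε, hδ, h⟩ := hU x hxU
    obtain ⟨A', ε', δ', hA', hμA', hε', hδ', h'⟩ := hV x hxV
    refine ⟨A ∪ A', min ε ε', min δ δ', hA.union hA', measure_union_lt_top hμA hμA',
      lt_min hε hε', lt_min hδ hδ', fun y hy => ⟨h y ?_, h' y ?_⟩⟩
    · exact mono _ _ _ _ _ _ hA Set.subset_union_left (min_le_left _ _) (min_le_left _ _) hy
    · exact mono _ _ _ _ _ _ hA' Set.subset_union_right (min_le_right _ _) (min_le_right _ _) hy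
  isOpen_sUnion := by
    rintro s hs x ⟨U, hU, hx⟩
    obtain ⟨A, ε, δ, hA, hμA, hε, hδ, h⟩ := hs U hU x hx
    exact ⟨A, ε, δ, hA, hμA, hε, hδ, fun y hy => ⟨U, hU, h y hy⟩⟩

/-- Convex subsets of `E(M)`, with respect to the vector space operations of `E(M)`: strong
addition and multiplication by scalars. -/
def IsConvexSet {M : VonNeumannAlgebra H} (V : Set (centralExtension M)) : Prop :=
  ∀ x ∈ V, ∀ y ∈ V, ∀ s t : ℝ, 0 ≤ s → 0 ≤ t → s + t = 1 →
    ∃ w ∈ V, (w : H →ₗ.[ℂ] H) =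
      strongAdd ((s : ℂ) • (x : H →ₗ.[ℂ] H)) ((t : ℂ) • (y : H →ₗ.[ℂ] H))

/-- A topology on `E(M)` is locally convex: every neighborhood of every point contains a convex
neighborhood of that point. -/
def IsLocallyConvexTopology {M : VonNeumannAlgebra H}
    (τ : TopologicalSpace (centralExtension M)) : Prop :=
  ∀ x, ∀ U ∈ @nhds _ τ x, ∃ V ∈ @nhds _ τ x, V ⊆ U ∧ IsConvexSet V

end Topology

end CentralExtension

/-! An element of E(M) is unbounded, but only along the center: there is an increasing sequence of
central projections p n with supremum 1 on whose ranges it is given by bounded operators a n of M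
(`mem_centralExtension_iff`; p n can be taken as the largest central projection on which the
operator is bounded by n). Sums, products, adjoints, moduli and the order are then computed piece by
piece on the a n. The measurable operators of the center are those glued from central pieces
(`isMeasurableOp_center_iff`).

Under Z(M) ≅ L^∞ central projections are measurable sets modulo null sets, and ‖x‖ is the function
that exceeds s essentially where x is not bounded by s. This gives `mem_nhdO_iff`: x lies in O(A, ε,
δ) iff x is bounded by ε on the central projection of some B ⊆ A with μ(A \ B) ≤ δ. From there on
the topology is that of convergence in measure, and the center-valued norm is no longer needed.

Atomic center implies local convexity: up to measure δ, the set A is a finite union C of atoms. A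
set that misses less of C than the measure of each of these atoms contains C almost everywhere, so
the neighborhoods contain balls of a seminorm, "bounded by ε over C".

Local convexity implies atomic center, as for L⁰[0,1]: if a central projection dominates no minimal
one, semifiniteness gives below it an atomless set A of finite positive measure. A is covered by n
sets C of measure at most δ. Each 2n χ_C lies in a given convex neighborhood, hence so does their
average, which is at least 2 on all of A and so does not belong to O(A, 1, μ(A)/2).

Atomic center and products of factors: minimal central projections are pairwise orthogonal and, when
the center is atomic, have supremum 1. M is the product of its compressions to them
(`nonempty_starAlgEquiv_cstarProduct`), which are factors because a measurable function is constant
on an atom. Conversely, a central projection in a product of factors has coordinates 0 or 1, and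
atomicity of the center is a *-isomorphism invariant. -/

namespace CentralExtension

/-! ### Operators glued from bounded pieces along a chain of central projections -/

section Gluing

variable {H : Type u} [NormedAddCommGroup H] [InnerProductSpace ℂ H] [CompleteSpace H]
variable {M : VonNeumannAlgebra H}

theorem mul_comm_of_mem_center {z a : H →L[ℂ] H} (hz : z ∈ center M) (ha : a ∈ M) :
    a * z = z * a :=
  VonNeumannAlgebra.mem_commutant_iff.1 hz.2 a ha

theorem smul_mem_vN (N : VonNeumannAlgebra H) (c : ℂ) {a : H →L[ℂ] H} (ha : a ∈ N) : c • a ∈ N :=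
  N.toStarSubalgebra.smul_mem ha c

/-- An increasing sequence of projections with supremum `1` converges strongly to `1`. -/
theorem tendsto_of_supEqOne {p : ℕ → H →L[ℂ] H} (hp : ∀ n, IsStarProjection (p n))
    (hm : Monotone p) (hs : SupEqOne p) (ξ : H) :
    Filter.Tendsto (fun n => p n ξ) Filter.atTop (𝓝 ξ) := by
  have hle : ∀ n m, n ≤ m → p m * p n = p n := fun n m h =>
    ((hp n).le_iff_mul_eq_right (hp m)).1 (hm h)
  rw [Metric.tendsto_atTop]
  intro ε hε
  have hξ : ξ ∈ (⨆ i, LinearMap.range (p i : H →ₗ[ℂ] H)).topologicalClosure := by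
    rw [hs]; trivial
  obtain ⟨ζ, hζ, hd⟩ := Metric.mem_closure_iff.1 hξ (ε / 2) (half_pos hε)
  replace hζ : ζ ∈ ⨆ i, LinearMap.range (p i : H →ₗ[ℂ] H) := hζ
  rw [Submodule.mem_iSup_of_directed] at hζ
  · obtain ⟨n, v, rfl⟩ := hζ
    refine ⟨n, fun m hnm => ?_⟩
    have h1 : p m (p n v) = p n v := congrArg (fun T : H →L[ℂ] H => T v) (hle n m hnm)
    -- `p n v` is fixed by every later projection, so the error is at most twice the distance from
    -- `ξ` to `p n v`; hence the `ε / 2` above.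
    have h2 : p m ξ - ξ = p m (ξ - p n v) - (ξ - p n v) := by
      rw [map_sub, h1]; abel
    have h3 : ‖p m (ξ - p n v)‖ ≤ ‖ξ - p n v‖ := by
      simpa using (p m).le_of_opNorm_le ((hp m).norm_le) (ξ - p n v)
    rw [dist_eq_norm] at hd ⊢
    change ‖ξ - p n v‖ < _ at hd
    rw [h2]
    refine (norm_sub_le _ _).trans_lt ?_
    linarith
  · refine Monotone.directed_le fun n m h => ?_
    rintro _ ⟨v, rfl⟩
    exact ⟨p n v, congrArg (fun T : H →L[ℂ] H => T v) (hle n m h)⟩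

theorem supEqOne_of_tendsto {p : ℕ → H →L[ℂ] H}
    (h : ∀ ξ, Filter.Tendsto (fun n => p n ξ) Filter.atTop (𝓝 ξ)) : SupEqOne p := by
  rw [SupEqOne, eq_top_iff]
  intro ξ _
  refine mem_closure_of_tendsto (h ξ) (Filter.Eventually.of_forall fun n => ?_)
  exact (le_iSup (fun i => LinearMap.range (p i : H →ₗ[ℂ] H)) n) ⟨ξ, rfl⟩

/-- An increasing sequence of central projections with supremum `1`. -/
structure CentralChain (M : VonNeumannAlgebra H) (p : ℕ → H →L[ℂ] H) : Prop where
  proj : ∀ n, IsProj (center M) (p n)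
  mono : Monotone p
  sup : SupEqOne p

namespace CentralChain

variable {p q : ℕ → H →L[ℂ] H}

theorem tendsto (hp : CentralChain M p) (ξ : H) :
    Filter.Tendsto (fun n => p n ξ) Filter.atTop (𝓝 ξ) :=
  tendsto_of_supEqOne (fun n => (hp.proj n).2) hp.mono hp.sup ξ

theorem mul_of_le (hp : CentralChain M p) {n m : ℕ} (h : n ≤ m) : p m * p n = p n :=
  ((hp.proj n).2.le_iff_mul_eq_right (hp.proj m).2).1 (hp.mono h)

theorem mul_of_le' (hp : CentralChain M p) {n m : ℕ} (h : n ≤ m) : p n * p m = p n :=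
  ((hp.proj n).2.le_iff_mul_eq_left (hp.proj m).2).1 (hp.mono h)

theorem mem (hp : CentralChain M p) (n : ℕ) : p n ∈ M := (hp.proj n).1.1

theorem comm (hp : CentralChain M p) (n : ℕ) {a : H →L[ℂ] H} (ha : a ∈ M) : a * p n = p n * a :=
  mul_comm_of_mem_center (hp.proj n).1 ha

theorem star_eq (hp : CentralChain M p) (n : ℕ) : star (p n) = p n :=
  (hp.proj n).2.isSelfAdjoint

theorem mul_self (hp : CentralChain M p) (n : ℕ) : p n * p n = p n := hp.mul_of_le le_rfl

theorem norm_apply_le (hp : CentralChain M p) (n : ℕ) (ξ : H) : ‖p n ξ‖ ≤ ‖ξ‖ := by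
  simpa using (p n).le_of_opNorm_le ((hp.proj n).2.norm_le) ξ

theorem inner_left (hp : CentralChain M p) (n : ℕ) (ξ η : H) :
    inner ℂ (p n ξ) η = inner ℂ ξ (p n η) := by
  conv_lhs => rw [← hp.star_eq n, ContinuousLinearMap.star_eq_adjoint]
  exact ContinuousLinearMap.adjoint_inner_left _ _ _

end CentralChain

theorem IsProj.mul {z w : H →L[ℂ] H} (hz : IsProj (center M) z) (hw : IsProj (center M) w) :
    IsProj (center M) (z * w) := by
  have hc : w * z = z * w := mul_comm_of_mem_center hz.1 hw.1.1
  refine ⟨mul_mem hz.1 hw.1, ?_, ?_⟩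
  · change z * w * (z * w) = z * w
    rw [mul_assoc, ← mul_assoc w, hc, mul_assoc, hw.2.isIdempotentElem.eq, ← mul_assoc,
      hz.2.isIdempotentElem.eq]
  · change star (z * w) = z * w
    rw [star_mul, hz.2.isSelfAdjoint, hw.2.isSelfAdjoint, hc]

theorem IsProj.one_sub {z : H →L[ℂ] H} (hz : IsProj (center M) z) :
    IsProj (center M) (1 - z) := ⟨sub_mem (one_mem _) hz.1, hz.2.one_sub⟩

theorem IsProj.one : IsProj (center M) (1 : H →L[ℂ] H) := ⟨one_mem _, .one _⟩

theorem CentralChain.mul {p q : ℕ → H →L[ℂ] H} (hp : CentralChain M p) (hq : CentralChain M q) :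
    CentralChain M (fun n => p n * q n) where
  proj n := (hp.proj n).mul (hq.proj n)
  mono n m h := by
    rw [((hp.proj n).mul (hq.proj n)).2.le_iff_mul_eq_right ((hp.proj m).mul (hq.proj m)).2]
    change p m * q m * (p n * q n) = p n * q n
    rw [mul_assoc, ← mul_assoc (q m), ← hq.comm m (hp.mem n), mul_assoc, hq.mul_of_le h,
      ← mul_assoc, hp.mul_of_le h]
  sup := by
    refine supEqOne_of_tendsto fun ξ => ?_
    have h2 := hq.tendsto ξ
    rw [tendsto_iff_norm_sub_tendsto_zero] at *
    refine squeeze_zero (fun _ => norm_nonneg _) (fun n => ?_)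
      (by simpa using h2.add (tendsto_iff_norm_sub_tendsto_zero.1 (hp.tendsto ξ)))
    have : (p n * q n) ξ - ξ = p n (q n ξ - ξ) + (p n ξ - ξ) := by
      rw [map_sub, mul_apply_eq_comp]; abel
    rw [this]
    exact (norm_add_le _ _).trans (add_le_add_left (hp.norm_apply_le n _) _)

theorem CentralChain.one : CentralChain M (fun _ => 1) where
  proj _ := IsProj.one
  mono _ _ _ := le_rfl
  sup := supEqOne_of_tendsto fun _ => tendsto_const_nhds

/-- The operator `x` is obtained by gluing the bounded operators `a n` of `M` along the central
chain `p`: on the range of `p n` it is given by `a n`. -/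
structure IsGlued (M : VonNeumannAlgebra H) (p a : ℕ → H →L[ℂ] H) (x : H →ₗ.[ℂ] H) : Prop where
  chain : CentralChain M p
  mem : ∀ n, a n ∈ M
  compat : ∀ n m, n ≤ m → a m * p n = a n
  graph : ∀ ξ η, (ξ, η) ∈ x.graph ↔ ∀ n, a n ξ = p n η

/-- The relation is a graph because `ξ = 0` forces `p n η = 0` for all `n`, and `p n η` tends to
`η`. Strong sums and products are identified by first gluing the expected pieces here and then
applying `IsGlued.closure_eq`. -/
theorem exists_isGlued {p a : ℕ → H →L[ℂ] H} (hp : CentralChain M p) (ha : ∀ n, a n ∈ M)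
    (hc : ∀ n m, n ≤ m → a m * p n = a n) : ∃ x, IsGlued M p a x := by
  let g : Submodule ℂ (H × H) :=
    { carrier := {v | ∀ n, a n v.1 = p n v.2}
      add_mem' := fun {v w} hv hw n => by simp [hv n, hw n]
      zero_mem' := fun n => by simp
      smul_mem' := fun c v hv n => by simp [hv n] }
  refine ⟨g.toLinearPMap, hp, ha, hc, fun ξ η => ?_⟩
  rw [Submodule.toLinearPMap_graph_eq]
  · rfl
  · rintro ⟨ξ, η⟩ h (rfl : ξ = 0)
    refine tendsto_nhds_unique (hp.tendsto η) ?_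
    have : ∀ n, p n η = 0 := fun n => by simpa using (h n).symm
    simp [this]

namespace IsGlued

variable {p q a b : ℕ → H →L[ℂ] H} {x y : H →ₗ.[ℂ] H}

theorem ext (hx : IsGlued M p a x) (hy : IsGlued M p a y) : x = y :=
  LinearPMap.eq_of_eq_graph (by ext ⟨ξ, η⟩; rw [hx.graph, hy.graph])

theorem proj_apply (hx : IsGlued M p a x) {n m : ℕ} (h : n ≤ m) (ξ : H) :
    p n (a m ξ) = a n ξ := by
  rw [← mul_apply_eq_comp, ← hx.chain.comm n (hx.mem m), hx.compat n m h]

theorem apply_proj (hx : IsGlued M p a x) {n m : ℕ} (h : n ≤ m) (ξ : H) :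
    a m (p n ξ) = a n ξ := by
  rw [← mul_apply_eq_comp, hx.compat n m h]

theorem apply_proj' (hx : IsGlued M p a x) {n m : ℕ} (h : n ≤ m) (ξ : H) :
    a n (p m ξ) = a n ξ := by
  rw [← hx.compat n m h, mul_apply_eq_comp, mul_apply_eq_comp,
    ← mul_apply_eq_comp (p n), hx.chain.mul_of_le' h]

theorem mem_graph (hx : IsGlued M p a x) (n : ℕ) (ξ : H) : (p n ξ, a n ξ) ∈ x.graph := by
  rw [hx.graph]
  intro m
  rcases le_total n m with h | h
  · rw [hx.apply_proj h, ← hx.proj_apply le_rfl, ← hx.proj_apply le_rfl,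
      ← mul_apply_eq_comp (p m), hx.chain.mul_of_le h]
  · rw [hx.apply_proj' h, hx.proj_apply h]

theorem isClosed (hx : IsGlued M p a x) : x.IsClosed := by
  have : (x.graph : Set (H × H)) = ⋂ n, {v | a n v.1 = p n v.2} := by
    ext ⟨ξ, η⟩
    simp [hx.graph]
  rw [LinearPMap.IsClosed, this]
  exact isClosed_iInter fun n => isClosed_eq (by fun_prop) (by fun_prop)

theorem mem_domain (hx : IsGlued M p a x) (n : ℕ) (ξ : H) : p n ξ ∈ x.domain :=
  LinearPMap.mem_domain_of_mem_graph (hx.mem_graph n ξ)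

theorem dense_domain (hx : IsGlued M p a x) : Dense (x.domain : Set H) := fun ξ =>
  mem_closure_of_tendsto (hx.chain.tendsto ξ) (Filter.Eventually.of_forall fun n =>
    hx.mem_domain n ξ)

theorem tendsto_apply (hx : IsGlued M p a x) {ξ η : H} (h : (ξ, η) ∈ x.graph) :
    Filter.Tendsto (fun n => a n ξ) Filter.atTop (𝓝 η) := by
  simpa only [fun n => (hx.graph ξ η).1 h n] using hx.chain.tendsto η

/-- The ranges of the `p n` form a core of the glued operator. -/
theorem closure_eq (hx : IsGlued M p a x) {T : H →ₗ.[ℂ] H} (hle : T.graph ≤ x.graph)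
    (hT : ∀ n ξ, p n ξ ∈ T.domain) : T.closure = x := by
  have hcl : T.IsClosable :=
    hx.isClosed.isClosable.leIsClosable (LinearPMap.le_of_le_graph hle)
  apply LinearPMap.eq_of_eq_graph
  rw [← hcl.graph_closure_eq_closure_graph]
  apply le_antisymm
  · exact Submodule.topologicalClosure_minimal _ hle hx.isClosed
  · rintro ⟨ξ, η⟩ h
    -- The pairs `(p n ξ, a n ξ)` lie in the graph of `T` and converge to `(ξ, η)`.
    refine mem_closure_of_tendsto ((hx.chain.tendsto ξ).prodMk_nhds (hx.tendsto_apply h))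
      (Filter.Eventually.of_forall fun n => ?_)
    obtain ⟨ζ, hζ⟩ := LinearPMap.mem_domain_iff.1 (hT n ξ)
    have := LinearPMap.mem_graph_snd_inj x (hle hζ) (hx.mem_graph n ξ) rfl
    exact this ▸ hζ

/-- Criterion for a closed operator to be glued. -/
theorem of_isClosed (hp : CentralChain M p) (ha : ∀ n, a n ∈ M) (hcl : x.IsClosed)
    (h1 : ∀ n ξ, (p n ξ, a n ξ) ∈ x.graph)
    (h2 : ∀ n ξ η, (ξ, η) ∈ x.graph → (p n ξ, p n η) ∈ x.graph) : IsGlued M p a x := by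
  refine ⟨hp, ha, fun n m h => ?_, fun ξ η => ⟨fun h n => ?_, fun h => ?_⟩⟩
  · ext ξ
    have := h1 m (p n ξ)
    rw [← mul_apply_eq_comp, hp.mul_of_le h] at this
    exact LinearPMap.mem_graph_snd_inj x this (h1 n ξ) rfl
  · exact LinearPMap.mem_graph_snd_inj x (h1 n ξ) (h2 n ξ η h) rfl
  · have : Filter.Tendsto (fun n => (p n ξ, p n η)) Filter.atTop (𝓝 (ξ, η)) :=
      (hp.tendsto ξ).prodMk_nhds (hp.tendsto η)
    refine hcl.mem_of_tendsto this (Filter.Eventually.of_forall fun n => ?_)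
    exact h n ▸ h1 n ξ

theorem map_graph (hx : IsGlued M p a x) {w : H →L[ℂ] H} (hw : ∀ n, w * p n = p n * w)
    (hw' : ∀ n, w * a n = a n * w) {ξ η : H} (h : (ξ, η) ∈ x.graph) : (w ξ, w η) ∈ x.graph := by
  rw [hx.graph] at *
  intro n
  rw [← mul_apply_eq_comp, ← mul_apply_eq_comp, ← hw n, ← hw' n,
    mul_apply_eq_comp, h n, mul_apply_eq_comp]

theorem center_graph (hx : IsGlued M p a x) {w : H →L[ℂ] H} (hw : w ∈ center M)
    {ξ η : H} (h : (ξ, η) ∈ x.graph) : (w ξ, w η) ∈ x.graph :=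
  hx.map_graph (fun n => (mul_comm_of_mem_center hw (hx.chain.mem n)).symm)
    (fun n => (mul_comm_of_mem_center hw (hx.mem n)).symm) h

/-- A glued operator is also glued along any refinement of the chain. -/
theorem refine (hx : IsGlued M p a x) (hq : CentralChain M q) :
    IsGlued M (fun n => p n * q n) (fun n => a n * q n) x := by
  refine of_isClosed (hx.chain.mul hq) (fun n => mul_mem (hx.mem n) (hq.mem n)) hx.isClosed
    (fun n ξ => hx.mem_graph n (q n ξ))
    fun n ξ η h => hx.center_graph ((hx.chain.proj n).mul (hq.proj n)).1 h

theorem refine' (hx : IsGlued M p a x) (hq : CentralChain M q) :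
    IsGlued M (fun n => q n * p n) (fun n => a n * q n) x := by
  simpa only [fun n => hq.comm n (hx.chain.mem n)] using hx.refine hq

/-- If `a n ξ` is bounded in `n`, then `ξ` is in the domain of the glued operator. -/
theorem exists_of_bounded (hx : IsGlued M p a x) {ξ : H} {C : ℝ} (h : ∀ n, ‖a n ξ‖ ≤ C) :
    ∃ η, (ξ, η) ∈ x.graph ∧ ‖η‖ ≤ C := by
  have hC : 0 ≤ C := (norm_nonneg _).trans (h 0)
  -- Pythagoras: `a n ξ = p n (a m ξ)` is orthogonal to `a m ξ - a n ξ`. So the squared norms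
  -- increase, are bounded, and control the increments, which makes `a n ξ` a Cauchy sequence.
  have key : ∀ n m, n ≤ m → ‖a m ξ - a n ξ‖ ^ 2 = ‖a m ξ‖ ^ 2 - ‖a n ξ‖ ^ 2 := by
    intro n m hnm
    have h1 : inner ℂ (a n ξ) (a m ξ - a n ξ) = (0 : ℂ) := by
      have h0 : p n (a m ξ - a n ξ) = 0 := by
        rw [map_sub, hx.proj_apply hnm, hx.proj_apply le_rfl, sub_self]
      rw [← hx.proj_apply le_rfl ξ, hx.chain.inner_left, hx.proj_apply le_rfl, h0,
        inner_zero_right]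
    have h2 := norm_add_sq_eq_norm_sq_add_norm_sq_of_inner_eq_zero _ _ h1
    rw [add_sub_cancel] at h2
    nlinarith
  have hmono : Monotone fun n => ‖a n ξ‖ ^ 2 := fun n m hnm => by
    have := key n m hnm
    have := sq_nonneg ‖a m ξ - a n ξ‖
    simp only
    linarith
  have hbdd : BddAbove (Set.range fun n => ‖a n ξ‖ ^ 2) := by
    refine ⟨C ^ 2, ?_⟩
    rintro _ ⟨n, rfl⟩
    exact pow_le_pow_left₀ (norm_nonneg _) (h n) 2
  have hlim := tendsto_atTop_ciSup hmono hbdd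
  have hcau : CauchySeq fun n => a n ξ := by
    refine cauchySeq_of_le_tendsto_0'
      (fun n => Real.sqrt ((⨆ n, ‖a n ξ‖ ^ 2) - ‖a n ξ‖ ^ 2)) (fun n m hnm => ?_) ?_
    · rw [dist_comm, dist_eq_norm]
      apply Real.le_sqrt_of_sq_le
      rw [key n m hnm]
      exact sub_le_sub_right (le_ciSup hbdd m) _
    · have := (Real.continuous_sqrt.tendsto _).comp (hlim.const_sub (⨆ n, ‖a n ξ‖ ^ 2))
      rwa [sub_self, Real.sqrt_zero] at this
  obtain ⟨η, hη⟩ := cauchySeq_tendsto_of_complete hcau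
  refine ⟨η, (hx.graph ξ η).2 fun n => ?_, le_of_tendsto hη.norm (Filter.Eventually.of_forall h)⟩
  have h1 := ((p n).continuous.tendsto η).comp hη
  refine tendsto_nhds_unique (tendsto_const_nhds.congr' ?_) h1
  filter_upwards [Filter.eventually_ge_atTop n] with m hm
  exact (hx.proj_apply hm ξ).symm

theorem ofBounded {c : H →L[ℂ] H} (hc : c ∈ M) :
    IsGlued M (fun _ => 1) (fun _ => c) (ofBounded c) where
  chain := .one
  mem _ := hc
  compat _ _ _ := mul_one _
  graph ξ η := by
    simp [CentralExtension.ofBounded, LinearPMap.mem_graph_iff]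

theorem strongAdd (hx : IsGlued M p a x) (hy : IsGlued M p b y) (s t : ℂ) :
    IsGlued M p (fun n => s • a n + t • b n) (strongAdd (s • x) (t • y)) := by
  have hmem : ∀ n, s • a n + t • b n ∈ M := fun n =>
    add_mem (smul_mem_vN M s (hx.mem n)) (smul_mem_vN M t (hy.mem n))
  obtain ⟨w, hw⟩ := exists_isGlued hx.chain hmem fun n m h => by
    rw [add_mul, smul_mul_assoc, smul_mul_assoc, hx.compat n m h, hy.compat n m h]
  rw [CentralExtension.strongAdd, hw.closure_eq]
  · exact hw
  · rintro ⟨ξ, η⟩ h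
    obtain ⟨⟨ζ, hζ⟩, rfl, rfl⟩ := (LinearPMap.mem_graph_iff _).1 h
    rw [LinearPMap.add_apply, hw.graph]
    intro n
    have h1 := (hx.graph _ _).1 (x.mem_graph ⟨ζ, hζ.1⟩) n
    have h2 := (hy.graph _ _).1 (y.mem_graph ⟨ζ, hζ.2⟩) n
    change s • a n ζ + t • b n ζ = p n (s • x ⟨ζ, hζ.1⟩ + t • y ⟨ζ, hζ.2⟩)
    rw [map_add, map_smul, map_smul]
    exact congrArg₂ (fun u v => s • u + t • v) h1 h2
  · exact fun n ξ => ⟨hx.mem_domain n ξ, hy.mem_domain n ξ⟩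

theorem strongSub (hx : IsGlued M p a x) (hy : IsGlued M p b y) :
    IsGlued M p (fun n => a n - b n) (strongSub x y) := by
  have hmem : ∀ n, a n - b n ∈ M := fun n => sub_mem (hx.mem n) (hy.mem n)
  obtain ⟨w, hw⟩ := exists_isGlued hx.chain hmem fun n m h => by
    rw [sub_mul, hx.compat n m h, hy.compat n m h]
  rw [CentralExtension.strongSub, hw.closure_eq]
  · exact hw
  · rintro ⟨ξ, η⟩ h
    obtain ⟨⟨ζ, hζ⟩, rfl, rfl⟩ := (LinearPMap.mem_graph_iff _).1 h
    rw [LinearPMap.sub_apply, hw.graph]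
    intro n
    have h1 := (hx.graph _ _).1 (x.mem_graph ⟨ζ, hζ.1⟩) n
    have h2 := (hy.graph _ _).1 (y.mem_graph ⟨ζ, hζ.2⟩) n
    change a n ζ - b n ζ = p n (x ⟨ζ, hζ.1⟩ - y ⟨ζ, hζ.2⟩)
    rw [map_sub]
    exact congrArg₂ (fun u v => u - v) h1 h2
  · exact fun n ξ => ⟨hx.mem_domain n ξ, hy.mem_domain n ξ⟩

theorem strongMul (hx : IsGlued M p a x) {c : H →L[ℂ] H} (hc : c ∈ M) :
    IsGlued M p (fun n => c * a n) (strongMul c x) := by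
  obtain ⟨w, hw⟩ := exists_isGlued hx.chain (fun n => mul_mem hc (hx.mem n)) fun n m h => by
    rw [mul_assoc, hx.compat n m h]
  rw [CentralExtension.strongMul, hw.closure_eq]
  · exact hw
  · rintro ⟨ξ, η⟩ h
    obtain ⟨ζ, rfl, rfl⟩ := (LinearPMap.mem_graph_iff _).1 h
    rw [LinearMap.compPMap_apply, hw.graph]
    intro n
    have h1 := (hx.graph _ _).1 (x.mem_graph ζ) n
    change c (a n ζ) = p n (c (x ζ))
    refine (congrArg c h1).trans ?_
    rw [← mul_apply_eq_comp, hx.chain.comm n hc]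
    rfl
  · exact fun n ξ => hx.mem_domain n ξ

/-- The ranges of the `p n` form a core, so the adjoint relation needs testing only against the
pairs `(p n ξ, a n ξ)`, where it reads `star (a n) η = p n ζ`. -/
theorem adjoint (hx : IsGlued M p a x) : IsGlued M p (fun n => star (a n)) x.adjoint where
  chain := hx.chain
  mem n := star_mem (hx.mem n)
  compat n m h := by
    rw [← hx.compat n m h, hx.chain.comm n (hx.mem m), star_mul, hx.chain.star_eq]
  graph η ζ := by
    rw [LinearPMap.adjoint_graph_eq_graph_adjoint hx.dense_domain, Submodule.mem_adjoint_iff]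
    constructor
    · intro h n
      refine ext_inner_left ℂ fun ξ => ?_
      rw [ContinuousLinearMap.star_eq_adjoint, ContinuousLinearMap.adjoint_inner_right,
        ← hx.chain.inner_left]
      exact sub_eq_zero.1 (h _ _ (hx.mem_graph n ξ))
    · intro h ξ ξ' hg
      rw [sub_eq_zero]
      refine tendsto_nhds_unique (f := fun n => inner ℂ (a n ξ) η) (l := Filter.atTop)
        ((hx.tendsto_apply hg).inner tendsto_const_nhds) ?_
      have : ∀ n, inner ℂ (a n ξ) η = inner ℂ ξ (p n ζ) := fun n => by
        rw [← h n, ContinuousLinearMap.star_eq_adjoint, ContinuousLinearMap.adjoint_inner_right]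
      simp only [this]
      exact tendsto_const_nhds.inner (hx.chain.tendsto ζ)

theorem eq_of_eq (hx : IsGlued M p a x) (hy : IsGlued M p b x) : a = b := by
  funext n
  ext ξ
  exact LinearPMap.mem_graph_snd_inj x (hx.mem_graph n ξ) (hy.mem_graph n ξ) rfl

theorem isSelfAdjoint_iff (hx : IsGlued M p a x) :
    IsSelfAdjoint x ↔ ∀ n, IsSelfAdjoint (a n) := by
  rw [LinearPMap.isSelfAdjoint_def]
  constructor
  · intro h n
    have := hx.adjoint
    rw [h] at this
    exact congrFun (this.eq_of_eq hx) n
  · intro h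
    refine hx.adjoint.ext ?_
    simpa only [fun n => (h n).star_eq] using hx

theorem isPositiveOp_iff (hx : IsGlued M p a x) : IsPositiveOp x ↔ ∀ n, 0 ≤ a n := by
  rw [IsPositiveOp, hx.isSelfAdjoint_iff]
  constructor
  · rintro ⟨h1, h2⟩ n
    rw [ContinuousLinearMap.nonneg_iff_isPositive, ContinuousLinearMap.isPositive_def']
    refine ⟨h1 n, fun ξ => ?_⟩
    have h3 := h2 ⟨p n ξ, hx.mem_domain n ξ⟩
    have h4 : x ⟨p n ξ, hx.mem_domain n ξ⟩ = a n ξ :=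
      LinearPMap.mem_graph_snd_inj x (x.mem_graph _) (hx.mem_graph n ξ) rfl
    rw [h4, ← hx.chain.inner_left, hx.proj_apply le_rfl] at h3
    exact h3
  · intro h
    refine ⟨fun n => (h n).isSelfAdjoint, fun ξ => ?_⟩
    have h1 := hx.tendsto_apply (x.mem_graph ξ)
    refine ge_of_tendsto (((Complex.continuous_re.tendsto _).comp
      (h1.inner tendsto_const_nhds))) (Filter.Eventually.of_forall fun n => ?_)
    exact ((ContinuousLinearMap.nonneg_iff_isPositive _).1 (h n)).re_inner_nonneg_left _

theorem opLE_iff (hx : IsGlued M p a x) (hy : IsGlued M p b y) :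
    OpLE x y ↔ (∀ n, IsSelfAdjoint (a n)) ∧ (∀ n, IsSelfAdjoint (b n)) ∧ ∀ n, a n ≤ b n := by
  rw [OpLE, hx.isSelfAdjoint_iff, hy.isSelfAdjoint_iff, (hy.strongSub hx).isPositiveOp_iff]
  simp only [sub_nonneg]

theorem affiliated {N : VonNeumannAlgebra H} (hx : IsGlued M p a x) (hp : ∀ n, p n ∈ N)
    (ha : ∀ n, a n ∈ N) : Affiliated N x := by
  have key : ∀ w ∈ N.commutant, ∀ ξ η, (ξ, η) ∈ x.graph → (w ξ, w η) ∈ x.graph := fun w hw ξ η h =>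
    hx.map_graph (fun n => (VonNeumannAlgebra.mem_commutant_iff.1 hw _ (hp n)).symm)
      (fun n => (VonNeumannAlgebra.mem_commutant_iff.1 hw _ (ha n)).symm) h
  refine ⟨fun w hw _ ξ hξ => ?_, fun w hw _ ξ η h => ?_⟩
  · exact LinearPMap.mem_domain_of_mem_graph (key w hw _ _ (x.mem_graph ⟨ξ, hξ⟩))
  · exact LinearPMap.mem_graph_snd_inj x (x.mem_graph η) (key w hw _ _ (x.mem_graph ξ)) h

/-- The product `x* x`, with its natural domain. -/
theorem adjoint_comp_self (hx : IsGlued M p a x) (ξ ζ : H) :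
    (∃ η, (ξ, η) ∈ x.graph ∧ (η, ζ) ∈ x.adjoint.graph) ↔
      ∀ n, (star (a n) * a n) ξ = p n ζ := by
  constructor
  · rintro ⟨η, h1, h2⟩ n
    rw [hx.graph] at h1
    rw [hx.adjoint.graph] at h2
    rw [mul_apply_eq_comp, h1 n, hx.adjoint.apply_proj le_rfl, h2 n]
  · intro h
    -- A solution of the glued equation satisfies ‖a n ξ‖² = ⟨p n ζ, ξ⟩ ≤ ‖ζ‖ ‖ξ‖ uniformly in `n`.
    -- By `exists_of_bounded` this already places `ξ` in the natural domain of `x`.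
    have hb : ∀ n, ‖a n ξ‖ ≤ Real.sqrt (‖ζ‖ * ‖ξ‖) := fun n => by
      apply Real.le_sqrt_of_sq_le
      have h1 : inner ℂ (p n ζ) ξ = inner ℂ (a n ξ) (a n ξ) := by
        rw [← h n, mul_apply_eq_comp, ContinuousLinearMap.star_eq_adjoint,
          ContinuousLinearMap.adjoint_inner_left]
      have h2 : ‖a n ξ‖ ^ 2 = ‖inner ℂ (p n ζ) ξ‖ := by
        rw [h1, inner_self_eq_norm_sq_to_K]; simp
      rw [h2]
      refine (norm_inner_le_norm _ _).trans ?_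
      gcongr
      exact hx.chain.norm_apply_le n ζ
    obtain ⟨η, hη, -⟩ := hx.exists_of_bounded hb
    refine ⟨η, hη, (hx.adjoint.graph _ _).2 fun n => ?_⟩
    rw [← h n, mul_apply_eq_comp, (hx.graph _ _).1 hη n, hx.adjoint.apply_proj le_rfl]

end IsGlued

end Gluing

/-! ### E(M), measurable central operators and moduli in terms of gluing -/

section Extension

variable {H : Type u} [NormedAddCommGroup H] [InnerProductSpace ℂ H] [CompleteSpace H]
variable {M : VonNeumannAlgebra H}

/-- An operator commuting with the unitaries of the commutant of `N` is in `N`. -/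
theorem mem_of_forall_unitary (N : VonNeumannAlgebra H) {a : H →L[ℂ] H}
    (h : ∀ w ∈ N.commutant, w ∈ unitary (H →L[ℂ] H) → w * a = a * w) : a ∈ N := by
  rw [← N.commutant_commutant, VonNeumannAlgebra.mem_commutant_iff]
  intro g hg
  have hcl : IsClosed (N.commutant.toStarSubalgebra : Set (H →L[ℂ] H)) := by
    rw [VonNeumannAlgebra.coe_toStarSubalgebra, VonNeumannAlgebra.coe_commutant]
    exact Set.isClosed_centralizer _
  -- The commutant is norm closed, hence a C*-algebra, hence the linear span of its unitaries.
  have hspan := CStarAlgebra.span_unitary N.commutant.toStarSubalgebra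
  have hg' : (⟨g, hg⟩ : N.commutant.toStarSubalgebra) ∈
      Submodule.span ℂ (unitary N.commutant.toStarSubalgebra : Set _) := hspan ▸ trivial
  refine Submodule.span_induction
    (p := fun (g : N.commutant.toStarSubalgebra) _ => (g : H →L[ℂ] H) * a = a * g)
    ?_ ?_ ?_ ?_ hg'
  · rintro w hw
    refine h w w.2 ?_
    rw [SetLike.mem_coe, Unitary.mem_iff] at hw
    rw [Unitary.mem_iff]
    exact ⟨congrArg Subtype.val hw.1, congrArg Subtype.val hw.2⟩
  · simp
  · intro x y _ _ hx hy
    simp [add_mul, mul_add, hx, hy]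
  · intro c x _ hx
    simp [hx]

theorem abs_mem (N : VonNeumannAlgebra H) {a : H →L[ℂ] H} (ha : a ∈ N) : CFC.abs a ∈ N := by
  rw [← N.commutant_commutant, VonNeumannAlgebra.mem_commutant_iff]
  intro g hg
  have h1 : Commute a g := VonNeumannAlgebra.mem_commutant_iff.1 hg a ha
  have h2 : Commute a (star g) := VonNeumannAlgebra.mem_commutant_iff.1 (star_mem hg) a ha
  exact (h1.cfcAbs_left h2).symm

theorem norm_abs_apply (a : H →L[ℂ] H) (ξ : H) : ‖CFC.abs a ξ‖ = ‖a ξ‖ := by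
  have h1 : ∀ b : H →L[ℂ] H, (‖b ξ‖ : ℝ) ^ 2 = RCLike.re (inner ℂ ((star b * b) ξ) ξ) := fun b => by
    rw [mul_apply_eq_comp, ContinuousLinearMap.star_eq_adjoint,
      ContinuousLinearMap.adjoint_inner_left, inner_self_eq_norm_sq]
  have h2 : star (CFC.abs a) * CFC.abs a = star a * a := by
    rw [(CFC.abs_nonneg a).star_eq, CFC.abs_mul_abs]
  rw [← sq_eq_sq₀ (norm_nonneg _) (norm_nonneg _), h1, h1, h2]

/-- Affiliation speaks only of unitaries. The symmetry 2z - 1 is one, and z is the mean of it and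
the identity. -/
theorem Affiliated.proj_mem_graph {N : VonNeumannAlgebra H} {x : H →ₗ.[ℂ] H} (hx : Affiliated N x)
    {z : H →L[ℂ] H} (hz : z ∈ N.commutant) (hz' : IsStarProjection z) {ξ η : H}
    (h : (ξ, η) ∈ x.graph) : (z ξ, z η) ∈ x.graph := by
  have hw : 2 * z - 1 ∈ N.commutant :=
    sub_mem (by rw [two_mul]; exact add_mem hz hz) (one_mem _)
  have hu := hz'.two_mul_sub_one_mem_unitary
  obtain ⟨ζ, rfl, rfl⟩ := (LinearPMap.mem_graph_iff _).1 h
  have h1 := hx.1 _ hw hu _ ζ.2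
  have h2 := hx.2 _ hw hu ζ ⟨_, h1⟩ rfl
  have h3 : ((2 * z - 1) (ζ : H), (2 * z - 1) (x ζ)) ∈ x.graph := by
    rw [← h2]; exact x.mem_graph ⟨_, h1⟩
  have h4 := x.graph.smul_mem (2⁻¹ : ℂ) (x.graph.add_mem h3 h)
  have h5 : ∀ v, (2⁻¹ : ℂ) • ((2 * z - 1) v + v) = z v := fun v => by
    have : (2 * z - 1) v + v = (2 : ℂ) • z v := by
      rw [two_mul]
      simp [two_smul]
    rw [this, smul_smul]
    simp
  simpa only [Prod.mk_add_mk, Prod.smul_mk, h5] using h4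

theorem graph_unique {x : H →ₗ.[ℂ] H} {ξ η ζ : H} (h : (ξ, η) ∈ x.graph)
    (h' : (ξ, ζ) ∈ x.graph) : η = ζ :=
  LinearPMap.mem_graph_snd_inj x h h' rfl

/-- A closed operator affiliated with `N`, defined on the ranges of the `p n`, is glued from
elements of `N`. -/
theorem exists_isGlued_of_affiliated {N : VonNeumannAlgebra H} {x : H →ₗ.[ℂ] H}
    {p : ℕ → H →L[ℂ] H} (hNM : ∀ a ∈ N, a ∈ M) (hcl : x.IsClosed) (hx : Affiliated N x)
    (hp : CentralChain M p) (hpN : ∀ n, p n ∈ N) (hpN' : ∀ n, p n ∈ N.commutant)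
    (hd : ∀ n ξ, p n ξ ∈ x.domain) : ∃ a, IsGlued M p a x ∧ ∀ n, a n ∈ N := by
  have hex : ∀ n, ∃ a : H →L[ℂ] H, ∀ ξ, (p n ξ, a ξ) ∈ x.graph := by
    intro n
    -- The composite of `x` with `p n` is everywhere defined and closed, so the closed graph theorem
    -- makes it bounded.
    let T : H →ₗ[ℂ] H := x.toFun.comp ((p n : H →ₗ[ℂ] H).codRestrict x.domain (hd n))
    have hT : ∀ ξ, (p n ξ, T ξ) ∈ x.graph := fun ξ => x.mem_graph ⟨p n ξ, hd n ξ⟩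
    have hTc : IsClosed (T.graph : Set (H × H)) := by
      have : (T.graph : Set (H × H)) = (fun v : H × H => (p n v.1, v.2)) ⁻¹' x.graph := by
        ext ⟨ξ, η⟩
        simp only [SetLike.mem_coe, LinearMap.mem_graph_iff, Set.mem_preimage]
        exact ⟨fun h => h ▸ hT ξ, fun h => graph_unique h (hT ξ)⟩
      rw [this]
      exact hcl.preimage (by fun_prop)
    exact ⟨ContinuousLinearMap.ofIsClosedGraph hTc, hT⟩
  choose a ha using hex
  have hmem : ∀ n, a n ∈ N := fun n => by
    refine mem_of_forall_unitary N fun w hw hu => ?_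
    ext ξ
    have h1 := hx.1 w hw hu _ (hd n ξ)
    have h2 := hx.2 w hw hu ⟨_, hd n ξ⟩ ⟨_, h1⟩ rfl
    have h3 : (w (p n ξ), w (a n ξ)) ∈ x.graph := by
      have h4 := graph_unique (x.mem_graph ⟨_, hd n ξ⟩) (ha n ξ)
      rw [← h4, ← h2]
      exact x.mem_graph ⟨_, h1⟩
    have h5 : w (p n ξ) = p n (w ξ) :=
      congrArg (fun T : H →L[ℂ] H => T ξ) (VonNeumannAlgebra.mem_commutant_iff.1 hw _ (hpN n)).symm
    rw [h5] at h3
    exact graph_unique h3 (ha n (w ξ))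
  exact ⟨a, .of_isClosed hp (fun n => hNM _ (hmem n)) hcl ha
    fun n ξ η h => hx.proj_mem_graph (hpN' n) (hp.proj n).2 h, hmem⟩

/-- The projection onto the closed linear span of the ranges of elements of `N` is in `N`. -/
theorem starProjection_iSup_range_mem (N : VonNeumannAlgebra H) {ι : Type*} (z : ι → H →L[ℂ] H)
    (hz : ∀ i, z i ∈ N) :
    (⨆ i, LinearMap.range (z i : H →ₗ[ℂ] H)).topologicalClosure.starProjection ∈ N := by
  rw [VonNeumannAlgebra.IsStarProjection.mem_iff isStarProjection_starProjection]
  intro y hy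
  rw [Submodule.range_starProjection]
  have h1 : ∀ ξ ∈ ⨆ i, LinearMap.range (z i : H →ₗ[ℂ] H),
      y ξ ∈ ⨆ i, LinearMap.range (z i : H →ₗ[ℂ] H) := by
    suffices h : (⨆ i, LinearMap.range (z i : H →ₗ[ℂ] H)) ≤
        (⨆ i, LinearMap.range (z i : H →ₗ[ℂ] H)).comap (y : H →ₗ[ℂ] H) from h
    refine iSup_le fun i => ?_
    rintro _ ⟨ξ, rfl⟩
    refine Submodule.mem_iSup_of_mem i ⟨y ξ, ?_⟩
    exact congrArg (fun T : H →L[ℂ] H => T ξ) (VonNeumannAlgebra.mem_commutant_iff.1 hy _ (hz i))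
  intro ξ hξ
  exact map_mem_closure y.continuous hξ h1

/-- The operator `x` is bounded by `s` on the range of `z`. -/
def BoundedOn (x : H →ₗ.[ℂ] H) (z : H →L[ℂ] H) (s : ℝ) : Prop :=
  ∀ ξ, ∃ η, (z ξ, η) ∈ x.graph ∧ ‖η‖ ≤ s * ‖ξ‖

theorem BoundedOn.mono {x : H →ₗ.[ℂ] H} {z : H →L[ℂ] H} {s t : ℝ} (h : BoundedOn x z s)
    (hst : s ≤ t) : BoundedOn x z t := fun ξ =>
  let ⟨η, h1, h2⟩ := h ξ
  ⟨η, h1, h2.trans (by gcongr)⟩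

theorem BoundedOn.of_le {x : H →ₗ.[ℂ] H} {z w : H →L[ℂ] H} {s : ℝ} (hs : 0 ≤ s)
    (h : BoundedOn x z s) (hw : IsStarProjection w) (hwz : z * w = w) : BoundedOn x w s := by
  intro ξ
  obtain ⟨η, h1, h2⟩ := h (w ξ)
  rw [← mul_apply_eq_comp, hwz] at h1
  refine ⟨η, h1, h2.trans ?_⟩
  gcongr
  simpa using w.le_of_opNorm_le hw.norm_le ξ

theorem norm_sq_eq_add {z : H →L[ℂ] H} (hz : IsStarProjection z) (ξ : H) :
    ‖ξ‖ ^ 2 = ‖z ξ‖ ^ 2 + ‖ξ - z ξ‖ ^ 2 := by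
  have h1 : inner ℂ (z ξ) (ξ - z ξ) = (0 : ℂ) := by
    have h2 : z (ξ - z ξ) = 0 := by
      rw [map_sub, ← mul_apply_eq_comp, hz.isIdempotentElem.eq, sub_self]
    conv_lhs => rw [← hz.isSelfAdjoint.star_eq, ContinuousLinearMap.star_eq_adjoint]
    rw [ContinuousLinearMap.adjoint_inner_left, ← ContinuousLinearMap.star_eq_adjoint,
      hz.isSelfAdjoint.star_eq, h2, inner_zero_right]
  have h2 := norm_add_sq_eq_norm_sq_add_norm_sq_of_inner_eq_zero _ _ h1
  rw [add_sub_cancel] at h2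
  nlinarith

/-- The vector splits into `z ξ` and `w (ξ - z ξ)`, which lie in the ranges of `z` and `1 - z`. By
`hinv` so do their images under `x`, and Pythagoras keeps the same constant `s`. This makes the
central projections with bound `s` a directed family. -/
theorem BoundedOn.sup {x : H →ₗ.[ℂ] H} {z w : H →L[ℂ] H} {s : ℝ} (hs : 0 ≤ s)
    (hinv : ∀ e, IsProj (center M) e → ∀ ξ η, (ξ, η) ∈ x.graph → (e ξ, e η) ∈ x.graph)
    (hz : IsProj (center M) z) (hw : IsProj (center M) w)
    (h : BoundedOn x z s) (h' : BoundedOn x w s) : BoundedOn x (1 - (1 - z) * (1 - w)) s := by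
  intro ξ
  have hcomm : w * z = z * w := mul_comm_of_mem_center hz.1 hw.1.1
  have hzz : ∀ v, z (z v) = z v := fun v => by
    rw [← mul_apply_eq_comp, hz.2.isIdempotentElem.eq]
  have hzw : ∀ v, w (z v) = z (w v) := fun v => by
    rw [← mul_apply_eq_comp, hcomm, mul_apply_eq_comp]
  have hww : ∀ v, w (w v) = w v := fun v => by
    rw [← mul_apply_eq_comp, hw.2.isIdempotentElem.eq]
  obtain ⟨η₁, h1, n1⟩ := h (z ξ)
  obtain ⟨η₂, h2, n2⟩ := h' (w (ξ - z ξ))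
  rw [hzz] at h1
  rw [hww] at h2
  have e1 : z η₁ = η₁ := by
    have := hinv z hz _ _ h1
    rw [hzz] at this
    exact graph_unique this h1
  have e2 : z η₂ = 0 := by
    have := hinv z hz _ _ h2
    rw [← hzw, map_sub, hzz, sub_self, map_zero] at this
    exact graph_unique this x.graph.zero_mem
  have hu : (1 - (1 - z) * (1 - w)) ξ = z ξ + w (ξ - z ξ) := by
    simp [sub_mul, hzw]
    abel
  refine ⟨η₁ + η₂, hu ▸ x.graph.add_mem h1 h2, ?_⟩
  have p1 := norm_sq_eq_add hz.2 (η₁ + η₂)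
  rw [map_add, e1, e2, add_zero, add_sub_cancel_left] at p1
  have p2 := norm_sq_eq_add hz.2 ξ
  have p3 : ‖w (ξ - z ξ)‖ ≤ ‖ξ - z ξ‖ := by
    simpa using w.le_of_opNorm_le hw.2.norm_le (ξ - z ξ)
  refine abs_le_of_sq_le_sq' ?_ (by positivity) |>.2
  have q1 := pow_le_pow_left₀ (norm_nonneg _) n1 2
  have q2 := pow_le_pow_left₀ (norm_nonneg _) (n2.trans (mul_le_mul_of_nonneg_left p3 hs)) 2
  rw [p1, mul_pow, p2]
  rw [mul_pow] at q1 q2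
  linarith

/-- For a closed operator commuting with the central projections, there is a largest central
projection on whose range it is bounded by `s`. -/
theorem exists_largest_boundedOn {x : H →ₗ.[ℂ] H} (hcl : x.IsClosed)
    (hinv : ∀ e, IsProj (center M) e → ∀ ξ η, (ξ, η) ∈ x.graph → (e ξ, e η) ∈ x.graph)
    {s : ℝ} (hs : 0 ≤ s) :
    ∃ e, IsProj (center M) e ∧ BoundedOn x e s ∧
      ∀ z, IsProj (center M) z → BoundedOn x z s → z ≤ e := by
  let S := {z : H →L[ℂ] H // IsProj (center M) z ∧ BoundedOn x z s}
  let K : Submodule ℂ H := ⨆ z : S, LinearMap.range ((z : H →L[ℂ] H) : H →ₗ[ℂ] H)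
  have hK : ∀ ξ ∈ K, ∃ η, (ξ, η) ∈ x.graph ∧ ‖η‖ ≤ s * ‖ξ‖ := by
    have : Nonempty S := ⟨0, ⟨zero_mem _, .zero _⟩, fun ξ =>
      ⟨0, by simp, by simp; positivity⟩⟩
    have hdir : Directed (· ≤ ·)
        fun z : S => LinearMap.range ((z : H →L[ℂ] H) : H →ₗ[ℂ] H) := by
      rintro ⟨z, hz, bz⟩ ⟨w, hw, bw⟩
      have hzz := hz.2.isIdempotentElem.eq
      have hww := hw.2.isIdempotentElem.eq
      have hc : w * z = z * w := mul_comm_of_mem_center hz.1 hw.1.1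
      refine ⟨⟨_, (hz.one_sub.mul hw.one_sub).one_sub, bz.sup hs hinv hz hw bw⟩, ?_, ?_⟩
      · rintro _ ⟨ξ, rfl⟩
        refine ⟨z ξ, congrArg (fun T : H →L[ℂ] H => T ξ) (?_ : (1 - (1 - z) * (1 - w)) * z = z)⟩
        have : (1 - w) * z = z * (1 - w) := by rw [sub_mul, mul_sub, one_mul, mul_one, hc]
        rw [sub_mul, mul_assoc, this, ← mul_assoc, sub_mul 1 z z, one_mul, hzz, sub_self, zero_mul,
          sub_zero]
      · rintro _ ⟨ξ, rfl⟩
        refine ⟨w ξ, congrArg (fun T : H →L[ℂ] H => T ξ) (?_ : (1 - (1 - z) * (1 - w)) * w = w)⟩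
        rw [sub_mul, mul_assoc, sub_mul 1 w w, one_mul, hww, sub_self, mul_zero, sub_zero]
    intro ξ hξ
    obtain ⟨⟨z, hz, bz⟩, ζ, rfl⟩ := (Submodule.mem_iSup_of_directed _ hdir).1 hξ
    obtain ⟨η, h1, h2⟩ := bz (z ζ)
    rw [← mul_apply_eq_comp, hz.2.isIdempotentElem.eq] at h1
    exact ⟨η, h1, h2⟩
  -- Closedness of `x` carries the bound from the span of the ranges to its closure, the range of
  -- the supremum.
  have hKc : ∀ ξ ∈ K.topologicalClosure, ∃ η, (ξ, η) ∈ x.graph ∧ ‖η‖ ≤ s * ‖ξ‖ := by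
    intro ξ hξ
    obtain ⟨v, hv, hlim⟩ := mem_closure_iff_seq_limit.1 hξ
    choose! T hT hTn using hK
    have hd : ∀ k l, ‖T (v k) - T (v l)‖ ≤ s * ‖v k - v l‖ := fun k l => by
      have h2 := x.graph.sub_mem (hT _ (hv k)) (hT _ (hv l))
      rw [← graph_unique (hT _ (K.sub_mem (hv k) (hv l))) h2]
      exact hTn _ (K.sub_mem (hv k) (hv l))
    have hcau : CauchySeq fun k => T (v k) := by
      have hvc := hlim.cauchySeq
      rw [Metric.cauchySeq_iff'] at hvc ⊢
      intro ε hε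
      -- The divisor is `s + 1` because `s` may be zero.
      obtain ⟨N, hN⟩ := hvc (ε / (s + 1)) (by positivity)
      refine ⟨N, fun n hn => ?_⟩
      rw [dist_eq_norm]
      have h1 := hN n hn
      rw [dist_eq_norm, lt_div_iff₀ (by positivity)] at h1
      refine (hd n N).trans_lt ?_
      nlinarith [norm_nonneg (v n - v N)]
    obtain ⟨η, hη⟩ := cauchySeq_tendsto_of_complete hcau
    refine ⟨η, ?_, ?_⟩
    · exact hcl.mem_of_tendsto (hlim.prodMk_nhds hη)
        (Filter.Eventually.of_forall fun k => hT _ (hv k))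
    · exact le_of_tendsto_of_tendsto' hη.norm (hlim.norm.const_mul s) fun k => hTn _ (hv k)
  refine ⟨K.topologicalClosure.starProjection, ⟨?_, isStarProjection_starProjection⟩, ?_, ?_⟩
  · exact starProjection_iSup_range_mem _ _ fun z => z.2.1.1
  · intro ξ
    obtain ⟨η, h1, h2⟩ := hKc _ (K.topologicalClosure.starProjection_apply_mem ξ)
    refine ⟨η, h1, h2.trans ?_⟩
    gcongr
    exact K.topologicalClosure.norm_starProjection_apply_le ξ
  · intro z hz bz
    rw [hz.2.le_iff_mul_eq_right isStarProjection_starProjection]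
    ext ξ
    refine Submodule.starProjection_eq_self_iff.2 ?_
    exact K.le_topologicalClosure (Submodule.mem_iSup_of_mem (⟨z, hz, bz⟩ : S) ⟨ξ, rfl⟩)

theorem IsGlued.boundedOn_iff {p a : ℕ → H →L[ℂ] H} {x : H →ₗ.[ℂ] H} (hx : IsGlued M p a x)
    {z : H →L[ℂ] H} {s : ℝ} (hs : 0 ≤ s) :
    BoundedOn x z s ↔ ∀ n, ‖a n * z‖ ≤ s := by
  constructor
  · intro h n
    refine ContinuousLinearMap.opNorm_le_bound _ hs fun ξ => ?_
    obtain ⟨η, h1, h2⟩ := h ξ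
    rw [mul_apply_eq_comp, (hx.graph _ _).1 h1 n]
    exact (hx.chain.norm_apply_le n η).trans h2
  · intro h ξ
    exact hx.exists_of_bounded fun n => (a n * z).le_of_opNorm_le (h n) ξ

theorem IsGlued.exists_largest {p a : ℕ → H →L[ℂ] H} {x : H →ₗ.[ℂ] H} (hx : IsGlued M p a x)
    {s : ℝ} (hs : 0 ≤ s) :
    ∃ e, IsProj (center M) e ∧ BoundedOn x e s ∧
      ∀ z, IsProj (center M) z → BoundedOn x z s → z ≤ e :=
  exists_largest_boundedOn hx.isClosed (fun _ he _ _ h => hx.center_graph he.1 h) hs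

theorem isMeasurableOp_ofBounded {a : H →L[ℂ] H} (ha : a ∈ M) : IsMeasurableOp M (ofBounded a) := by
  have h := IsGlued.ofBounded ha
  refine ⟨h.isClosed, h.affiliated (fun _ => one_mem _) (fun _ => ha), fun _ _ _ _ _ => trivial,
    fun _ => 1, fun _ => ⟨one_mem _, .one _⟩, fun _ _ _ => le_rfl,
    (CentralChain.one (M := M)).sup, fun _ _ => trivial, fun _ => ?_⟩
  rw [sub_self]
  refine ⟨⟨zero_mem _, .zero _⟩, fun w _ h1 _ => ?_⟩
  rw [CStarRing.star_mul_self_eq_zero_iff] at h1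
  rw [h1, zero_mul]

theorem IsGlued.strongMul_eq_ofBounded {p a : ℕ → H →L[ℂ] H} {x : H →ₗ.[ℂ] H}
    (hx : IsGlued M p a x) {c : H →L[ℂ] H} (hc : c ∈ M) {n : ℕ} (hn : c * p n = c) :
    CentralExtension.strongMul c x = CentralExtension.ofBounded (c * a n) := by
  refine (hx.strongMul hc).ext ?_
  have h := (IsGlued.ofBounded (mul_mem hc (hx.mem n))).refine hx.chain
  simp only [one_mul] at h
  convert h using 2 with m
  rcases le_total n m with hnm | hnm
  · conv_lhs => rw [← hn, mul_assoc, ← hx.chain.comm n (hx.mem m), hx.compat n m hnm]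
    rw [← hx.compat n n le_rfl, mul_assoc, mul_assoc, hx.chain.mul_of_le' hnm]
  · rw [mul_assoc, hx.compat m n hnm]

theorem IsGlued.strongMul_proj {p a : ℕ → H →L[ℂ] H} {x : H →ₗ.[ℂ] H} (hx : IsGlued M p a x)
    (n : ℕ) : CentralExtension.strongMul (p n) x = CentralExtension.ofBounded (a n) := by
  rw [hx.strongMul_eq_ofBounded (hx.chain.mem n) (hx.chain.mul_self n),
    ← hx.chain.comm n (hx.mem n), hx.compat n n le_rfl]

theorem IsGlued.isLocallyMeasurableOp {p a : ℕ → H →L[ℂ] H} {x : H →ₗ.[ℂ] H}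
    (hx : IsGlued M p a x) : IsLocallyMeasurableOp M x :=
  ⟨hx.isClosed, hx.affiliated hx.chain.mem hx.mem, p, hx.chain.proj, hx.chain.mono, hx.chain.sup,
    fun n => hx.strongMul_proj n ▸ isMeasurableOp_ofBounded (hx.mem n)⟩

/-- A strong product is a closure, so `(ξ, a ξ)` is only a limit of pairs `(α, z (x α))`. Applying
`z` to the first coordinates moves these pairs into the closed graph of `x`. -/
theorem mem_graph_of_strongMul_eq {x : H →ₗ.[ℂ] H} (hcl : x.IsClosed) {z a : H →L[ℂ] H}
    (hinv : ∀ ξ η, (ξ, η) ∈ x.graph → (z ξ, z η) ∈ x.graph)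
    (h : strongMul z x = ofBounded a) (ξ : H) : (z ξ, a ξ) ∈ x.graph := by
  have h1 : (ξ, a ξ) ∈ (strongMul z x).graph := by
    rw [h]; exact (ofBounded a).mem_graph ⟨ξ, trivial⟩
  have h2 : (strongMul z x).graph ≤
      (((z : H →ₗ[ℂ] H).compPMap x).graph).topologicalClosure := by
    unfold strongMul
    -- For a non-closable operator `LinearPMap.closure` is by convention the operator itself, and
    -- the inclusion still holds.
    by_cases hc : ((z : H →ₗ[ℂ] H).compPMap x).IsClosable
    · exact hc.graph_closure_eq_closure_graph.ge
    · rw [LinearPMap.closure_def' hc]; exact Submodule.le_topologicalClosure _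
  have h3 := h2 h1
  have hc : Continuous fun v : H × H => (z v.1, v.2) := by fun_prop
  refine hcl.closure_subset
    (map_mem_closure (f := fun v : H × H => (z v.1, v.2)) (t := x.graph) hc h3 ?_)
  rintro ⟨α, β⟩ hαβ
  obtain ⟨ζ, rfl, rfl⟩ := (LinearPMap.mem_graph_iff _).1 hαβ
  exact hinv _ _ (x.mem_graph ζ)

/-- The elements of the central extension are the glued operators. -/
theorem mem_centralExtension_iff {x : H →ₗ.[ℂ] H} :
    x ∈ centralExtension M ↔ ∃ p a, IsGlued M p a x := by
  constructor
  · rintro ⟨⟨hcl, haff, -⟩, I, z, hz, -, hsup, hb⟩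
    have hinv : ∀ e, IsProj (center M) e → ∀ ξ η, (ξ, η) ∈ x.graph → (e ξ, e η) ∈ x.graph :=
      fun e he ξ η h => haff.proj_mem_graph he.1.2 he.2 h
    -- The arbitrary family `z i` is replaced by a sequence: each `z i` lies below the largest
    -- central projection with bound `n`, as soon as `n` exceeds the norm of the bounded operator `z
    -- i x`.
    have hex : ∀ n : ℕ, _ := fun n =>
      exists_largest_boundedOn (M := M) hcl hinv (s := n) (Nat.cast_nonneg n)
    choose p hp hpb hpm using hex
    have hchain : CentralChain M p := by
      refine ⟨hp, fun n m h => hpm m _ (hp n) ((hpb n).mono (by exact_mod_cast h)), ?_⟩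
      rw [SupEqOne, eq_top_iff, ← hsup]
      refine Submodule.topologicalClosure_mono (iSup_le fun i => ?_)
      obtain ⟨a, ha, h⟩ := hb i
      obtain ⟨n, hn⟩ := exists_nat_ge ‖a‖
      have hbd : BoundedOn x (z i) n := fun ξ =>
        ⟨a ξ, mem_graph_of_strongMul_eq hcl (hinv _ (hz i)) h ξ, a.le_of_opNorm_le hn ξ⟩
      have hle := ((hz i).2.le_iff_mul_eq_right (hp n).2).1 (hpm n _ (hz i) hbd)
      refine le_trans ?_ (le_iSup (fun n => LinearMap.range (p n : H →ₗ[ℂ] H)) n)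
      rintro _ ⟨ξ, rfl⟩
      exact ⟨z i ξ, congrArg (fun T : H →L[ℂ] H => T ξ) hle⟩
    obtain ⟨a, ha, -⟩ := exists_isGlued_of_affiliated (M := M) (fun _ h => h) hcl haff hchain
      hchain.mem (fun n => (hp n).1.2)
      (fun n ξ => let ⟨η, h, _⟩ := hpb n ξ; LinearPMap.mem_domain_of_mem_graph h)
    exact ⟨p, a, ha⟩
  · rintro ⟨p, a, hx⟩
    have hp := hx.chain
    -- `r` is the chain shifted by one with `r 0 = 0`, so the `d n` below are the successive
    -- differences of the chain.
    let r : ℕ → H →L[ℂ] H := fun n => Nat.casesOn n 0 p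
    have hr : ∀ n, IsProj (center M) (r n) := fun n => by
      cases n with
      | zero => exact ⟨zero_mem _, .zero _⟩
      | succ n => exact hp.proj n
    let d : ℕ → H →L[ℂ] H := fun n => (1 - r n) * p n
    have hd : ∀ n, IsProj (center M) (d n) := fun n => (hr n).one_sub.mul (hp.proj n)
    have horth : ∀ n m, n < m → d m * d n = 0 := by
      intro n m h
      cases m with
      | zero => omega
      | succ m =>
        have h1 : d n = p n * (1 - r n) := (hp.comm n (hr n).one_sub.1.1)
        have h2 : (1 - p m) * p n = 0 := by
          rw [sub_mul, one_mul, hp.mul_of_le (by omega), sub_self]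
        change (1 - p m) * p (m + 1) * d n = 0
        rw [h1, mul_assoc, ← mul_assoc (p (m + 1)), hp.mul_of_le h.le, ← mul_assoc, h2, zero_mul]
    refine ⟨hx.isLocallyMeasurableOp, ULift ℕ, fun i => d i.down, fun i => hd _, ?_, ?_, ?_⟩
    · rintro ⟨i⟩ ⟨j⟩ hij
      have hij' : i ≠ j := fun h => hij (congrArg _ h)
      rcases lt_or_gt_of_ne hij' with h | h
      · rw [← mul_comm_of_mem_center (hd i).1 (hd j).1.1]; exact horth i j h
      · exact horth j i h
    · rw [SupEqOne, eq_top_iff, ← hp.sup]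
      refine Submodule.topologicalClosure_mono (iSup_le fun n => ?_)
      have hmem : ∀ n ξ, d n ξ ∈ ⨆ i : ULift ℕ, LinearMap.range (d i.down : H →ₗ[ℂ] H) :=
        fun n ξ => Submodule.mem_iSup_of_mem ⟨n⟩ ⟨ξ, rfl⟩
      rintro _ ⟨ξ, rfl⟩
      change p n ξ ∈ _
      induction n with
      | zero => simpa [d, r] using hmem 0 ξ
      | succ n ih =>
        have : p (n + 1) ξ = d (n + 1) ξ + p n ξ := by
          have h1 : p n * p (n + 1) = p n := hp.mul_of_le' n.le_succ
          have h2 : d (n + 1) = p (n + 1) - p n := by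
            change (1 - p n) * p (n + 1) = _
            rw [sub_mul, one_mul, h1]
          rw [h2]; simp
        rw [this]
        exact Submodule.add_mem _ (hmem _ _) ih
    · rintro ⟨n⟩
      refine ⟨_, mul_mem (hd n).1.1 (hx.mem n), hx.strongMul_eq_ofBounded (hd n).1.1 ?_⟩
      change (1 - r n) * p n * p n = _
      rw [mul_assoc, hp.mul_self]

/-- The measurable operators with respect to the center are the operators glued from central
elements. -/
theorem isMeasurableOp_center_iff {f : H →ₗ.[ℂ] H} :
    IsMeasurableOp (center M) f ↔ ∃ p c, IsGlued M p c f ∧ ∀ n, c n ∈ center M := by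
  have hcc : ∀ a ∈ center M, a ∈ (center M).commutant := fun a ha =>
    VonNeumannAlgebra.mem_commutant_iff.2 fun g hg => mul_comm_of_mem_center ha hg.1
  constructor
  · rintro ⟨hcl, haff, -, p, hp, hm, hs, hd, -⟩
    have hch : CentralChain M p := ⟨hp, hm, hs⟩
    obtain ⟨c, h1, h2⟩ := exists_isGlued_of_affiliated (M := M) (N := center M) (fun _ h => h.1)
      hcl haff hch (fun n => (hp n).1) (fun n => hcc _ (hp n).1) hd
    exact ⟨p, c, h1, h2⟩
  · rintro ⟨p, c, h, hc⟩
    have haff := h.affiliated (fun n => (h.chain.proj n).1) hc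
    refine ⟨h.isClosed, haff, haff.1, p, h.chain.proj, h.chain.mono, h.chain.sup, h.mem_domain,
      fun n => ⟨(h.chain.proj n).one_sub, fun w hw h1 _ => ?_⟩⟩
    -- Every projection of an abelian algebra is finite, since `w` commutes with its adjoint.
    rw [← h1]
    exact mul_comm_of_mem_center (star_mem hw) hw.1

theorem abs_mul_proj {a z : H →L[ℂ] H} (ha : a ∈ M) (hz : IsProj (center M) z) :
    CFC.abs (a * z) = CFC.abs a * z := by
  have h : Commute a z := mul_comm_of_mem_center hz.1 ha
  rw [h.cfcAbs_mul_eq (by rwa [hz.2.isSelfAdjoint.star_eq]), CFC.abs_of_nonneg z hz.2.nonneg]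

/-- The modulus of a glued operator is glued from the moduli. -/
theorem IsGlued.isModulus_iff {p a : ℕ → H →L[ℂ] H} {x h : H →ₗ.[ℂ] H} (hx : IsGlued M p a x) :
    IsModulus M x h ↔ IsGlued M p (fun n => CFC.abs (a n)) h := by
  have hsq : ∀ n, star (CFC.abs (a n)) * CFC.abs (a n) = star (a n) * a n := fun n => by
    rw [(CFC.abs_nonneg _).star_eq, CFC.abs_mul_abs]
  constructor
  · rintro ⟨⟨hcl, haff, -⟩, hpos, hg⟩
    -- `w` is the operator x* x, which is also h². Its domain contains the ranges of the `p n`,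
    -- hence so does the domain of `h`.
    obtain ⟨w, hw⟩ := exists_isGlued (a := fun n => star (a n) * a n) hx.chain
      (fun n => mul_mem (star_mem (hx.mem n)) (hx.mem n)) fun n m hnm => by
        rw [mul_assoc, hx.compat n m hnm, ← hx.compat n n le_rfl, hx.chain.comm n (hx.mem n),
          ← mul_assoc, hx.adjoint.compat n m hnm, ← hx.chain.comm n (hx.mem n),
          hx.compat n n le_rfl]
    have hd : ∀ n ξ, p n ξ ∈ h.domain := fun n ξ => by
      have h1 := (hw.graph _ _).1 (hw.mem_graph n ξ)
      obtain ⟨η, h2, -⟩ := (hg _ _).2 ((hx.adjoint_comp_self _ _).2 h1)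
      exact LinearPMap.mem_domain_of_mem_graph h2
    obtain ⟨b, hb, -⟩ := exists_isGlued_of_affiliated (M := M) (fun _ h => h) hcl haff hx.chain
      hx.chain.mem (fun n => (hx.chain.proj n).1.2) hd
    have hb0 := hb.isPositiveOp_iff.1 hpos
    have : b = fun n => CFC.abs (a n) := by
      funext n
      -- Each piece of `h` is a positive square root of `star (a n) * a n`, and such a root is
      -- unique.
      refine (CFC.sqrt_unique ?_ (hb0 n)).symm
      ext ξ
      have hsa : h.adjoint = h := LinearPMap.isSelfAdjoint_def.1 hpos.1
      have h1 := hb.mem_graph n ξ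
      have h2 : (b n ξ, b n (b n ξ)) ∈ h.graph := by
        simpa [hb.proj_apply] using hb.mem_graph n (b n ξ)
      obtain ⟨hh⟩ : Nonempty (∃ η, (p n ξ, η) ∈ h.graph ∧ (η, b n (b n ξ)) ∈ h.graph) :=
        ⟨_, h1, h2⟩
      have h3 := (hx.adjoint_comp_self _ _).1 ((hg _ _).1 hh) n
      rw [hb.proj_apply le_rfl, mul_apply_eq_comp, hx.apply_proj le_rfl] at h3
      exact h3.symm
    exact this ▸ hb
  · intro hh
    have hpos : IsPositiveOp h := hh.isPositiveOp_iff.2 fun n => CFC.abs_nonneg _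
    refine ⟨hh.isLocallyMeasurableOp, hpos, fun ξ ζ => ?_⟩
    rw [hx.adjoint_comp_self]
    have := hh.adjoint_comp_self ξ ζ
    rw [LinearPMap.isSelfAdjoint_def.1 hpos.1] at this
    simpa only [hsq] using this

theorem IsGlued.exists_modulus {p a : ℕ → H →L[ℂ] H} {x : H →ₗ.[ℂ] H} (hx : IsGlued M p a x) :
    ∃ h, IsGlued M p (fun n => CFC.abs (a n)) h :=
  exists_isGlued hx.chain (fun n => abs_mem M (hx.mem n)) fun n m hnm => by
    rw [← hx.compat n m hnm, abs_mul_proj (hx.mem m) (hx.chain.proj n)]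

end Extension

/-! ### Dictionary between central operators and measurable functions -/

section Functions

open scoped ComplexOrder

variable {H : Type u} [NormedAddCommGroup H] [InnerProductSpace ℂ H] [CompleteSpace H]
variable {M : VonNeumannAlgebra H}
variable {Ω : Type v} [MeasurableSpace Ω] {μ : Measure Ω} {Φ : CenterIso M μ}

theorem sqrt_mem (N : VonNeumannAlgebra H) {a : H →L[ℂ] H} (ha : a ∈ N) : CFC.sqrt a ∈ N := by
  rw [← N.commutant_commutant, VonNeumannAlgebra.mem_commutant_iff]
  intro g hg
  have h1 : Commute a g := VonNeumannAlgebra.mem_commutant_iff.1 hg a ha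
  exact (h1.cfcₙ_nnreal _).symm

/-- The central element `c` corresponds to (the class of) the function `f`. -/
def Rep (Φ : CenterIso M μ) (c : H →L[ℂ] H) (f : Ω → ℂ) : Prop :=
  ∃ hc : c ∈ (center M).toStarSubalgebra, (Φ.toFun ⟨c, hc⟩ : Ω → ℂ) =ᵐ[μ] f

namespace Rep

variable {c d : H →L[ℂ] H} {f g : Ω → ℂ}

theorem mem (h : Rep Φ c f) : c ∈ center M := h.1

theorem congr (h : Rep Φ c f) (hfg : f =ᵐ[μ] g) : Rep Φ c g := ⟨h.1, h.2.trans hfg⟩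

theorem ae_eq (h : Rep Φ c f) (h' : Rep Φ c g) : f =ᵐ[μ] g := h.2.symm.trans h'.2

theorem inj (h : Rep Φ c f) (h' : Rep Φ d f) : c = d :=
  congrArg Subtype.val (Φ.injective (AEEqFun.ext (h.2.trans h'.2.symm)))

theorem add (h : Rep Φ c f) (h' : Rep Φ d g) : Rep Φ (c + d) (fun ω => f ω + g ω) := by
  obtain ⟨hc, hf⟩ := h
  obtain ⟨hd, hg⟩ := h'
  refine ⟨add_mem hc hd, ?_⟩
  have := Φ.map_add ⟨c, hc⟩ ⟨d, hd⟩
  change Φ.toFun ⟨c + d, _⟩ = _ at this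
  rw [this]
  exact (AEEqFun.coeFn_add _ _).trans (hf.add hg)

theorem mul (h : Rep Φ c f) (h' : Rep Φ d g) : Rep Φ (c * d) (fun ω => f ω * g ω) := by
  obtain ⟨hc, hf⟩ := h
  obtain ⟨hd, hg⟩ := h'
  refine ⟨mul_mem hc hd, ?_⟩
  have := Φ.map_mul ⟨c, hc⟩ ⟨d, hd⟩
  change Φ.toFun ⟨c * d, _⟩ = _ at this
  rw [this]
  exact (AEEqFun.coeFn_mul _ _).trans (hf.mul hg)

theorem smul (k : ℂ) (h : Rep Φ c f) : Rep Φ (k • c) (fun ω => k * f ω) := by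
  obtain ⟨hc, hf⟩ := h
  refine ⟨(center M).toStarSubalgebra.smul_mem hc k, ?_⟩
  have := Φ.map_smul k ⟨c, hc⟩
  change Φ.toFun ⟨k • c, _⟩ = _ at this
  rw [this]
  refine (AEEqFun.coeFn_smul _ _).trans ?_
  filter_upwards [hf] with ω hω
  simp [hω]

theorem star (h : Rep Φ c f) : Rep Φ (star c) (fun ω => star (f ω)) := by
  obtain ⟨hc, hf⟩ := h
  refine ⟨star_mem hc, ?_⟩
  have := Φ.map_star ⟨c, hc⟩
  change Φ.toFun ⟨Star.star c, _⟩ = _ at this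
  rw [this]
  refine (AEEqFun.coeFn_star _).trans ?_
  filter_upwards [hf] with ω hω
  simp [hω]

theorem sub (h : Rep Φ c f) (h' : Rep Φ d g) : Rep Φ (c - d) (fun ω => f ω - g ω) := by
  have := h.add (h'.smul (-1))
  simpa [sub_eq_add_neg] using this

theorem zero : Rep Φ (0 : H →L[ℂ] H) (fun _ : Ω => (0 : ℂ)) := by
  have h : Rep Φ (0 : H →L[ℂ] H) (Φ.toFun ⟨0, zero_mem _⟩) := ⟨zero_mem _, ae_eq_rfl⟩
  simpa using h.smul 0

end Rep

theorem exists_rep (Φ : CenterIso M μ) {c : H →L[ℂ] H} (hc : c ∈ center M) :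
    ∃ f : Ω → ℂ, Measurable f ∧ Rep Φ c f ∧ ∃ C : ℝ, ∀ᵐ ω ∂μ, ‖f ω‖ ≤ C := by
  refine ⟨Φ.toFun ⟨c, hc⟩, AEEqFun.measurable _, ⟨hc, ae_eq_rfl⟩, ?_⟩
  have h : Φ.toFun ⟨c, hc⟩ ∈ {f : Ω →ₘ[μ] ℂ | eLpNorm f ∞ μ < ∞} := by
    rw [← Φ.range_eq]; exact ⟨_, rfl⟩
  refine ⟨(eLpNorm (Φ.toFun ⟨c, hc⟩) ∞ μ).toReal, ?_⟩
  rw [Set.mem_ofPred_eq, eLpNorm_exponent_top] at h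
  filter_upwards [enorm_ae_le_eLpNormEssSup (Φ.toFun ⟨c, hc⟩ : Ω → ℂ) μ] with ω hω
  rw [eLpNorm_exponent_top, ← toReal_enorm]
  exact ENNReal.toReal_mono h.ne hω

theorem exists_rep_of_bounded (Φ : CenterIso M μ) {f : Ω → ℂ} (hf : AEStronglyMeasurable f μ)
    {C : ℝ} (hC : ∀ᵐ ω ∂μ, ‖f ω‖ ≤ C) : ∃ c, Rep Φ c f := by
  have h : AEEqFun.mk f hf ∈ {f : Ω →ₘ[μ] ℂ | eLpNorm f ∞ μ < ∞} := by
    rw [Set.mem_ofPred_eq, eLpNorm_congr_ae (AEEqFun.coeFn_mk f hf)]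
    exact (memLp_top_of_bound hf C hC).2
  rw [← Φ.range_eq] at h
  obtain ⟨⟨c, hc⟩, h⟩ := h
  exact ⟨c, hc, h ▸ AEEqFun.coeFn_mk f hf⟩

namespace Rep

variable {c d : H →L[ℂ] H} {f g : Ω → ℂ}

/-- Preservation of the unit is not among the fields of `CenterIso`. It follows from surjectivity:
the preimage `c` of the constant 1 satisfies 1 * c = c. -/
theorem one : Rep Φ (1 : H →L[ℂ] H) (fun _ : Ω => (1 : ℂ)) := by
  obtain ⟨c, hc⟩ := exists_rep_of_bounded Φ (f := fun _ => (1 : ℂ)) aestronglyMeasurable_const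
    (C := 1) (by simp)
  obtain ⟨f, -, hf, -⟩ := exists_rep Φ (one_mem (center M))
  have h1 := hf.mul hc
  rw [one_mul] at h1
  have h2 : f =ᵐ[μ] fun _ => 1 := by
    filter_upwards [h1.ae_eq hc] with ω hω
    simpa using hω
  exact hf.congr h2

/-- `Φ` is only assumed to be algebraic. Positivity passes through it because on both sides the
positive elements are those of the form d* d, with square roots available in the center and in L^∞.
-/
theorem nonneg_iff (h : Rep Φ c f) : 0 ≤ c ↔ ∀ᵐ ω ∂μ, 0 ≤ f ω := by
  constructor
  · intro hc
    obtain ⟨g, -, hg, -⟩ := exists_rep Φ (sqrt_mem _ h.mem)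
    have h1 := hg.star.mul hg
    rw [(CFC.sqrt_nonneg c).star_eq, CFC.sqrt_mul_sqrt_self c] at h1
    filter_upwards [h.ae_eq h1] with ω hω
    rw [hω]
    exact star_mul_self_nonneg _
  · intro hf
    obtain ⟨f', hm, hf', C, hC⟩ := exists_rep Φ h.mem
    obtain ⟨d, hd⟩ := exists_rep_of_bounded Φ (f := fun ω => ((Real.sqrt (f' ω).re : ℝ) : ℂ))
      (by fun_prop) (C := Real.sqrt C) (by
        filter_upwards [hC] with ω hω
        rw [Complex.norm_real, Real.norm_of_nonneg (Real.sqrt_nonneg _)]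
        exact Real.sqrt_le_sqrt ((Complex.re_le_norm _).trans hω))
    have h1 : c = Star.star d * d := by
      refine (hf'.congr ?_).inj (hd.star.mul hd)
      filter_upwards [hf, h.ae_eq hf'] with ω h0 h1
      rw [h1] at h0
      obtain ⟨h2, h3⟩ := Complex.nonneg_iff.1 h0
      apply Complex.ext
      · simp [Real.mul_self_sqrt h2]
      · simp [← h3]
    rw [h1]
    exact star_mul_self_nonneg _

theorem le_iff (h : Rep Φ c f) (h' : Rep Φ d g) : c ≤ d ↔ ∀ᵐ ω ∂μ, f ω ≤ g ω := by
  rw [← sub_nonneg, (h'.sub h).nonneg_iff]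
  simp only [sub_nonneg]

end Rep

/-- The central element `z` corresponds to the indicator function of the measurable set `B`. -/
def RepSet (Φ : CenterIso M μ) (z : H →L[ℂ] H) (B : Set Ω) : Prop :=
  MeasurableSet B ∧ Rep Φ z (B.indicator fun _ => 1)

theorem exists_repSet (Φ : CenterIso M μ) {B : Set Ω} (hB : MeasurableSet B) :
    ∃ z, RepSet Φ z B := by
  obtain ⟨z, hz⟩ := exists_rep_of_bounded Φ (f := B.indicator fun _ => (1 : ℂ))
    (aestronglyMeasurable_const.indicator hB) (C := 1) (Filter.Eventually.of_forall fun ω => by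
      by_cases h : ω ∈ B <;> simp [h])
  exact ⟨z, hB, hz⟩

theorem exists_set_of_isProj (Φ : CenterIso M μ) {z : H →L[ℂ] H} (hz : IsProj (center M) z) :
    ∃ B, RepSet Φ z B := by
  obtain ⟨f, hm, hf, -⟩ := exists_rep Φ hz.1
  refine ⟨f ⁻¹' {1}, hm (measurableSet_singleton 1), hf.congr ?_⟩
  have h1 := hf.mul hf
  rw [hz.2.isIdempotentElem.eq] at h1
  filter_upwards [h1.ae_eq hf] with ω hω
  by_cases h : f ω = 1
  · simp [h]
  · have h0 : f ω = 0 := by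
      by_contra h0
      exact h (mul_left_cancel₀ h0 (hω.trans (mul_one _).symm))
    rw [Set.indicator_of_notMem (by simpa using h), h0]

namespace RepSet

variable {z w : H →L[ℂ] H} {B C : Set Ω}

theorem isProj (h : RepSet Φ z B) : IsProj (center M) z := by
  refine ⟨h.2.mem, (h.2.mul h.2).inj (h.2.congr ?_), h.2.star.inj (h.2.congr ?_)⟩
  all_goals
    refine Filter.Eventually.of_forall fun ω => ?_
    by_cases hω : ω ∈ B <;> simp [hω]

theorem le_iff (h : RepSet Φ z B) (h' : RepSet Φ w C) : z ≤ w ↔ ∀ᵐ ω ∂μ, ω ∈ B → ω ∈ C := by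
  rw [h.2.le_iff h'.2]
  refine Filter.eventually_congr (Filter.Eventually.of_forall fun ω => ?_)
  by_cases hB : ω ∈ B <;> by_cases hC : ω ∈ C <;> simp [hB, hC, Complex.le_def]

theorem mul (h : RepSet Φ z B) (h' : RepSet Φ w C) : RepSet Φ (z * w) (B ∩ C) := by
  refine ⟨h.1.inter h'.1, (h.2.mul h'.2).congr (Filter.Eventually.of_forall fun ω => ?_)⟩
  by_cases hB : ω ∈ B <;> by_cases hC : ω ∈ C <;> simp [hB, hC]

theorem one_sub (h : RepSet Φ z B) : RepSet Φ (1 - z) Bᶜ := by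
  refine ⟨h.1.compl, (Rep.one.sub h.2).congr (Filter.Eventually.of_forall fun ω => ?_)⟩
  by_cases hB : ω ∈ B <;> simp [hB]

theorem eq_zero_iff (h : RepSet Φ z B) : z = 0 ↔ μ B = 0 := by
  have h1 : z = 0 ↔ z ≤ 0 := ⟨fun h => h.le, fun h' => le_antisymm h' h.isProj.2.nonneg⟩
  rw [h1, h.2.le_iff Rep.zero, measure_eq_zero_iff_ae_notMem]
  refine Filter.eventually_congr (Filter.Eventually.of_forall fun ω => ?_)
  by_cases hB : ω ∈ B <;> simp [hB, Complex.le_def]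

theorem rep_mul {c : H →L[ℂ] H} {f : Ω → ℂ} (h : RepSet Φ z B) (hc : Rep Φ c f) :
    Rep Φ (c * z) (B.indicator f) := by
  refine (hc.mul h.2).congr (Filter.Eventually.of_forall fun ω => ?_)
  by_cases hB : ω ∈ B <;> simp [hB]

end RepSet

/-- The sets corresponding to a central chain cover the space up to a null set. -/
theorem CentralChain.ae_mem {p : ℕ → H →L[ℂ] H} (hp : CentralChain M p) {P : ℕ → Set Ω}
    (hP : ∀ n, RepSet Φ (p n) (P n)) : ∀ᵐ ω ∂μ, ∃ n, ω ∈ P n := by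
  -- `z` is the projection of the uncovered set; it annihilates every `p n` and therefore vanishes
  -- in the strong limit.
  obtain ⟨z, hz⟩ := exists_repSet Φ (MeasurableSet.iUnion fun n => (hP n).1).compl
  have h0 : ∀ n, z * p n = 0 := fun n => by
    rw [(hz.mul (hP n)).eq_zero_iff]
    convert measure_empty (μ := μ)
    ext ω
    simp only [Set.mem_inter_iff, Set.mem_compl_iff, Set.mem_iUnion, Set.mem_empty_iff_false,
      iff_false]
    exact fun h => h.1 ⟨n, h.2⟩
  have hz0 : z = 0 := by
    ext ξ
    refine tendsto_nhds_unique ((z.continuous.tendsto ξ).comp (hp.tendsto ξ)) ?_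
    have : ∀ n, (z ∘ fun n => p n ξ) n = 0 := fun n =>
      congrArg (fun T : H →L[ℂ] H => T ξ) (h0 n)
    exact (Filter.tendsto_congr this).2 tendsto_const_nhds
  rw [hz.eq_zero_iff, measure_eq_zero_iff_ae_notMem] at hz0
  filter_upwards [hz0] with ω hω
  simpa using hω

/-- The complement of the supremum is a central projection annihilating every `p n`. Its set meets
each `P n` in a null set, and the `P n` cover the space. -/
theorem centralChain_of_sets {p : ℕ → H →L[ℂ] H} {P : ℕ → Set Ω}
    (hP : ∀ n, RepSet Φ (p n) (P n)) (hm : Monotone P) (hU : ∀ ω, ∃ n, ω ∈ P n) :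
    CentralChain M p := by
  refine ⟨fun n => (hP n).isProj, fun n m h => ((hP n).le_iff (hP m)).2
    (Filter.Eventually.of_forall fun ω => @hm _ _ h ω), ?_⟩
  have he := starProjection_iSup_range_mem (center M) p fun n => (hP n).isProj.1
  rw [SupEqOne]
  set K := (⨆ i, LinearMap.range (p i : H →ₗ[ℂ] H)) with hK
  have hep : ∀ n, K.topologicalClosure.starProjection * p n = p n := fun n => by
    ext ξ
    refine Submodule.starProjection_eq_self_iff.2 ?_
    exact K.le_topologicalClosure (Submodule.mem_iSup_of_mem n ⟨ξ, rfl⟩)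
  obtain ⟨E, hE⟩ := exists_set_of_isProj Φ
    (IsProj.one_sub ⟨he, isStarProjection_starProjection⟩)
  have h1 : ∀ n, μ (E ∩ P n) = 0 := fun n => by
    rw [← (hE.mul (hP n)).eq_zero_iff, sub_mul, one_mul, hep, sub_self]
  have h2 : 1 - K.topologicalClosure.starProjection = 0 := by
    rw [hE.eq_zero_iff]
    refine measure_mono_null (fun ω hω => ?_) (measure_iUnion_null h1)
    obtain ⟨n, hn⟩ := hU ω
    exact Set.mem_iUnion.2 ⟨n, hω, hn⟩
  rw [eq_top_iff]
  intro ξ _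
  rw [← Submodule.starProjection_eq_self_iff, ← sub_eq_zero.1 h2]
  rfl

/-- A nonnegative measurable function gives an operator glued from central elements. -/
theorem exists_isGlued_of_function (Φ : CenterIso M μ) {G : Ω → ℝ} (hG : Measurable G)
    (hG0 : ∀ ω, 0 ≤ G ω) :
    ∃ q c f, IsGlued M q c f ∧ (∀ n : ℕ, RepSet Φ (q n) {ω | G ω ≤ n}) ∧
      ∀ n : ℕ, Rep Φ (c n) ({ω | G ω ≤ n}.indicator fun ω => (G ω : ℂ)) := by
  have hQ : ∀ n : ℕ, MeasurableSet {ω | G ω ≤ n} := fun n => measurableSet_le hG measurable_const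
  choose q hq using fun n => exists_repSet Φ (hQ n)
  have hex : ∀ n : ℕ, ∃ c, Rep Φ c ({ω | G ω ≤ n}.indicator fun ω => (G ω : ℂ)) := fun n => by
    refine exists_rep_of_bounded Φ (C := n) ?_ (Filter.Eventually.of_forall fun ω => ?_)
    · exact ((Complex.measurable_ofReal.comp hG).indicator (hQ n)).aestronglyMeasurable
    · by_cases h : G ω ≤ n
      · simp [h, abs_of_nonneg (hG0 ω)]
      · simp [h]
  choose c hc using hex
  have hch : CentralChain M q := by
    refine centralChain_of_sets hq (fun n m h ω hω => ?_) fun ω => exists_nat_ge (G ω)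
    have h1 : (n : ℝ) ≤ m := by exact_mod_cast h
    exact (show G ω ≤ n from hω).trans h1
  obtain ⟨f, hf⟩ := exists_isGlued hch (fun n => (hc n).mem.1) fun n m h => by
    refine ((hq n).rep_mul (hc m)).inj ((hc n).congr (Filter.Eventually.of_forall fun ω => ?_))
    by_cases h1 : G ω ≤ n
    · have h2 : G ω ≤ m := h1.trans (by exact_mod_cast h)
      simp [h1, h2]
    · simp [h1]
  exact ⟨q, c, f, hf, hq, hc⟩

theorem Represents.rep {q c : ℕ → H →L[ℂ] H} {f : H →ₗ.[ℂ] H} {g : Ω →ₘ[μ] ℂ}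
    (h : Represents Φ f g) (hf : IsGlued M q c f) (hc : ∀ n, c n ∈ center M) {Q : ℕ → Set Ω}
    (hQ : ∀ n, RepSet Φ (q n) (Q n)) (n : ℕ) : Rep Φ (c n) ((Q n).indicator g) := by
  have h1 := h ⟨q n, (hQ n).isProj.1⟩ ⟨c n, hc n⟩ (hQ n).isProj.2 (hf.strongMul_proj n)
  refine ⟨hc n, ?_⟩
  rw [h1]
  refine (AEEqFun.coeFn_mul _ _).trans ?_
  filter_upwards [(hQ n).2.2] with ω hω
  rw [Pi.mul_apply, hω]
  by_cases hQ' : ω ∈ Q n <;> simp [hQ']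

/-- `Represents` quantifies over all central `z` with `z f` bounded, but one chain suffices:
comparing `a * q n` with `z * c n` gives the identity on each `Q n`, and these sets cover almost
everything. -/
theorem represents_of_rep {q c : ℕ → H →L[ℂ] H} {f : H →ₗ.[ℂ] H} {g : Ω →ₘ[μ] ℂ}
    (hf : IsGlued M q c f) {Q : ℕ → Set Ω} (hQ : ∀ n, RepSet Φ (q n) (Q n))
    (h : ∀ n, Rep Φ (c n) ((Q n).indicator g)) : Represents Φ f g := by
  rintro ⟨z, hz⟩ ⟨a, ha⟩ - hza
  have h1 := hf.strongMul hz.1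
  have h2 := (IsGlued.ofBounded ha.1).refine hf.chain
  simp only [one_mul] at h2
  change CentralExtension.strongMul z f = _ at hza
  rw [hza] at h1
  have h3 : ∀ n, a * q n = z * c n := congrFun (h2.eq_of_eq h1)
  have hz' : Rep Φ z (Φ.toFun ⟨z, hz⟩) := ⟨hz, ae_eq_rfl⟩
  have ha' : Rep Φ a (Φ.toFun ⟨a, ha⟩) := ⟨ha, ae_eq_rfl⟩
  refine AEEqFun.ext (Filter.EventuallyEq.trans ?_ (AEEqFun.coeFn_mul _ _).symm)
  have h4 : ∀ᵐ ω ∂μ, ∀ n, ω ∈ Q n → (Φ.toFun ⟨a, ha⟩ : Ω → ℂ) ω = Φ.toFun ⟨z, hz⟩ ω * g ω := by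
    refine ae_all_iff.2 fun n => ?_
    have h5 := (hQ n).rep_mul ha'
    rw [h3 n] at h5
    filter_upwards [h5.ae_eq (hz'.mul (h n))] with ω hω hQω
    simpa [hQω] using hω
  filter_upwards [h4, hf.chain.ae_mem hQ] with ω h5 ⟨n, hn⟩
  exact h5 n hn

end Functions

/-! ### The center-valued norm and the basic neighborhoods -/

section CenterNorm

open scoped ComplexOrder

variable {H : Type u} [NormedAddCommGroup H] [InnerProductSpace ℂ H] [CompleteSpace H]
variable {M : VonNeumannAlgebra H}
variable {Ω : Type v} [MeasurableSpace Ω] {μ : Measure Ω} {Φ : CenterIso M μ}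

theorem mul_proj_le {a b z : H →L[ℂ] H} (ha : a ∈ M) (hb : b ∈ M) (hz : IsProj (center M) z)
    (h : a ≤ b) : a * z ≤ b * z := by
  have h1 := star_left_conjugate_nonneg (sub_nonneg.2 h) z
  rw [hz.2.isSelfAdjoint.star_eq, ← mul_comm_of_mem_center hz.1 (sub_mem hb ha), mul_assoc,
    hz.2.isIdempotentElem.eq, sub_mul] at h1
  exact sub_nonneg.1 h1

theorem norm_abs (a : H →L[ℂ] H) : ‖CFC.abs a‖ = ‖a‖ := by
  apply le_antisymm <;> refine ContinuousLinearMap.opNorm_le_bound _ (norm_nonneg _) fun ξ => ?_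
  · rw [norm_abs_apply]; exact a.le_opNorm ξ
  · rw [← norm_abs_apply]; exact (CFC.abs a).le_opNorm ξ

/-- The norm of an operator is that of its modulus, and for a positive operator it is at most `s`
iff the operator lies below `s` times the identity. The order form can be compared with central
functions. -/
theorem norm_mul_proj_le_iff {a z : H →L[ℂ] H} (ha : a ∈ M) (hz : IsProj (center M) z) {s : ℝ}
    (hs : 0 ≤ s) : ‖a * z‖ ≤ s ↔ CFC.abs a * z ≤ (s : ℂ) • z := by
  have hs1 : algebraMap ℝ (H →L[ℂ] H) s = (s : ℂ) • 1 := by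
    rw [Algebra.algebraMap_eq_smul_one]
    exact (Complex.coe_smul s (1 : H →L[ℂ] H)).symm
  have hle : (s : ℂ) • z ≤ (s : ℂ) • 1 := smul_le_smul_of_nonneg_left hz.2.le_one (by simpa using hs)
  rw [← norm_abs, abs_mul_proj ha hz, CStarAlgebra.norm_le_iff_le_algebraMap _ hs
    (abs_mul_proj ha hz ▸ CFC.abs_nonneg _), hs1]
  refine ⟨fun h => ?_, fun h => h.trans hle⟩
  have := mul_proj_le (mul_mem (abs_mem M ha) hz.1.1) (smul_mem_vN M _ (one_mem M)) hz h
  rwa [mul_assoc, hz.2.isIdempotentElem.eq, smul_mul_assoc, one_mul] at this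

/-- A glued operator and an operator glued from central elements can be glued along the same
chain. -/
theorem exists_common_chain {p a q c : ℕ → H →L[ℂ] H} {x g : H →ₗ.[ℂ] H} (hx : IsGlued M p a x)
    (hg : IsGlued M q c g) (hc : ∀ n, c n ∈ center M) :
    ∃ r a' c', IsGlued M r a' x ∧ IsGlued M r c' g ∧ ∀ n, c' n ∈ center M :=
  ⟨_, _, _, hx.refine hg.chain, hg.refine' hx.chain,
    fun n => mul_mem (hc n) (hx.chain.proj n).1⟩

theorem IsGlued.boundedOn_of_norm_le {p a : ℕ → H →L[ℂ] H} {x : H →ₗ.[ℂ] H}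
    (hx : IsGlued M p a x) {z : H →L[ℂ] H} {n : ℕ} (hz : p n * z = z) {s : ℝ}
    (h : ‖a n * z‖ ≤ s) : BoundedOn x z s := fun ξ => by
  refine ⟨(a n * z) ξ, ?_, (a n * z).le_of_opNorm_le h ξ⟩
  have := hx.mem_graph n (z ξ)
  rwa [← mul_apply_eq_comp, hz] at this

/-- If `e` is the largest central projection on which `x` is bounded by `s`, then `s (1 - e)` is
a lower bound of all central operators dominating `|x|`. -/
theorem opLE_of_largest (Φ : CenterIso M μ) {p a : ℕ → H →L[ℂ] H} {x h g : H →ₗ.[ℂ] H}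
    (hx : IsGlued M p a x) (hh : IsModulus M x h) {s : ℝ} (hs : 0 ≤ s) {e : H →L[ℂ] H}
    (he : IsProj (center M) e)
    (hmax : ∀ z, IsProj (center M) z → BoundedOn x z s → z ≤ e)
    (hg : IsMeasurableOp (center M) g) (hle : OpLE h g) :
    OpLE (ofBounded ((s : ℂ) • (1 - e))) g := by
  obtain ⟨q, c, hgl, hc⟩ := isMeasurableOp_center_iff.1 hg
  obtain ⟨r, a', c', hx', hg', hc'⟩ := exists_common_chain hx hgl hc
  have hh' := hx'.isModulus_iff.1 hh
  obtain ⟨-, hsa, hle'⟩ := (hh'.opLE_iff hg').1 hle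
  have he' : (s : ℂ) • (1 - e) ∈ M := smul_mem_vN M _ he.one_sub.1.1
  have hb := (IsGlued.ofBounded he').refine hx'.chain
  simp only [one_mul] at hb
  obtain ⟨E, hE⟩ := exists_set_of_isProj Φ he
  have key : ∀ n, (s : ℂ) • (1 - e) * r n ≤ c' n := fun n => by
    obtain ⟨F, hFm, hF, -⟩ := exists_rep Φ (hc' n)
    obtain ⟨R, hR⟩ := exists_set_of_isProj Φ (hx'.chain.proj n)
    have hF0 := hF.nonneg_iff.1 ((CFC.abs_nonneg _).trans (hle' n))
    -- On the part of `R` where the dominating function is below `s`, the operator `x` is bounded by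
    -- `s`. By maximality this part lies in `E`, so the function is at least `s` on `R` off `E`.
    have hWm : MeasurableSet (R ∩ {ω | (F ω).re < s}) :=
      hR.1.inter (measurableSet_lt (Complex.measurable_re.comp hFm) measurable_const)
    obtain ⟨w, hw⟩ := exists_repSet Φ hWm
    have h1 : c' n * w ≤ (s : ℂ) • w := by
      rw [(hw.rep_mul hF).le_iff (hw.2.smul s)]
      filter_upwards [hF0] with ω hω
      by_cases hωW : ω ∈ R ∩ {ω | (F ω).re < s}
      · rw [Set.indicator_of_mem hωW, Set.indicator_of_mem hωW, mul_one, Complex.le_def]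
        exact ⟨by simpa using hωW.2.le, by simpa using (Complex.nonneg_iff.1 hω).2.symm⟩
      · simp [Set.indicator_of_notMem hωW]
    have h2 : ‖a' n * w‖ ≤ s := (norm_mul_proj_le_iff (hx'.mem n) hw.isProj hs).2
      ((mul_proj_le (hh'.mem n) (hc' n).1 hw.isProj (hle' n)).trans h1)
    have h3 : r n * w = w := by
      rw [← hw.isProj.2.le_iff_mul_eq_right hR.isProj.2, hw.le_iff hR]
      exact Filter.Eventually.of_forall fun ω hω => hω.1
    have h4 := hmax w hw.isProj (hx'.boundedOn_of_norm_le h3 h2)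
    rw [hw.le_iff hE] at h4
    rw [(hR.rep_mul (hE.one_sub.2.smul s)).le_iff hF]
    filter_upwards [h4, hF0] with ω h5 h6
    by_cases hωR : ω ∈ R
    · by_cases hωE : ω ∈ E
      · simpa [hωR, hωE] using h6
      · have h7 : s ≤ (F ω).re := by
          by_contra hlt
          exact hωE (h5 ⟨hωR, not_le.1 hlt⟩)
        rw [Set.indicator_of_mem hωR, Set.indicator_of_mem (Set.mem_compl hωE), mul_one,
          Complex.le_def]
        exact ⟨by simpa using h7, by simpa using (Complex.nonneg_iff.1 h6).2⟩
    · simpa [hωR] using h6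
  refine (hb.opLE_iff hg').2 ⟨fun n => ?_, hsa, key⟩
  refine IsSelfAdjoint.of_nonneg ?_
  rw [smul_mul_assoc]
  exact smul_nonneg (by simpa using hs) (he.one_sub.mul (hx'.chain.proj n)).2.nonneg

/-- The set on which the center-valued norm of `x` is at most `ε` supports a part of `x` of norm
at most `ε`. -/
theorem boundedOn_of_isCenterNorm {p a : ℕ → H →L[ℂ] H} {x f : H →ₗ.[ℂ] H} {g : Ω →ₘ[μ] ℂ}
    (hx : IsGlued M p a x) (hf : IsCenterNorm M x f) (hg : Represents Φ f g) {ε : ℝ} (hε : 0 ≤ ε)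
    {z : H →L[ℂ] H} {B : Set Ω} (hz : RepSet Φ z B) (hB : ∀ᵐ ω ∂μ, ω ∈ B → ‖g ω‖ ≤ ε) :
    BoundedOn x z ε := by
  obtain ⟨hfm, -, h, hh, -, hgreatest⟩ := hf
  obtain ⟨q, c, hfl, hc⟩ := isMeasurableOp_center_iff.1 hfm
  choose Q hQ using fun n => exists_set_of_isProj Φ (hfl.chain.proj n)
  have hcR := hg.rep hfl hc hQ
  -- Strictness matters: off the largest set `E` with bound `s` the norm function is at least `s`,
  -- which contradicts its bound `ε` on `B` only for `s > ε`. The bound `ε` follows as `s`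
  -- decreases.
  have key : ∀ s, ε < s → BoundedOn x z s := by
    intro s hs
    have hs0 : 0 ≤ s := hε.trans hs.le
    obtain ⟨e, he, hb, hmax⟩ := hx.exists_largest hs0
    obtain ⟨E, hE⟩ := exists_set_of_isProj Φ he
    have hemem : (s : ℂ) • (1 - e) ∈ center M := smul_mem_vN _ _ he.one_sub.1
    have hsa : IsSelfAdjoint ((s : ℂ) • (1 - e)) :=
      IsSelfAdjoint.of_nonneg (smul_nonneg (by simpa using hs0) he.one_sub.2.nonneg)
    have hle := hgreatest (ofBounded ((s : ℂ) • (1 - e))) (isMeasurableOp_ofBounded hemem)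
      ((IsGlued.ofBounded hemem.1).isSelfAdjoint_iff.2 fun _ => hsa)
      fun k hk hhk => opLE_of_largest Φ hx hh hs0 he hmax hk hhk
    have hb' := (IsGlued.ofBounded hemem.1).refine hfl.chain
    simp only [one_mul] at hb'
    have hle' := ((hb'.opLE_iff hfl).1 hle).2.2
    have hae : ∀ᵐ ω ∂μ, ∀ n, ω ∈ Q n → ω ∉ E → s ≤ ‖g ω‖ := by
      refine ae_all_iff.2 fun n => ?_
      have h1 := hle' n
      rw [((hQ n).rep_mul (hE.one_sub.2.smul s)).le_iff (hcR n)] at h1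
      filter_upwards [h1] with ω h2 hωQ hωE
      rw [Set.indicator_of_mem hωQ, Set.indicator_of_mem hωQ,
        Set.indicator_of_mem (Set.mem_compl hωE), mul_one, Complex.le_def] at h2
      exact (by simpa using h2.1 : s ≤ (g ω).re).trans (Complex.re_le_norm _)
    have hle2 : z ≤ e := by
      rw [hz.le_iff hE]
      filter_upwards [hae, hB, hfl.chain.ae_mem hQ] with ω h1 h2 ⟨n, hn⟩ hωB
      by_contra hωE
      exact absurd (h1 n hn hωE) (not_le.2 ((h2 hωB).trans_lt hs))
    exact hb.of_le hs0 hz.isProj.2 ((hz.isProj.2.le_iff_mul_eq_right he.2).1 hle2)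
  rw [hx.boundedOn_iff hε]
  intro n
  refine le_of_forall_gt_imp_ge_of_dense fun s hs => ?_
  exact (hx.boundedOn_iff (hε.trans hs.le)).1 (key s hs) n

/-- The function with given sublevel sets. -/
theorem exists_function_of_sets {E : ℚ≥0 → Set Ω} (hE : ∀ s, MeasurableSet (E s))
    (hm : ∀ᵐ ω ∂μ, ∀ s t, s ≤ t → ω ∈ E s → ω ∈ E t) (hU : ∀ᵐ ω ∂μ, ∃ s, ω ∈ E s) :
    ∃ G : Ω → ℝ, Measurable G ∧ (∀ ω, 0 ≤ G ω) ∧ ∀ᵐ ω ∂μ,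
      (∀ s, ω ∉ E s → (s : ℝ) ≤ G ω) ∧
        ∀ k : ℝ, 0 ≤ k → (∀ s, ω ∉ E s → (s : ℝ) ≤ k) → G ω ≤ k := by
  -- The value at ω is the supremum of the rational levels whose set omits ω. Rational levels keep
  -- the exceptional null sets countable in number.
  let F : Ω → ℝ≥0∞ := fun ω => ⨆ s, (E s)ᶜ.indicator (fun _ => ENNReal.ofReal (s : ℝ)) ω
  have hF : Measurable F := Measurable.iSup fun s => measurable_const.indicator (hE s).compl
  have hFle : ∀ ω (k : ℝ), (∀ s, ω ∉ E s → (s : ℝ) ≤ k) → F ω ≤ ENNReal.ofReal k := by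
    intro ω k h
    refine iSup_le fun s => ?_
    by_cases hs : ω ∈ E s
    · simp [hs]
    · simpa [hs] using ENNReal.ofReal_le_ofReal (h s hs)
  refine ⟨fun ω => (F ω).toReal, hF.ennreal_toReal, fun ω => ENNReal.toReal_nonneg, ?_⟩
  filter_upwards [hm, hU] with ω h1 ⟨t, ht⟩
  have hfin : F ω ≠ ∞ := by
    refine ((hFle ω t fun s hs => ?_).trans_lt ENNReal.ofReal_lt_top).ne
    have : s ≤ t := le_of_not_ge fun hts => hs (h1 t s hts ht)
    exact_mod_cast this
  refine ⟨fun s hs => ?_, fun k hk h => ?_⟩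
  · have h2 : ENNReal.ofReal (s : ℝ) ≤ F ω := by
      refine le_trans ?_ (le_iSup _ s)
      simp [hs]
    have := ENNReal.toReal_mono hfin h2
    rwa [ENNReal.toReal_ofReal (by positivity)] at this
  · exact ENNReal.toReal_le_of_le_ofReal hk (hFle ω k h)

/-- An estimate of the modulus of a bounded operator by a central element from estimates on level
sets. -/
theorem abs_le_of_level_sets {a c r : H →L[ℂ] H} {R : Set Ω} {G : Ω → ℝ} (ha : a ∈ M)
    (hr : RepSet Φ r R) (har : a * r = a) (hG : Measurable G) (hG0 : ∀ ω, 0 ≤ G ω) {n : ℕ}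
    (hRG : ∀ᵐ ω ∂μ, ω ∈ R → G ω ≤ n) (hc : Rep Φ c (R.indicator fun ω => (G ω : ℂ)))
    (hb : ∀ (s : ℚ≥0) (w : H →L[ℂ] H), RepSet Φ w (R ∩ {ω | G ω < s}) → ‖a * w‖ ≤ s) :
    CFC.abs a ≤ c := by
  -- `R` is cut along the levels j / (m + 1) of `G`. On the slice below level j + 1 and not below
  -- level j, the modulus is at most (j + 1) / (m + 1) ≤ G + 1 / (m + 1). The slices telescope to
  -- `r`, and `m` tends to infinity.
  have key : ∀ m : ℕ, CFC.abs a ≤ c + (((1 : ℝ) / (m + 1) : ℝ) : ℂ) • 1 := by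
    intro m
    have hm0 : (0 : ℝ) < m + 1 := by positivity
    let s : ℕ → ℚ≥0 := fun j => (j : ℚ≥0) / ((m : ℚ≥0) + 1)
    have hsR : ∀ j, ((s j : ℚ≥0) : ℝ) = (j : ℝ) / (m + 1) := fun j => by simp [s]
    choose d hd using fun j : ℕ => exists_repSet Φ
      (hr.1.inter (measurableSet_lt hG measurable_const) : MeasurableSet (R ∩ {ω | G ω < s j}))
    have hd0 : d 0 = 0 := by
      rw [(hd 0).eq_zero_iff]
      convert measure_empty (μ := μ)
      ext ω
      simpa [hsR] using fun _ => hG0 ω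
    have hsub : ∀ j, R ∩ {ω | G ω < s j} ⊆ R ∩ {ω | G ω < s (j + 1)} := by
      rintro j ω ⟨h1, h2⟩
      have h3 : (s j : ℝ) ≤ s (j + 1) := by
        rw [hsR, hsR]
        gcongr
        simp
      exact ⟨h1, lt_of_lt_of_le (show G ω < s j from h2) h3⟩
    -- The extra 1 makes the last level n + 1 / (m + 1), so that G ≤ n gives the strict inequality
    -- defining the slices.
    let N := n * (m + 1) + 1
    have hdN : d N = r := by
      refine (hd N).2.inj (hr.2.congr ?_)
      filter_upwards [hRG] with ω hω
      by_cases hωR : ω ∈ R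
      · have h1 : G ω < s N := by
          rw [hsR, lt_div_iff₀ hm0]
          have := mul_le_mul_of_nonneg_right (hω hωR) hm0.le
          push_cast [N]
          linarith
        have h2 : ω ∈ R ∩ {ω | G ω < s N} := ⟨hωR, h1⟩
        rw [Set.indicator_of_mem hωR, Set.indicator_of_mem h2]
      · rw [Set.indicator_of_notMem hωR, Set.indicator_of_notMem fun h => hωR h.1]
    have habs : CFC.abs a = CFC.abs a * r := by
      rw [← abs_mul_proj ha hr.isProj, har]
    have hdd : ∀ j, IsProj (center M) (d (j + 1) - d j) ∧ d (j + 1) * (d (j + 1) - d j) =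
        d (j + 1) - d j := fun j => by
      have hle : d j ≤ d (j + 1) := by
        rw [(hd j).le_iff (hd (j + 1))]
        exact Filter.Eventually.of_forall fun ω hω => hsub j hω
      have h1 := (hd (j + 1)).isProj.2
      have h2 := ((hd j).isProj.2.le_iff_sub h1).1 hle
      refine ⟨⟨sub_mem (hd (j + 1)).isProj.1 (hd j).isProj.1, h2⟩, ?_⟩
      rw [mul_sub, h1.isIdempotentElem.eq, ((hd j).isProj.2.le_iff_mul_eq_right h1).1 hle]
    have hcm : c + (((1 : ℝ) / (m + 1) : ℝ) : ℂ) • 1 ∈ M :=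
      add_mem hc.mem.1 (smul_mem_vN M _ (one_mem M))
    have hstep : ∀ j, CFC.abs a * (d (j + 1) - d j) ≤
        (c + (((1 : ℝ) / (m + 1) : ℝ) : ℂ) • 1) * (d (j + 1) - d j) := fun j => by
      have h1 : ‖a * (d (j + 1) - d j)‖ ≤ s (j + 1) := by
        rw [← (hdd j).2, ← mul_assoc]
        refine (norm_mul_le _ _).trans ?_
        refine (mul_le_mul (hb _ _ (hd (j + 1))) (hdd j).1.2.norm_le (norm_nonneg _)
          (by positivity)).trans (mul_one _).le
      refine ((norm_mul_proj_le_iff ha (hdd j).1 (by positivity)).1 h1).trans ?_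
      have e1 := (hd (j + 1)).2.sub (hd j).2
      have e2 := (hc.add (Rep.one.smul (((1 : ℝ) / (m + 1) : ℝ) : ℂ))).mul e1
      rw [(e1.smul _).le_iff e2]
      refine Filter.Eventually.of_forall fun ω => ?_
      by_cases hω1 : ω ∈ R ∩ {ω | G ω < s (j + 1)}
      · by_cases hω2 : ω ∈ R ∩ {ω | G ω < s j}
        · simp [Set.indicator_of_mem hω1, Set.indicator_of_mem hω2]
        · rw [Set.indicator_of_mem hω1, Set.indicator_of_notMem hω2, Set.indicator_of_mem hω1.1]
          have h3 : (s j : ℝ) ≤ G ω := not_lt.1 fun h => hω2 ⟨hω1.1, h⟩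
          have h4 : ((s (j + 1) : ℚ≥0) : ℝ) = s j + 1 / (m + 1) := by
            rw [hsR, hsR]; push_cast; ring
          simp only [sub_zero, mul_one]
          rw [← Complex.ofReal_add, Complex.real_le_real, h4]
          linarith
      · have hω2 : ω ∉ R ∩ {ω | G ω < s j} := fun h => hω1 (hsub j h)
        simp [Set.indicator_of_notMem hω1, Set.indicator_of_notMem hω2]
    calc CFC.abs a = ∑ j ∈ Finset.range N, CFC.abs a * (d (j + 1) - d j) := by
          rw [← Finset.mul_sum, Finset.sum_range_sub, hd0, hdN, sub_zero, ← habs]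
      _ ≤ ∑ j ∈ Finset.range N, (c + (((1 : ℝ) / (m + 1) : ℝ) : ℂ) • 1) * (d (j + 1) - d j) :=
          Finset.sum_le_sum fun j _ => hstep j
      _ = (c + (((1 : ℝ) / (m + 1) : ℝ) : ℂ) • 1) * r := by
          rw [← Finset.mul_sum, Finset.sum_range_sub, hd0, hdN, sub_zero]
      _ ≤ _ := by
          have e2 := hc.add (Rep.one.smul (((1 : ℝ) / (m + 1) : ℝ) : ℂ))
          rw [(hr.rep_mul e2).le_iff e2]
          refine Filter.Eventually.of_forall fun ω => ?_
          by_cases hωR : ω ∈ R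
          · simp [hωR]
          · simp only [Set.indicator_of_notMem hωR, zero_add, mul_one]
            exact_mod_cast (by positivity : (0 : ℝ) ≤ 1 / (m + 1))
  have hlim : Filter.Tendsto (fun m : ℕ => c + (((1 : ℝ) / (m + 1) : ℝ) : ℂ) • (1 : H →L[ℂ] H))
      Filter.atTop (𝓝 (c + ((0 : ℝ) : ℂ) • 1)) :=
    (((Complex.continuous_ofReal.tendsto _).comp
      tendsto_one_div_add_atTop_nhds_zero_nat).smul_const _).const_add _
  simp only [Complex.ofReal_zero, zero_smul, add_zero] at hlim
  exact ge_of_tendsto' hlim key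

/-- Elements of the central extension have a center-valued norm, which is at most `ε` on every
central part of norm at most `ε`. -/
theorem exists_isCenterNorm (Φ : CenterIso M μ) {p a : ℕ → H →L[ℂ] H} {x : H →ₗ.[ℂ] H}
    (hx : IsGlued M p a x) :
    ∃ f g, IsCenterNorm M x f ∧ Represents Φ f g ∧ ∀ (ε : ℝ) (z : H →L[ℂ] H) (B : Set Ω), 0 ≤ ε →
      RepSet Φ z B → BoundedOn x z ε → ∀ᵐ ω ∂μ, ω ∈ B → ‖g ω‖ ≤ ε := by
  -- The norm function is built from the sets `E s` of the largest central projections on which `x`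
  -- is bounded by a rational `s`.
  choose e he heb hmax using fun s : ℚ≥0 => hx.exists_largest (s := s) (by positivity)
  choose E hE using fun s => exists_set_of_isProj Φ (he s)
  have hmono : ∀ᵐ ω ∂μ, ∀ s t, s ≤ t → ω ∈ E s → ω ∈ E t := by
    simp only [ae_all_iff]
    intro s t hst
    rw [← (hE s).le_iff (hE t)]
    exact hmax t _ (he s) ((heb s).mono (by exact_mod_cast hst))
  choose P hP using fun n => exists_set_of_isProj Φ (hx.chain.proj n)
  have hcov : ∀ᵐ ω ∂μ, ∃ s, ω ∈ E s := by
    have h1 : ∀ᵐ ω ∂μ, ∀ n, ω ∈ P n → ∃ s, ω ∈ E s := by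
      refine ae_all_iff.2 fun n => ?_
      obtain ⟨k, hk⟩ := exists_nat_ge ‖a n * p n‖
      have h2 := hmax k (p n) (hx.chain.proj n)
        (hx.boundedOn_of_norm_le (hx.chain.mul_self n) (by simpa using hk))
      rw [(hP n).le_iff (hE k)] at h2
      filter_upwards [h2] with ω h3 h4 using ⟨_, h3 h4⟩
    filter_upwards [h1, hx.chain.ae_mem hP] with ω h2 ⟨n, hn⟩ using h2 n hn
  obtain ⟨G, hGm, hG0, hG⟩ := exists_function_of_sets (fun s => (hE s).1) hmono hcov
  obtain ⟨q, c, f, hf, hq, hc⟩ := exists_isGlued_of_function Φ hGm hG0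
  have hGa : AEStronglyMeasurable (fun ω => (G ω : ℂ)) μ :=
    (Complex.measurable_ofReal.comp hGm).aestronglyMeasurable
  have hGc := AEEqFun.coeFn_mk _ hGa
  obtain ⟨h, hh⟩ := hx.exists_modulus
  have hhm := hx.isModulus_iff.2 hh
  have hcc : ∀ n, c n ∈ center M := fun n => (hc n).mem
  have hfm : IsMeasurableOp (center M) f := isMeasurableOp_center_iff.2 ⟨q, c, hf, hcc⟩
  have hc0 : ∀ n, 0 ≤ c n := fun n => by
    rw [(hc n).nonneg_iff]
    refine Filter.Eventually.of_forall fun ω => Set.indicator_nonneg (fun ω _ => ?_) ω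
    exact_mod_cast hG0 ω
  have hfsa : IsSelfAdjoint f := hf.isSelfAdjoint_iff.2 fun n => (hc0 n).isSelfAdjoint
  have hbdd : ∀ (s : ℚ≥0) (w : H →L[ℂ] H) (B : Set Ω), RepSet Φ w B → (∀ ω ∈ B, G ω < s) →
      BoundedOn x w s := by
    intro s w B hw hB
    refine (heb s).of_le (by positivity) hw.isProj.2 ?_
    rw [← hw.isProj.2.le_iff_mul_eq_right (he s).2, hw.le_iff (hE s)]
    filter_upwards [hG] with ω h1 hωB
    by_contra h2
    exact absurd (h1.1 s h2) (not_le.2 (hB ω hωB))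
  refine ⟨f, AEEqFun.mk _ hGa, ⟨hfm, hfsa, h, hhm, ?_, ?_⟩, ?_, ?_⟩
  · intro k hk hhk
    obtain ⟨q', c', hkl, hc'⟩ := isMeasurableOp_center_iff.1 hk
    have hf' := hf.refine hkl.chain
    have hk' := hkl.refine' hf.chain
    -- Any central `k` above the modulus is at least `s` off `E s`, for every `s`; by construction
    -- `G` is the least such function.
    have hlow : ∀ s : ℚ≥0, OpLE (ofBounded (((s : ℝ) : ℂ) • (1 - e s))) k := fun s =>
      opLE_of_largest Φ hx hhm (by positivity) (he s) (hmax s) hk hhk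
    refine (hf'.opLE_iff hk').2 ⟨fun n => ?_, hk'.isSelfAdjoint_iff.1 hhk.2.1, fun n => ?_⟩
    · refine IsSelfAdjoint.of_nonneg ?_
      simpa using mul_proj_le (zero_mem M) (hcc n).1 (hkl.chain.proj n) (hc0 n)
    obtain ⟨Q', hQ'⟩ := exists_set_of_isProj Φ (hkl.chain.proj n)
    obtain ⟨F, -, hF, -⟩ := exists_rep Φ (mul_mem (hc' n) (hq n).isProj.1)
    have hlow' : ∀ᵐ ω ∂μ, ∀ s : ℚ≥0, ({ω | G ω ≤ n} ∩ Q').indicator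
        (fun ω => ((s : ℝ) : ℂ) * (E s)ᶜ.indicator (fun _ => 1) ω) ω ≤ F ω := by
      refine ae_all_iff.2 fun s => ?_
      have hb := (IsGlued.ofBounded (M := M)
        (smul_mem_vN M ((s : ℝ) : ℂ) (he s).one_sub.1.1)).refine hk'.chain
      simp only [one_mul] at hb
      have h1 := ((hb.opLE_iff hk').1 (hlow s)).2.2 n
      rwa [(((hq n).mul hQ').rep_mul ((hE s).one_sub.2.smul _)).le_iff hF] at h1
    rw [(hQ'.rep_mul (hc n)).le_iff hF]
    filter_upwards [hlow', hG] with ω h1 h2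
    have h3 : 0 ≤ F ω := by
      have := h1 0
      by_cases hω : ω ∈ {ω | G ω ≤ n} ∩ Q'
      · simpa [Set.indicator_of_mem hω] using this
      · simpa [Set.indicator_of_notMem hω] using this
    by_cases hω : ω ∈ {ω | G ω ≤ n} ∩ Q'
    · rw [Set.indicator_of_mem hω.2, Set.indicator_of_mem hω.1, Complex.le_def]
      refine ⟨?_, by simpa using (Complex.nonneg_iff.1 h3).2⟩
      rw [Complex.ofReal_re]
      refine h2.2 _ (Complex.nonneg_iff.1 h3).1 fun s hs => ?_
      have h4 := h1 s
      rw [Set.indicator_of_mem hω, Set.indicator_of_mem (Set.mem_compl hs), mul_one,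
        Complex.le_def] at h4
      simpa using h4.1
    · rw [Set.indicator_indicator, Set.inter_comm, Set.indicator_of_notMem hω]
      exact h3
  -- The infimum is attained: `f` itself dominates the modulus, so every lower bound is at most `f`.
  · refine fun f' _ _ hf' => hf' f hfm ?_
    have hx' := hx.refine hf.chain
    have hf'' := hf.refine' hx.chain
    refine ((hx'.isModulus_iff.1 hhm).opLE_iff hf'').2
      ⟨fun n => (CFC.abs_nonneg _).isSelfAdjoint, hf''.isSelfAdjoint_iff.1 hfsa, fun n => ?_⟩
    refine abs_le_of_level_sets (hx'.mem n) ((hP n).mul (hq n)) (hx'.compat n n le_rfl) hGm hG0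
      (n := n) (Filter.Eventually.of_forall fun ω hω => hω.2) ?_ ?_
    · rw [← Set.indicator_indicator]
      exact (hP n).rep_mul (hc n)
    · intro s w hw
      exact (hx'.boundedOn_iff (by positivity)).1 (hbdd s w _ hw fun ω hω => hω.2) n
  · refine represents_of_rep hf hq fun n => (hc n).congr ?_
    filter_upwards [hGc] with ω hω
    by_cases h1 : G ω ≤ n <;> simp [h1, hω]
  · intro ε z B hε hz hb
    have h1 : ∀ᵐ ω ∂μ, ∀ s : ℚ≥0, ε ≤ s → ω ∈ B → ω ∈ E s := by
      simp only [ae_all_iff]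
      intro s hs
      rw [← hz.le_iff (hE s)]
      exact hmax s z hz.isProj (hb.mono hs)
    filter_upwards [h1, hG, hGc] with ω h2 h3 h4 hωB
    rw [h4, Complex.norm_real, Real.norm_of_nonneg (hG0 ω)]
    refine h3.2 ε hε fun s hs => ?_
    by_contra hlt
    exact hs (h2 s (not_le.1 hlt).le hωB)

/-- The basic neighborhoods of zero in terms of bounds on central parts. -/
theorem mem_nhdO_iff {x : H →ₗ.[ℂ] H} {A : Set Ω} {ε δ : ℝ} (hε : 0 ≤ ε) :
    x ∈ nhdO Φ A ε δ ↔ x ∈ centralExtension M ∧ ∃ B ⊆ A, μ (A \ B) ≤ ENNReal.ofReal δ ∧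
      ∃ z, RepSet Φ z B ∧ BoundedOn x z ε := by
  have hnorm : ∀ (g : Ω →ₘ[μ] ℂ) (B : Set Ω), eLpNorm (B.indicator g) ∞ μ ≤ ENNReal.ofReal ε ↔
      ∀ᵐ ω ∂μ, ω ∈ B → ‖g ω‖ ≤ ε := by
    intro g B
    rw [eLpNorm_exponent_top]
    have h1 : ∀ ω, ‖B.indicator g ω‖ₑ ≤ ENNReal.ofReal ε ↔ (ω ∈ B → ‖g ω‖ ≤ ε) := by
      intro ω
      by_cases hω : ω ∈ B
      · simp [hω, ← ofReal_norm, ENNReal.ofReal_le_ofReal_iff hε]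
      · simp [hω]
    constructor
    · intro h
      filter_upwards [enorm_ae_le_eLpNormEssSup (B.indicator g) μ] with ω hω
      exact (h1 ω).1 (hω.trans h)
    · intro h
      refine essSup_le_of_ae_le _ ?_
      filter_upwards [h] with ω hω using (h1 ω).2 hω
  constructor
  · rintro ⟨hx, f, g, hf, hg, B, hBA, hB, hμ, hn⟩
    obtain ⟨p, a, hxg⟩ := mem_centralExtension_iff.1 hx
    obtain ⟨z, hz⟩ := exists_repSet Φ hB
    exact ⟨hx, B, hBA, hμ, z, hz,
      boundedOn_of_isCenterNorm hxg hf hg hε hz ((hnorm g B).1 hn)⟩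
  · rintro ⟨hx, B, hBA, hμ, z, hz, hb⟩
    obtain ⟨p, a, hxg⟩ := mem_centralExtension_iff.1 hx
    obtain ⟨f, g, hf, hg, h⟩ := exists_isCenterNorm Φ hxg
    exact ⟨hx, f, g, hf, hg, B, hBA, hz.1, hμ, (hnorm g B).2 (h ε z B hε hz hb)⟩

end CenterNorm

/-! ### Exhausting sets of finite measure -/

section Exhaustion

variable {Ω : Type v} [MeasurableSpace Ω] {μ : Measure Ω}

/-- If every non-null part of a set `A` of finite measure contains a non-null member of `𝒞`, then
`A` is exhausted by finite unions of members of `𝒞`. -/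
theorem exists_finset_measure_diff_le {A : Set Ω} (hA : MeasurableSet A) (hμA : μ A ≠ ∞)
    {𝒞 : Set (Set Ω)} (hm : ∀ C ∈ 𝒞, MeasurableSet C)
    (h : ∀ B ⊆ A, MeasurableSet B → μ B ≠ 0 → ∃ C ∈ 𝒞, C ⊆ B ∧ μ C ≠ 0) {η : ℝ≥0∞} (hη : η ≠ 0) :
    ∃ F : Finset (Set Ω), (∀ C ∈ F, C ∈ 𝒞 ∧ C ⊆ A) ∧ μ (A \ ⋃ C ∈ F, C) ≤ η := by
  classical
  let Fam := {F : Finset (Set Ω) // ∀ C ∈ F, C ∈ 𝒞 ∧ C ⊆ A}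
  have : Nonempty Fam := ⟨⟨∅, by simp⟩⟩
  let φ : Fam → ℝ≥0∞ := fun F => μ (⋃ C ∈ F.1, C)
  have hFm : ∀ F : Fam, MeasurableSet (⋃ C ∈ F.1, C) := fun F =>
    F.1.measurableSet_biUnion fun C hC => hm C (F.2 C hC).1
  have hφA : ∀ F, φ F ≤ μ A := fun F => measure_mono (Set.iUnion₂_subset fun C hC => (F.2 C hC).2)
  obtain ⟨v, -, hv, hvr⟩ := exists_seq_tendsto_sSup (Set.range_nonempty φ) (OrderTop.bddAbove _)
  choose F hF using hvr
  have hS : sSup (Set.range φ) ≠ ∞ :=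
    ((sSup_le (by rintro _ ⟨F, rfl⟩; exact hφA F)).trans_lt hμA.lt_top).ne
  -- Along a maximizing sequence of finite unions nothing is left over: a non-null remainder would
  -- contain a member `C` that raises every value by `μ C`, beyond the finite supremum.
  have hD0 : μ (A \ ⋃ n, ⋃ C ∈ (F n).1, C) = 0 := by
    by_contra hD
    obtain ⟨C, hC, hCD, hC0⟩ := h _ Set.sdiff_subset
      (hA.diff (MeasurableSet.iUnion fun n => hFm (F n))) hD
    have h1 : ∀ n, v n + μ C ≤ sSup (Set.range φ) := by
      intro n
      have hdisj : Disjoint (⋃ C ∈ (F n).1, C) C := by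
        rw [Set.disjoint_left]
        intro ω hω hωC
        exact (hCD hωC).2 (Set.mem_iUnion.2 ⟨n, hω⟩)
      rw [← hF n, ← measure_union hdisj (hm C hC)]
      refine le_sSup ⟨⟨insert C (F n).1, ?_⟩, ?_⟩
      · intro C' hC'
        rcases Finset.mem_insert.1 hC' with rfl | h2
        · exact ⟨hC, fun ω hω => (hCD hω).1⟩
        · exact (F n).2 _ h2
      · change μ _ = μ _
        rw [Finset.set_biUnion_insert, Set.union_comm]
    have h2 : sSup (Set.range φ) + μ C ≤ sSup (Set.range φ) :=
      le_of_tendsto' (hv.add_const _) h1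
    exact absurd h2 (not_le.2 (ENNReal.lt_add_right hS hC0))
  -- Cumulative unions make the remainders decreasing, so that continuity from above applies.
  let G : ℕ → Finset (Set Ω) := fun n => (Finset.range n).biUnion fun k => (F k).1
  have hGmem : ∀ n C, C ∈ G n ↔ ∃ k < n, C ∈ (F k).1 := fun n C => by simp [G]
  have hGF : ∀ n, ∀ C ∈ G n, C ∈ 𝒞 ∧ C ⊆ A := fun n C hC => by
    obtain ⟨k, -, hk⟩ := (hGmem n C).1 hC
    exact (F k).2 C hk
  have hlim : Filter.Tendsto (fun n => μ (A \ ⋃ C ∈ G n, C)) Filter.atTop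
      (𝓝 (μ (⋂ n, A \ ⋃ C ∈ G n, C))) := by
    refine tendsto_measure_iInter_atTop (fun n => ?_) ?_ ⟨0, ?_⟩
    · exact (hA.diff ((G n).measurableSet_biUnion fun C hC => hm C (hGF n C hC).1)).nullMeasurableSet
    · intro n m hnm
      refine Set.sdiff_subset_sdiff_right (Set.biUnion_subset_biUnion_left fun C hC => ?_)
      obtain ⟨k, hk, hC⟩ := (hGmem n C).1 hC
      exact (hGmem m C).2 ⟨k, hk.trans_le hnm, hC⟩
    · exact ((measure_mono Set.sdiff_subset).trans_lt hμA.lt_top).ne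
  have h0 : μ (⋂ n, A \ ⋃ C ∈ G n, C) = 0 := by
    refine measure_mono_null (fun ω hω => ?_) hD0
    rw [Set.mem_iInter] at hω
    refine ⟨(hω 0).1, fun h1 => ?_⟩
    simp only [Set.mem_iUnion] at h1
    obtain ⟨n, C, hC, hωC⟩ := h1
    exact (hω (n + 1)).2 (Set.mem_biUnion ((hGmem _ _).2 ⟨n, n.lt_succ_self, hC⟩) hωC)
  rw [h0] at hlim
  obtain ⟨n, hn⟩ := (hlim.eventually (gt_mem_nhds (pos_iff_ne_zero.2 hη))).exists
  exact ⟨G n, hGF n, hn.le⟩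

/-- A set of finite measure without atoms has non-null parts of arbitrarily small measure. -/
theorem exists_small_subset {A : Set Ω} (hμA : μ A ≠ ∞)
    (h : ∀ B ⊆ A, MeasurableSet B → μ B ≠ 0 →
      ∃ C ⊆ B, MeasurableSet C ∧ μ C ≠ 0 ∧ μ (B \ C) ≠ 0)
    {η : ℝ≥0∞} (hη : η ≠ 0) {B : Set Ω} (hBA : B ⊆ A) (hB : MeasurableSet B) (hB0 : μ B ≠ 0) :
    ∃ C ⊆ B, MeasurableSet C ∧ μ C ≠ 0 ∧ μ C ≤ η := by
  have hBfin : μ B ≠ ∞ := ((measure_mono hBA).trans_lt hμA.lt_top).ne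
  -- Of the two non-null parts of a split set, one has at most half the measure.
  have key : ∀ n : ℕ, ∃ C ⊆ B, MeasurableSet C ∧ μ C ≠ 0 ∧ μ C ≤ μ B * 2⁻¹ ^ n := by
    intro n
    induction n with
    | zero => exact ⟨B, subset_rfl, hB, hB0, by simp⟩
    | succ n ih =>
      obtain ⟨C, hCB, hC, hC0, hCn⟩ := ih
      obtain ⟨D, hDC, hD, hD0, hD0'⟩ := h C (hCB.trans hBA) hC hC0
      have hadd : μ D + μ (C \ D) = μ C := by
        rw [← measure_inter_add_sdiff C hD, Set.inter_eq_self_of_subset_right hDC]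
      have hhalf : μ C / 2 ≤ μ B * 2⁻¹ ^ (n + 1) := by
        rw [pow_succ, ← mul_assoc, ENNReal.div_eq_inv_mul, mul_comm]
        gcongr
      rcases le_total (μ D) (μ (C \ D)) with hle | hle
      · refine ⟨D, hDC.trans hCB, hD, hD0, le_trans ?_ hhalf⟩
        rw [ENNReal.le_div_iff_mul_le (by simp) (by simp), mul_two, ← hadd]
        gcongr
      · refine ⟨C \ D, Set.sdiff_subset.trans hCB, hC.diff hD, hD0', le_trans ?_ hhalf⟩
        rw [ENNReal.le_div_iff_mul_le (by simp) (by simp), mul_two, ← hadd]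
        gcongr
  obtain ⟨n, hn⟩ := ENNReal.exists_inv_two_pow_lt (ENNReal.div_ne_zero.2 ⟨hη, hBfin⟩)
  obtain ⟨C, hCB, hC, hC0, hCn⟩ := key n
  refine ⟨C, hCB, hC, hC0, hCn.trans ?_⟩
  rw [mul_comm]
  exact ENNReal.mul_le_of_le_div hn.le

end Exhaustion

/-! ### Local convexity and atomicity of the center -/

section LocalConvexity

open scoped ComplexOrder

variable {H : Type u} [NormedAddCommGroup H] [InnerProductSpace ℂ H] [CompleteSpace H]
variable {M : VonNeumannAlgebra H}
variable {Ω : Type v} [MeasurableSpace Ω] {μ : Measure Ω} {Φ : CenterIso M μ}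

/-- Three elements of the central extension can be glued along the same chain. -/
theorem exists_common_chain₃ {x y w : H →ₗ.[ℂ] H} (hx : x ∈ centralExtension M)
    (hy : y ∈ centralExtension M) (hw : w ∈ centralExtension M) :
    ∃ p a b c, IsGlued M p a x ∧ IsGlued M p b y ∧ IsGlued M p c w := by
  obtain ⟨p, a, hx⟩ := mem_centralExtension_iff.1 hx
  obtain ⟨q, b, hy⟩ := mem_centralExtension_iff.1 hy
  obtain ⟨r, c, hw⟩ := mem_centralExtension_iff.1 hw
  exact ⟨_, _, _, _, (hx.refine hy.chain).refine hw.chain, (hy.refine' hx.chain).refine hw.chain,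
    hw.refine' (hx.chain.mul hy.chain)⟩

theorem strongSub_mem {x y : H →ₗ.[ℂ] H} (hx : x ∈ centralExtension M)
    (hy : y ∈ centralExtension M) : strongSub x y ∈ centralExtension M := by
  obtain ⟨p, a, b, _, hx, hy, -⟩ := exists_common_chain₃ hx hy hy
  exact mem_centralExtension_iff.2 ⟨_, _, hx.strongSub hy⟩

theorem strongAdd_mem {x y : H →ₗ.[ℂ] H} (hx : x ∈ centralExtension M)
    (hy : y ∈ centralExtension M) (s t : ℂ) :
    strongAdd (s • x) (t • y) ∈ centralExtension M := by
  obtain ⟨p, a, b, _, hx, hy, -⟩ := exists_common_chain₃ hx hy hy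
  exact mem_centralExtension_iff.2 ⟨_, _, hx.strongAdd hy s t⟩

theorem ofBounded_mem {a : H →L[ℂ] H} (ha : a ∈ M) : ofBounded a ∈ centralExtension M :=
  mem_centralExtension_iff.2 ⟨_, _, IsGlued.ofBounded ha⟩

theorem boundedOn_strongSub_self {x : H →ₗ.[ℂ] H} (hx : x ∈ centralExtension M) (z : H →L[ℂ] H)
    {s : ℝ} (hs : 0 ≤ s) : BoundedOn (strongSub x x) z s := by
  obtain ⟨p, a, hx⟩ := mem_centralExtension_iff.1 hx
  rw [(hx.strongSub hx).boundedOn_iff hs]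
  intro n
  simpa using hs

theorem BoundedOn.strongSub_trans {x y w : H →ₗ.[ℂ] H} (hx : x ∈ centralExtension M)
    (hy : y ∈ centralExtension M) (hw : w ∈ centralExtension M) {z z' : H →L[ℂ] H}
    (hz : IsProj (center M) z) (hz' : IsProj (center M) z') {s t : ℝ} (hs : 0 ≤ s) (ht : 0 ≤ t)
    (h : BoundedOn (strongSub x y) z s) (h' : BoundedOn (strongSub y w) z' t) :
    BoundedOn (strongSub x w) (z * z') (s + t) := by
  obtain ⟨p, a, b, c, hx, hy, hw⟩ := exists_common_chain₃ hx hy hw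
  rw [(hx.strongSub hy).boundedOn_iff hs] at h
  rw [(hy.strongSub hw).boundedOn_iff ht] at h'
  rw [(hx.strongSub hw).boundedOn_iff (add_nonneg hs ht)]
  intro n
  have e : (a n - c n) * (z * z') = (a n - b n) * z * z' + (b n - c n) * z' * z := by
    have hc : z * z' = z' * z := mul_comm_of_mem_center hz'.1 hz.1.1
    rw [mul_assoc, mul_assoc, ← hc, ← add_mul, sub_add_sub_cancel]
  have bound : ∀ (d e : H →L[ℂ] H) (k : ℝ), 0 ≤ k → ‖d‖ ≤ k → IsStarProjection e →
      ‖d * e‖ ≤ k := fun d e k hk hd he =>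
    (norm_mul_le _ _).trans ((mul_le_mul hd he.norm_le (norm_nonneg _) hk).trans (mul_one k).le)
  rw [e]
  exact (norm_add_le _ _).trans
    (add_le_add (bound _ _ _ hs (h n) hz'.2) (bound _ _ _ ht (h' n) hz.2))

/-- Triangle inequality: bounds add over the intersection of the good sets, and the measures of the
exceptional sets add. -/
theorem nhdO_trans {x y w : H →ₗ.[ℂ] H} (hx : x ∈ centralExtension M)
    (hy : y ∈ centralExtension M) (hw : w ∈ centralExtension M) {A : Set Ω} {ε ε' δ δ' : ℝ}
    (hε : 0 ≤ ε) (hε' : 0 ≤ ε') (hδ : 0 ≤ δ) (hδ' : 0 ≤ δ')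
    (h : strongSub x y ∈ nhdO Φ A ε δ) (h' : strongSub y w ∈ nhdO Φ A ε' δ') :
    strongSub x w ∈ nhdO Φ A (ε + ε') (δ + δ') := by
  rw [mem_nhdO_iff hε] at h
  rw [mem_nhdO_iff hε'] at h'
  rw [mem_nhdO_iff (add_nonneg hε hε')]
  obtain ⟨-, B, hBA, hB, z, hz, hb⟩ := h
  obtain ⟨-, B', -, hB', z', hz', hb'⟩ := h'
  refine ⟨strongSub_mem hx hw, B ∩ B', Set.inter_subset_left.trans hBA, ?_, z * z', hz.mul hz',
    hb.strongSub_trans hx hy hw hz.isProj hz'.isProj hε hε' hb'⟩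
  rw [Set.sdiff_inter, ENNReal.ofReal_add hδ hδ']
  exact (measure_union_le _ _).trans (add_le_add hB hB')

/-- The sets `x + O(A, ε, δ)` are neighborhoods of `x`. -/
theorem nhd_mem_nhds (x : centralExtension M) {A : Set Ω} (hA : MeasurableSet A) (hμA : μ A < ∞)
    {ε δ : ℝ} (hε : 0 < ε) (hδ : 0 < δ) :
    {y : centralExtension M | strongSub (y : H →ₗ.[ℂ] H) x ∈ nhdO Φ A ε δ} ∈
      @nhds _ (tc Φ) x := by
  letI := tc Φ
  rw [mem_nhds_iff]
  -- The interior candidate consists of the points some smaller neighborhood of which, over the same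
  -- `A`, stays inside; halving both parameters shows that it is open.
  refine ⟨{y | ∃ ε' δ', 0 < ε' ∧ 0 < δ' ∧ ∀ w : centralExtension M,
    strongSub (w : H →ₗ.[ℂ] H) y ∈ nhdO Φ A ε' δ' → strongSub (w : H →ₗ.[ℂ] H) x ∈ nhdO Φ A ε δ},
    ?_, ?_, ?_⟩
  · rintro y ⟨ε', δ', hε', hδ', h⟩
    refine h y ((mem_nhdO_iff hε'.le).2 ⟨strongSub_mem y.2 y.2, A, subset_rfl, by simp, ?_⟩)
    obtain ⟨z, hz⟩ := exists_repSet Φ hA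
    exact ⟨z, hz, boundedOn_strongSub_self y.2 z hε'.le⟩
  · rintro y ⟨ε', δ', hε', hδ', h⟩
    refine ⟨A, ε' / 2, δ' / 2, hA, hμA, by positivity, by positivity, fun w hw => ?_⟩
    refine ⟨ε' / 2, δ' / 2, by positivity, by positivity, fun t ht => h t ?_⟩
    have := nhdO_trans t.2 w.2 y.2 (by positivity) (by positivity) (by positivity) (by positivity)
      ht hw
    rwa [add_halves, add_halves] at this
  · exact ⟨ε, δ, hε, hδ, fun _ h => h⟩

theorem exists_nhd_of_mem_nhds {x : centralExtension M} {U : Set (centralExtension M)}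
    (hU : U ∈ @nhds _ (tc Φ) x) : ∃ A ε δ, MeasurableSet A ∧ μ A < ∞ ∧ 0 < ε ∧ 0 < δ ∧
      ∀ y : centralExtension M, strongSub (y : H →ₗ.[ℂ] H) x ∈ nhdO Φ A ε δ → y ∈ U := by
  letI := tc Φ
  rw [mem_nhds_iff] at hU
  obtain ⟨V, hVU, hV, hx⟩ := hU
  obtain ⟨A, ε, δ, hA, hμA, hε, hδ, h⟩ := hV x hx
  exact ⟨A, ε, δ, hA, hμA, hε, hδ, fun y hy => hVU (h y hy)⟩

/-- The bounded operators in a convex subset of the central extension form a convex set. -/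
theorem IsConvexSet.convex_bounded {V : Set (centralExtension M)} (hV : IsConvexSet V) :
    Convex ℝ {a : H →L[ℂ] H | ∃ ha : a ∈ M, ⟨ofBounded a, ofBounded_mem ha⟩ ∈ V} := by
  rintro a ⟨ha, haV⟩ b ⟨hb, hbV⟩ s t hs ht hst
  obtain ⟨w, hwV, hw⟩ := hV _ haV _ hbV s t hs ht hst
  have h1 := (IsGlued.ofBounded ha).strongAdd (IsGlued.ofBounded hb) s t
  have h2 : s • a + t • b = (s : ℂ) • a + (t : ℂ) • b := by
    rw [Complex.coe_smul, Complex.coe_smul]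
  have hmem : s • a + t • b ∈ M := h2 ▸ h1.mem 0
  refine ⟨hmem, ?_⟩
  have h3 : w = ⟨ofBounded (s • a + t • b), ofBounded_mem hmem⟩ := by
    apply Subtype.ext
    rw [hw]
    refine h1.ext ?_
    rw [← h2]
    exact IsGlued.ofBounded hmem
  exact h3 ▸ hwV

/-- If the center is atomic, then the topology is locally convex. -/
theorem isLocallyConvexTopology_of_isAtomicAlgebra (hat : IsAtomicAlgebra (center M)) :
    IsLocallyConvexTopology (tc Φ) := by
  intro x U hU
  obtain ⟨A, ε, δ, hA, hμA, hε, hδ, hAU⟩ := exists_nhd_of_mem_nhds hU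
  -- The atoms of the measure; each is cut out by a minimal central projection.
  let 𝒞 : Set (Set Ω) := {C | MeasurableSet C ∧ μ C ≠ 0 ∧
    ∀ D ⊆ C, MeasurableSet D → μ D = 0 ∨ μ (C \ D) = 0}
  obtain ⟨F, hF, hFμ⟩ := exists_finset_measure_diff_le (𝒞 := 𝒞) hA hμA.ne (fun C hC => hC.1)
    (fun B _ hB hB0 => by
      obtain ⟨b, hb⟩ := exists_repSet Φ hB
      obtain ⟨q, hq, hq0, hqb, hmin⟩ := hat b hb.isProj (mt hb.eq_zero_iff.1 hB0)
      obtain ⟨Q, hQ⟩ := exists_set_of_isProj Φ hq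
      have hqb' : q * b = q := (hq.2.le_iff_mul_eq_left hb.isProj.2).1 hqb
      have hQB : RepSet Φ q (Q ∩ B) := hqb' ▸ hQ.mul hb
      refine ⟨Q ∩ B, ⟨hQB.1, mt hQB.eq_zero_iff.2 hq0, fun D hD hDm => ?_⟩,
        Set.inter_subset_right, mt hQB.eq_zero_iff.2 hq0⟩
      obtain ⟨d, hd⟩ := exists_repSet Φ hDm
      rcases hmin d hd.isProj ((hd.le_iff hQB).2 (Filter.Eventually.of_forall hD)) with h | h
      · exact Or.inl (hd.eq_zero_iff.1 h)
      · right
        have h1 := (hQB.mul hd.one_sub).eq_zero_iff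
        rw [h, mul_sub, mul_one, hq.2.isIdempotentElem.eq, sub_self] at h1
        exact h1.1 rfl)
    (η := ENNReal.ofReal δ) (by simpa using hδ)
  set C := ⋃ D ∈ F, D with hC
  have hCm : MeasurableSet C := F.measurableSet_biUnion fun D hD => (hF D hD).1.1
  have hCA : C ⊆ A := Set.iUnion₂_subset fun D hD => (hF D hD).2
  have hμC : μ C < ∞ := (measure_mono hCA).trans_lt hμA
  obtain ⟨z, hz⟩ := exists_repSet Φ hCm
  -- With `δ'` below the measure of each of the finitely many atoms, an exceptional set of measure
  -- at most `δ'` cannot fill an atom, so it is null in `C`.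
  obtain ⟨δ', hδ', hsmall⟩ : ∃ δ' : ℝ, 0 < δ' ∧ ∀ D ∈ F, ENNReal.ofReal δ' < μ D := by
    have h1 : ∀ D ∈ F, ∀ᶠ d : ℝ in 𝓝[>] 0, ENNReal.ofReal d < μ D := fun D hD => by
      have h2 : Filter.Tendsto ENNReal.ofReal (𝓝[>] 0) (𝓝 0) := by
        simpa using (ENNReal.continuous_ofReal.tendsto 0).mono_left nhdsWithin_le_nhds
      exact h2.eventually (gt_mem_nhds (pos_iff_ne_zero.2 (hF D hD).1.2.1))
    have h3 := (Filter.eventually_all_finset F).2 h1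
    obtain ⟨d, h4, h5⟩ := (h3.and self_mem_nhdsWithin).exists
    exact ⟨d, h5, h4⟩
  -- One fixed projection `z` replaces the varying good sets, which turns the neighborhood into a
  -- ball of a seminorm.
  refine ⟨{y | BoundedOn (strongSub (y : H →ₗ.[ℂ] H) x) z ε}, ?_, ?_, ?_⟩
  · refine Filter.mem_of_superset (nhd_mem_nhds (Φ := Φ) x hCm hμC hε hδ') fun y hy => ?_
    obtain ⟨-, B, hBC, hB, b, hb, hbd⟩ := (mem_nhdO_iff hε.le).1 hy
    refine hbd.of_le hε.le hz.isProj.2 ?_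
    rw [← hz.isProj.2.le_iff_mul_eq_right hb.isProj.2, hz.le_iff hb]
    have h1 : ∀ D ∈ F, μ (D \ B) = 0 := fun D hD => by
      have hDC : D ⊆ C := Set.subset_biUnion_of_mem (u := fun D => D) hD
      rcases (hF D hD).1.2.2 (D \ B) Set.sdiff_subset ((hF D hD).1.1.diff hb.1) with h | h
      · exact h
      · exfalso
        have h2 : μ D ≤ ENNReal.ofReal δ' := by
          have h3 := measure_inter_add_sdiff (μ := μ) D ((hF D hD).1.1.diff hb.1)
          rw [h, add_zero] at h3
          rw [← h3]
          refine (measure_mono ?_).trans hB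
          exact fun ω hω => ⟨hDC hω.1, hω.2.2⟩
        exact absurd h2 (not_le.2 (hsmall D hD))
    have h2 : μ (C \ B) = 0 := by
      refine measure_mono_null (t := ⋃ D ∈ F, D \ B) ?_
        ((measure_biUnion_null_iff F.countable_toSet).2 h1)
      rw [hC]
      rintro ω ⟨h3, h4⟩
      obtain ⟨D, hD, hωD⟩ := Set.mem_iUnion₂.1 h3
      exact Set.mem_iUnion₂.2 ⟨D, hD, hωD, h4⟩
    rw [measure_eq_zero_iff_ae_notMem] at h2
    filter_upwards [h2] with ω h3 h4
    by_contra h5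
    exact h3 ⟨h4, h5⟩
  · intro y hy
    exact hAU y ((mem_nhdO_iff hε.le).2 ⟨strongSub_mem y.2 x.2, C, hCA, hFμ, z, hz, hy⟩)
  · intro y hy w hw s t hs ht hst
    refine ⟨⟨_, strongAdd_mem y.2 w.2 s t⟩, ?_, rfl⟩
    obtain ⟨p, a, b, c, hy', hw', hx'⟩ := exists_common_chain₃ y.2 w.2 x.2
    change BoundedOn (strongSub (strongAdd _ _) _) z ε
    rw [Set.mem_ofPred_eq, (hy'.strongSub hx').boundedOn_iff hε.le] at hy
    rw [Set.mem_ofPred_eq, (hw'.strongSub hx').boundedOn_iff hε.le] at hw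
    rw [((hy'.strongAdd hw' s t).strongSub hx').boundedOn_iff hε.le]
    intro n
    have hst' : (s : ℂ) + t = 1 := by exact_mod_cast hst
    have e : ((s : ℂ) • a n + (t : ℂ) • b n - c n) * z =
        (s : ℂ) • ((a n - c n) * z) + (t : ℂ) • ((b n - c n) * z) := by
      have : c n = (s : ℂ) • c n + (t : ℂ) • c n := by rw [← add_smul, hst', one_smul]
      conv_lhs => rw [this]
      simp only [sub_mul, add_mul, smul_sub, smul_mul_assoc]
      abel
    rw [e]
    refine (norm_add_le _ _).trans ?_
    rw [norm_smul, norm_smul, Complex.norm_real, Complex.norm_real, Real.norm_of_nonneg hs,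
      Real.norm_of_nonneg ht]
    calc s * _ + t * _ ≤ s * ε + t * ε :=
          add_le_add (mul_le_mul_of_nonneg_left (hy n) hs) (mul_le_mul_of_nonneg_left (hw n) ht)
      _ = ε := by rw [← add_mul, hst, one_mul]

/-- If the topology is locally convex, then the center is atomic. -/
theorem isAtomicAlgebra_of_isLocallyConvexTopology (hμ : IsSemifiniteMeasure μ)
    (hlc : IsLocallyConvexTopology (tc Φ)) : IsAtomicAlgebra (center M) := by
  classical
  intro p hp hp0
  by_contra! hno
  obtain ⟨P, hP⟩ := exists_set_of_isProj Φ hp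
  obtain ⟨A, hAP, hA, hA0, hAfin⟩ := hμ P hP.1 (pos_iff_ne_zero.2 (mt hP.eq_zero_iff.2 hp0))
  -- A non-null part of `A` that could not be split would give a minimal central projection below
  -- `p`.
  have hsplit : ∀ B ⊆ A, MeasurableSet B → μ B ≠ 0 →
      ∃ C ⊆ B, MeasurableSet C ∧ μ C ≠ 0 ∧ μ (B \ C) ≠ 0 := by
    intro B hBA hB hB0
    obtain ⟨b, hb⟩ := exists_repSet Φ hB
    obtain ⟨r, hr, hrb, hr0, hrne⟩ := hno b hb.isProj (mt hb.eq_zero_iff.1 hB0)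
      ((hb.le_iff hP).2 (Filter.Eventually.of_forall fun ω hω => hAP (hBA hω)))
    obtain ⟨R, hR⟩ := exists_set_of_isProj Φ hr
    have hrb' : r * b = r := (hr.2.le_iff_mul_eq_left hb.isProj.2).1 hrb
    have hRB : RepSet Φ r (R ∩ B) := hrb' ▸ hR.mul hb
    refine ⟨R ∩ B, Set.inter_subset_right, hRB.1, mt hRB.eq_zero_iff.2 hr0, fun h => hrne ?_⟩
    refine le_antisymm hrb ((hb.le_iff hRB).2 ?_)
    rw [measure_eq_zero_iff_ae_notMem] at h
    filter_upwards [h] with ω h1 h2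
    by_contra h3
    exact h1 ⟨h2, h3⟩
  let x₀ : centralExtension M := ⟨ofBounded 0, ofBounded_mem (zero_mem M)⟩
  -- Half the measure of `A` guarantees that the good set of a member of this neighborhood is not
  -- null.
  have hδ₀ : 0 < (μ A).toReal / 2 := half_pos (ENNReal.toReal_pos hA0.ne' hAfin.ne)
  obtain ⟨V, hV, hVU, hconv⟩ := hlc x₀ _
    (nhd_mem_nhds (Φ := Φ) x₀ hA hAfin (ε := 1) one_pos hδ₀)
  obtain ⟨A', ε, δ, hA', hμA', hε, hδ, hAV⟩ := exists_nhd_of_mem_nhds hV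
  have hsub0 : ∀ {a : H →L[ℂ] H}, a ∈ M →
      IsGlued M (fun _ => 1) (fun _ => a) (strongSub (ofBounded a) (ofBounded 0)) := fun ha => by
    simpa using (IsGlued.ofBounded ha).strongSub (IsGlued.ofBounded (zero_mem M))
  have hη : ENNReal.ofReal δ ≠ 0 := by simpa using hδ
  obtain ⟨F, hF, hFμ⟩ := exists_finset_measure_diff_le
    (𝒞 := {C | MeasurableSet C ∧ μ C ≤ ENNReal.ofReal δ}) hA hAfin.ne (fun C hC => hC.1)
    (fun B hBA hB hB0 => by
      obtain ⟨C, hCB, hC, hC0, hCη⟩ := exists_small_subset hAfin.ne hsplit hη hBA hB hB0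
      exact ⟨C, ⟨hC, hCη⟩, hCB, hC0⟩) hη
  -- The remainder of the exhaustion also has measure at most `δ`; adding it gives a full cover of
  -- `A`.
  let F' := insert (A \ ⋃ C ∈ F, C) F
  have hF' : ∀ C ∈ F', MeasurableSet C ∧ μ C ≤ ENNReal.ofReal δ := by
    intro C hC
    rcases Finset.mem_insert.1 hC with rfl | h
    · exact ⟨hA.diff (F.measurableSet_biUnion fun C hC => (hF C hC).1.1), hFμ⟩
    · exact (hF C h).1
  have hcov : ∀ ω ∈ A, ∃ C ∈ F', ω ∈ C := by
    intro ω hω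
    by_cases h : ω ∈ ⋃ C ∈ F, C
    · obtain ⟨C, hC, hωC⟩ := Set.mem_iUnion₂.1 h
      exact ⟨C, Finset.mem_insert_of_mem hC, hωC⟩
    · exact ⟨_, Finset.mem_insert_self _ _, hω, h⟩
  let n : ℝ := F'.card
  have hn : 0 < n := Nat.cast_pos.2 (Finset.card_pos.2 ⟨_, Finset.mem_insert_self _ _⟩)
  have hex : ∀ C : Set Ω, ∃ b, C ∈ F' → RepSet Φ b C := fun C => by
    by_cases h : C ∈ F'
    · obtain ⟨b, hb⟩ := exists_repSet Φ (hF' C h).1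
      exact ⟨b, fun _ => hb⟩
    · exact ⟨0, fun h' => absurd h' h⟩
  choose b hb using hex
  -- An operator supported on a set of measure at most `δ` lies in the neighborhood whatever its
  -- size. The factor `2 * n` survives averaging over the `n` pieces as the constant 2.
  have hmemV : ∀ C ∈ F', ((2 * n : ℝ) : ℂ) • b C ∈
      {a : H →L[ℂ] H | ∃ ha : a ∈ M, ⟨ofBounded a, ofBounded_mem ha⟩ ∈ V} := by
    intro C hC
    have hmem : ((2 * n : ℝ) : ℂ) • b C ∈ M := smul_mem_vN M _ (hb C hC).isProj.1.1
    refine ⟨hmem, hAV _ ((mem_nhdO_iff hε.le).2 ⟨strongSub_mem (ofBounded_mem hmem) x₀.2,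
      A' \ C, Set.sdiff_subset, ?_, ?_⟩)⟩
    · rw [Set.sdiff_sdiff_right_self]
      exact (measure_mono Set.inter_subset_right).trans (hF' C hC).2
    · obtain ⟨w, hw⟩ := exists_repSet Φ (hA'.diff (hF' C hC).1)
      refine ⟨w, hw, (hsub0 hmem).boundedOn_iff hε.le |>.2 fun _ => ?_⟩
      have h0 : b C * w = 0 := by
        rw [((hb C hC).mul hw).eq_zero_iff]
        simp
      rw [smul_mul_assoc, h0, smul_zero, norm_zero]
      exact hε.le
  have havg := hconv.convex_bounded.sum_mem (t := F') (w := fun _ => n⁻¹)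
    (z := fun C => ((2 * n : ℝ) : ℂ) • b C) (fun _ _ => by positivity)
    (by rw [Finset.sum_const, nsmul_eq_mul]; exact mul_inv_cancel₀ hn.ne') hmemV
  have hterm : ∀ C, n⁻¹ • (((2 * n : ℝ) : ℂ) • b C) = ((2 : ℝ) : ℂ) • b C := fun C => by
    rw [Complex.coe_smul, Complex.coe_smul, smul_smul]
    congr 1
    field_simp
  simp only [hterm] at havg
  obtain ⟨hcM, hcV⟩ := havg
  have hpos : ∀ C ∈ F', 0 ≤ ((2 : ℝ) : ℂ) • b C := fun C hC =>
    smul_nonneg (by norm_num) (hb C hC).isProj.2.nonneg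
  set c := ∑ C ∈ F', ((2 : ℝ) : ℂ) • b C with hc
  have hc0 : 0 ≤ c := Finset.sum_nonneg hpos
  obtain ⟨-, B, hBA, hBμ, w, hw, hbd⟩ := (mem_nhdO_iff zero_le_one).1 (hVU hcV)
  have h1 := (norm_mul_proj_le_iff hcM hw.isProj zero_le_one).1
    (((hsub0 hcM).boundedOn_iff zero_le_one).1 hbd 0)
  rw [CFC.abs_of_nonneg c hc0] at h1
  -- On B ∩ C the average is at least 2, while membership in the neighborhood bounds it by 1.
  have hBnull : ∀ᵐ ω ∂μ, ∀ C ∈ F', ω ∉ B ∩ C := by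
    refine (Filter.eventually_all_finset F').2 fun C hC => ?_
    have h2 : ((2 : ℝ) : ℂ) • b C ≤ c := Finset.single_le_sum hpos hC
    have h3 := (mul_proj_le (smul_mem_vN M _ (hb C hC).isProj.1.1) hcM hw.isProj h2).trans h1
    rw [(hw.rep_mul ((hb C hC).2.smul _)).le_iff (hw.2.smul _)] at h3
    filter_upwards [h3] with ω h4 h5
    rw [Set.indicator_of_mem h5.1, Set.indicator_of_mem h5.2, Set.indicator_of_mem h5.1,
      mul_one, mul_one, Complex.real_le_real] at h4
    norm_num at h4
  have hB0 : μ B = 0 := by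
    rw [measure_eq_zero_iff_ae_notMem]
    filter_upwards [hBnull] with ω h2 hωB
    obtain ⟨C, hC, hωC⟩ := hcov ω (hBA hωB)
    exact h2 C hC ⟨hωB, hωC⟩
  have h2 : μ A ≤ ENNReal.ofReal ((μ A).toReal / 2) := by
    rwa [measure_sdiff_null hB0] at hBμ
  have h3 := ENNReal.toReal_mono ENNReal.ofReal_ne_top h2
  rw [ENNReal.toReal_ofReal hδ₀.le] at h3
  linarith

end LocalConvexity

/-! ### Compression to the range of a central projection -/

section Compression

variable {H : Type u} [NormedAddCommGroup H] [InnerProductSpace ℂ H] [CompleteSpace H]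
variable {M : VonNeumannAlgebra H} (K : Submodule ℂ H) [CompleteSpace K]

/-- The operator on `H` that is `b` on `K` and `0` on the orthogonal complement. -/
noncomputable def extendZero (b : K →L[ℂ] K) : H →L[ℂ] H :=
  K.subtypeL ∘L b ∘L K.orthogonalProjectionOnto

/-- The compression of an operator on `H` to `K`. -/
noncomputable def compress (a : H →L[ℂ] H) : K →L[ℂ] K :=
  K.orthogonalProjectionOnto ∘L a ∘L K.subtypeL

theorem extendZero_apply (b : K →L[ℂ] K) (ξ : H) :
    extendZero K b ξ = b (K.orthogonalProjectionOnto ξ) := rfl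

theorem compress_apply (a : H →L[ℂ] H) (v : K) :
    compress K a v = K.orthogonalProjectionOnto (a v) := rfl

@[simp]
theorem compress_extendZero (b : K →L[ℂ] K) : compress K (extendZero K b) = b := by
  ext v
  simp [compress_apply, extendZero_apply]

theorem extendZero_compress (a : H →L[ℂ] H) :
    extendZero K (compress K a) = K.starProjection * a * K.starProjection := by
  ext ξ
  simp [compress_apply, extendZero_apply]

theorem extendZero_injective : Function.Injective (extendZero K) :=
  Function.LeftInverse.injective (compress_extendZero K)

theorem extendZero_mul (b c : K →L[ℂ] K) :
    extendZero K (b * c) = extendZero K b * extendZero K c := by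
  ext ξ
  simp [extendZero_apply]

theorem extendZero_add (b c : K →L[ℂ] K) :
    extendZero K (b + c) = extendZero K b + extendZero K c := by
  ext ξ
  simp [extendZero_apply]

theorem extendZero_smul_one (k : ℂ) :
    extendZero K (k • 1) = k • K.starProjection := by
  ext ξ
  simp [extendZero_apply]

theorem extendZero_star (b : K →L[ℂ] K) : extendZero K (star b) = star (extendZero K b) := by
  simp only [extendZero, ContinuousLinearMap.star_eq_adjoint, ContinuousLinearMap.adjoint_comp,
    ← K.adjoint_subtypeL, ContinuousLinearMap.adjoint_adjoint]
  rfl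

theorem extendZero_mul_proj (b : K →L[ℂ] K) :
    extendZero K b * K.starProjection = extendZero K b := by
  ext ξ
  rw [mul_apply_eq_comp, extendZero_apply, extendZero_apply,
    Submodule.starProjection_apply, Submodule.orthogonalProjectionOnto_mem_subspace_eq_self]

theorem proj_mul_extendZero (b : K →L[ℂ] K) :
    K.starProjection * extendZero K b = extendZero K b := by
  ext ξ
  simp [extendZero_apply]

theorem extendZero_compress_of_mem (hK : K.starProjection ∈ center M) {a : H →L[ℂ] H}
    (ha : a ∈ M) : extendZero K (compress K a) = a * K.starProjection := by
  rw [extendZero_compress, ← mul_comm_of_mem_center hK ha, mul_assoc,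
    (isStarProjection_starProjection (U := K)).isIdempotentElem.eq]

/-- The compression of a von Neumann algebra to the range of a central projection. -/
noncomputable def compression (M : VonNeumannAlgebra H) (hK : K.starProjection ∈ center M) :
    VonNeumannAlgebra K where
  carrier := {b | extendZero K b ∈ M}
  mul_mem' {b c} hb hc := by
    rw [Set.mem_ofPred_eq, extendZero_mul]
    exact mul_mem hb hc
  add_mem' {b c} hb hc := by
    rw [Set.mem_ofPred_eq, extendZero_add]
    exact add_mem hb hc
  algebraMap_mem' k := by
    rw [Set.mem_ofPred_eq, Algebra.algebraMap_eq_smul_one, extendZero_smul_one]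
    exact smul_mem_vN M k hK.1
  star_mem' {b} hb := by
    rw [Set.mem_ofPred_eq, extendZero_star]
    exact star_mem hb
  centralizer_centralizer' := by
    refine Set.Subset.antisymm (fun b hb => ?_) Set.subset_centralizer_centralizer
    change extendZero K b ∈ M
    rw [← M.commutant_commutant, VonNeumannAlgebra.mem_commutant_iff]
    intro t ht
    have htK : K.starProjection * t = t * K.starProjection :=
      VonNeumannAlgebra.mem_commutant_iff.1 ht _ hK.1
    have hext : extendZero K (compress K t) = t * K.starProjection := by
      rw [extendZero_compress, htK, mul_assoc,
        (isStarProjection_starProjection (U := K)).isIdempotentElem.eq]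
    -- An element `t` of the commutant of M compresses into the commutant of the compression. There
    -- it commutes with `b`, and extending by zero returns the relation to `H`.
    have h1 : compress K t ∈ Set.centralizer {b : K →L[ℂ] K | extendZero K b ∈ M} := by
      intro c hc
      apply extendZero_injective K
      rw [extendZero_mul, extendZero_mul, hext, mul_assoc, proj_mul_extendZero, ← htK, ← mul_assoc,
        extendZero_mul_proj]
      exact VonNeumannAlgebra.mem_commutant_iff.1 ht _ hc
    have h2 : compress K t * b = b * compress K t := hb _ h1
    have h3 := congrArg (extendZero K) h2
    rwa [extendZero_mul, extendZero_mul, hext, mul_assoc, proj_mul_extendZero, ← htK, ← mul_assoc,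
      extendZero_mul_proj] at h3

theorem mem_compression_iff (hK : K.starProjection ∈ center M) {b : K →L[ℂ] K} :
    b ∈ compression K M hK ↔ extendZero K b ∈ M := Iff.rfl

theorem compress_mem (hK : K.starProjection ∈ center M) {a : H →L[ℂ] H} (ha : a ∈ M) :
    compress K a ∈ compression K M hK := by
  rw [mem_compression_iff, extendZero_compress_of_mem K hK ha]
  exact mul_mem ha hK.1

/-- Multiplicativity rests on centrality: P a P b P = P a b P because P commutes with `b`. -/
theorem compress_mul (hK : K.starProjection ∈ center M) {a b : H →L[ℂ] H} (ha : a ∈ M)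
    (hb : b ∈ M) : compress K (a * b) = compress K a * compress K b := by
  apply extendZero_injective K
  rw [extendZero_mul, extendZero_compress_of_mem K hK ha, extendZero_compress_of_mem K hK hb,
    extendZero_compress_of_mem K hK (mul_mem ha hb), mul_assoc a K.starProjection,
    ← mul_assoc K.starProjection b, ← mul_comm_of_mem_center hK hb, mul_assoc b,
    (isStarProjection_starProjection (U := K)).isIdempotentElem.eq, mul_assoc]

theorem compress_star (a : H →L[ℂ] H) : compress K (star a) = star (compress K a) := by
  apply extendZero_injective K
  rw [extendZero_star, extendZero_compress, extendZero_compress, star_mul, star_mul,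
    (isStarProjection_starProjection (U := K)).isSelfAdjoint.star_eq, mul_assoc]

theorem norm_compress_le (a : H →L[ℂ] H) : ‖compress K a‖ ≤ ‖a‖ := by
  refine ContinuousLinearMap.opNorm_le_bound _ (norm_nonneg _) fun v => ?_
  rw [compress_apply]
  exact (K.norm_orthogonalProjectionOnto_apply_le _).trans (a.le_opNorm _)

/-- A central element of the compression is the compression of a central element. -/
theorem extendZero_mem_center (hK : K.starProjection ∈ center M) {b : K →L[ℂ] K}
    (hb : b ∈ center (compression K M hK)) : extendZero K b ∈ center M := by
  refine ⟨hb.1, VonNeumannAlgebra.mem_commutant_iff.2 fun m hm => ?_⟩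
  have h := congrArg (extendZero K) (mul_comm_of_mem_center hb (compress_mem K hK hm))
  rwa [extendZero_mul, extendZero_mul, extendZero_compress_of_mem K hK hm, mul_assoc,
    proj_mul_extendZero, mul_comm_of_mem_center hK hm, ← mul_assoc, extendZero_mul_proj] at h

end Compression

/-! ### Decomposition into a C*-product of compressions -/

section CstarProduct

variable {J : Type u} {K : J → Type u} [∀ j, NormedAddCommGroup (K j)]
  [∀ j, InnerProductSpace ℂ (K j)] [∀ j, CompleteSpace (K j)] {N : ∀ j, VonNeumannAlgebra (K j)}

theorem cstarProduct_ext {a b : cstarProduct N}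
    (h : ∀ j, ((a.1 j).1 : K j →L[ℂ] K j) = (b.1 j).1) : a = b :=
  Subtype.ext (funext fun j => Subtype.ext (h j))

theorem exists_norm_coord_le (a : cstarProduct N) :
    ∃ C : ℝ, ∀ j, ‖((a.1 j).1 : K j →L[ℂ] K j)‖ ≤ C := a.2

end CstarProduct

section Product

variable {H : Type u} [NormedAddCommGroup H] [InnerProductSpace ℂ H] [CompleteSpace H]
variable {M : VonNeumannAlgebra H} {J : Type u} {K : J → Submodule ℂ H}
  [∀ j, CompleteSpace (K j)]

theorem eq_of_forall_mul_starProjection_eq (hd : ⊤ ≤ (⨆ j, K j).topologicalClosure)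
    {a b : H →L[ℂ] H} (h : ∀ j, a * (K j).starProjection = b * (K j).starProjection) : a = b := by
  have h1 : ⨆ j, K j ≤ LinearMap.eqLocus (a : H →ₗ[ℂ] H) b := by
    refine iSup_le fun j ξ hξ => ?_
    have := congrArg (fun T : H →L[ℂ] H => T ξ) (h j)
    simpa [Submodule.starProjection_eq_self_iff.2 hξ] using this
  have h2 : IsClosed (LinearMap.eqLocus (a : H →ₗ[ℂ] H) (b : H →ₗ[ℂ] H) : Set H) :=
    isClosed_eq a.continuous b.continuous
  ext ξ
  exact Submodule.topologicalClosure_minimal _ h1 h2 (hd trivial)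

theorem mem_of_forall_mul_starProjection_mem (hK : ∀ j, (K j).starProjection ∈ center M)
    (hd : ⊤ ≤ (⨆ j, K j).topologicalClosure) {a : H →L[ℂ] H}
    (h : ∀ j, a * (K j).starProjection ∈ M) : a ∈ M := by
  rw [← M.commutant_commutant, VonNeumannAlgebra.mem_commutant_iff]
  intro t ht
  refine eq_of_forall_mul_starProjection_eq hd fun j => ?_
  have htK : (K j).starProjection * t = t * (K j).starProjection :=
    VonNeumannAlgebra.mem_commutant_iff.1 ht _ (hK j).1
  have hbt : a * (K j).starProjection * t = t * (a * (K j).starProjection) :=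
    VonNeumannAlgebra.mem_commutant_iff.1 ht _ (h j)
  rw [mul_assoc t, ← hbt, mul_assoc, mul_assoc, htK]

/-- A bounded family of operators on the summands of a Hilbert sum comes from an operator. -/
theorem exists_forall_mul_starProjection_eq
    (hH : IsHilbertSum ℂ (fun j => K j) fun j => (K j).subtypeₗᵢ) (b : ∀ j, K j →L[ℂ] K j) {C : ℝ}
    (hC : ∀ j, ‖b j‖ ≤ C) :
    ∃ T : H →L[ℂ] H, ∀ j, T * (K j).starProjection = extendZero (K j) (b j) := by
  classical
  -- For an empty family `C` may be negative.
  have hC' : ∀ j, ‖b j‖ ≤ max C 0 := fun j => (hC j).trans (le_max_left _ _)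
  let e := hH.linearIsometryEquiv
  let S := lp.mapCLM 2 b (le_max_right C 0) hC'
  refine ⟨(e.symm.toContinuousLinearEquiv : lp (fun j => K j) 2 →L[ℂ] H) ∘L S ∘L
    (e.toContinuousLinearEquiv : H →L[ℂ] lp (fun j => K j) 2), fun j => ?_⟩
  ext ξ
  change e.symm (S (e ((K j).starProjection ξ))) = _
  have h1 : e ((K j).starProjection ξ) = lp.single 2 j ((K j).orthogonalProjectionOnto ξ) := by
    rw [← e.symm_apply_eq.1]
    exact hH.linearIsometryEquiv_symm_apply_single _
  have h2 : S (lp.single 2 j ((K j).orthogonalProjectionOnto ξ)) =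
      lp.single 2 j (b j ((K j).orthogonalProjectionOnto ξ)) := by
    ext i
    rw [lp.mapCLM_apply_coe, lp.single_apply, lp.single_apply]
    by_cases hij : i = j
    · subst hij; simp
    · simp [hij]
  rw [h1, h2]
  exact hH.linearIsometryEquiv_symm_apply_single _

/-- The *-homomorphism that takes an operator to the family of its compressions. -/
noncomputable def compressHom (K : J → Submodule ℂ H) [∀ j, CompleteSpace (K j)]
    (hK : ∀ j, (K j).starProjection ∈ center M) :
    M.toStarSubalgebra →⋆ₐ[ℂ] cstarProduct fun j => compression (K j) M (hK j) where
  toFun a := ⟨fun j => ⟨compress (K j) a, compress_mem (K j) (hK j) a.2⟩, ‖(a : H →L[ℂ] H)‖,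
    fun j => norm_compress_le (K j) a⟩
  map_one' := cstarProduct_ext fun j => by
    change compress (K j) 1 = 1
    ext v
    simp [compress_apply]
  map_mul' a b := cstarProduct_ext fun j =>
    compress_mul (K j) (hK j) a.2 b.2
  map_zero' := cstarProduct_ext fun j => by
    change compress (K j) 0 = 0
    ext v
    simp [compress_apply]
  map_add' a b := cstarProduct_ext fun j => by
    change compress (K j) (a + b) = compress (K j) a + compress (K j) b
    ext v
    simp [compress_apply]
  commutes' k := cstarProduct_ext fun j => by
    change compress (K j) (algebraMap ℂ _ k) = algebraMap ℂ _ k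
    ext v
    simp [compress_apply, Algebra.algebraMap_eq_smul_one]
  map_star' a := cstarProduct_ext fun j => by
    change compress (K j) (star (a : H →L[ℂ] H)) = star (compress (K j) (a : H →L[ℂ] H))
    exact compress_star (K j) a

theorem compressHom_apply (hK : ∀ j, (K j).starProjection ∈ center M) (a : M.toStarSubalgebra)
    (j : J) : (((compressHom K hK a).1 j).1 : K j →L[ℂ] K j) = compress (K j) a := rfl

theorem compressHom_injective (hK : ∀ j, (K j).starProjection ∈ center M)
    (hd : ⊤ ≤ (⨆ j, K j).topologicalClosure) : Function.Injective (compressHom K hK) := by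
  intro a b hab
  refine Subtype.ext (eq_of_forall_mul_starProjection_eq hd fun j => ?_)
  have h : compress (K j) (a : H →L[ℂ] H) = compress (K j) (b : H →L[ℂ] H) := by
    exact congrArg (fun c : cstarProduct fun j => compression (K j) M (hK j) => (c.1 j).1) hab
  rw [← extendZero_compress_of_mem (K j) (hK j) a.2,
    ← extendZero_compress_of_mem (K j) (hK j) b.2, h]

-- A bounded family defines a diagonal operator on the Hilbert sum. It belongs to M by the double
-- commutant theorem, since each of its central pieces does.
set_option maxHeartbeats 800000 in
theorem compressHom_surjective (hK : ∀ j, (K j).starProjection ∈ center M)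
    (hort : OrthogonalFamily ℂ (fun j => K j) fun j => (K j).subtypeₗᵢ)
    (hd : ⊤ ≤ (⨆ j, K j).topologicalClosure) : Function.Surjective (compressHom K hK) := by
  intro b
  have h0 := exists_norm_coord_le b
  have hs := IsHilbertSum.mkInternal K hort hd
  obtain ⟨C, hC⟩ := h0
  have h1 := exists_forall_mul_starProjection_eq hs (fun j => (b.1 j).1) hC
  obtain ⟨T, hT⟩ := h1
  have hTM : T ∈ M := mem_of_forall_mul_starProjection_mem hK hd fun j => by
    rw [hT]
    exact (b.1 j).2
  refine ⟨⟨T, hTM⟩, cstarProduct_ext fun j => extendZero_injective (K j) ?_⟩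
  rw [compressHom_apply, extendZero_compress_of_mem (K j) (hK j) hTM, hT]

/-- A von Neumann algebra is the C*-product of its compressions to the members of an orthogonal
family of central projections with supremum `1`. -/
theorem nonempty_starAlgEquiv_cstarProduct (hK : ∀ j, (K j).starProjection ∈ center M)
    (hort : OrthogonalFamily ℂ (fun j => K j) fun j => (K j).subtypeₗᵢ)
    (hd : ⊤ ≤ (⨆ j, K j).topologicalClosure) :
    Nonempty (M.toStarSubalgebra ≃⋆ₐ[ℂ] cstarProduct fun j => compression (K j) M (hK j)) :=
  ⟨StarAlgEquiv.ofBijective (compressHom K hK)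
    ⟨compressHom_injective hK hd, compressHom_surjective hK hort hd⟩⟩

end Product

/-! ### Atomic center gives a product of factors -/

section Factors

variable {H : Type u} [NormedAddCommGroup H] [InnerProductSpace ℂ H] [CompleteSpace H]
variable {M : VonNeumannAlgebra H}
variable {Ω : Type v} [MeasurableSpace Ω] {μ : Measure Ω}

/-- A nonzero projection of `N` that dominates no other nonzero projection of `N`. -/
def IsMinimalProj (N : VonNeumannAlgebra H) (q : H →L[ℂ] H) : Prop :=
  IsProj N q ∧ q ≠ 0 ∧ ∀ r, IsProj N r → r ≤ q → r = 0 ∨ r = q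

/-- The part of the center under a minimal central projection is one-dimensional. -/
theorem IsMinimalProj.exists_mul_eq_smul (Φ : CenterIso M μ) {q a : H →L[ℂ] H}
    (hq : IsMinimalProj (center M) q) (ha : a ∈ center M) : ∃ c : ℂ, a * q = c • q := by
  obtain ⟨Q, hQ⟩ := exists_set_of_isProj Φ hq.1
  obtain ⟨f, hfm, hf, -⟩ := exists_rep Φ ha
  -- Minimality makes every preimage under `f` null or conull in `Q`. Countably many Borel sets
  -- separate the points of ℂ, so `f` is almost everywhere constant on `Q`.
  obtain ⟨c, hc⟩ := Filter.exists_eventuallyEq_const_of_forall_separating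
    (l := ae (μ.restrict Q)) (f := f) MeasurableSet fun U hU => by
      rw [ae_restrict_iff' hQ.1, ae_restrict_iff' hQ.1]
      obtain ⟨d, hd⟩ := exists_repSet Φ (hQ.1.inter (hfm hU))
      rcases hq.2.2 d hd.isProj ((hd.le_iff hQ).2 (Filter.Eventually.of_forall fun ω h => h.1))
        with h | h
      · right
        rw [hd.eq_zero_iff, measure_eq_zero_iff_ae_notMem] at h
        filter_upwards [h] with ω h1 h2 h3 using h1 ⟨h2, h3⟩
      · left
        filter_upwards [(hQ.le_iff hd).1 h.ge] with ω h1 h2 using (h1 h2).2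
  refine ⟨c, (hQ.rep_mul hf).inj ((hQ.2.smul c).congr ?_)⟩
  have hc' := (ae_restrict_iff' hQ.1).1 hc
  filter_upwards [hc'] with ω hω
  by_cases h : ω ∈ Q
  · simp [h, hω h]
  · simp [h]

/-- The product is a central projection below both factors; if nonzero, it equals each of them by
minimality. -/
theorem IsMinimalProj.mul_eq_zero {q r : H →L[ℂ] H} (hq : IsMinimalProj (center M) q)
    (hr : IsMinimalProj (center M) r) (hne : q ≠ r) : q * r = 0 := by
  have hc : q * r = r * q := mul_comm_of_mem_center hr.1.1 hq.1.1.1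
  have h1 := hq.1.mul hr.1
  by_contra h0
  have h2 : q * r ≤ q := (h1.2.le_iff_mul_eq_right hq.1.2).2 (by
    rw [← mul_assoc, hq.1.2.isIdempotentElem.eq])
  have h3 : q * r ≤ r := (h1.2.le_iff_mul_eq_left hr.1.2).2 (by
    rw [mul_assoc, hr.1.2.isIdempotentElem.eq])
  exact hne (((hq.2.2 _ h1 h2).resolve_left h0).symm.trans ((hr.2.2 _ h1 h3).resolve_left h0))

/-- A von Neumann algebra with atomic center is a product of factors. -/
theorem isProductOfFactors_of_isAtomicAlgebra (Φ : CenterIso M μ)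
    (hat : IsAtomicAlgebra (center M)) : IsProductOfFactors M := by
  -- Minimal central projections are indexed by their ranges, which serve directly as the Hilbert
  -- spaces of the factors.
  let J := {K : Submodule ℂ H // ∃ _ : CompleteSpace K, IsMinimalProj (center M) K.starProjection}
  have hcomp : ∀ j : J, CompleteSpace j.1 := fun j => j.2.1
  have hmin : ∀ j : J, IsMinimalProj (center M) (j.1.starProjection) := fun j => j.2.2
  have hJ : ∀ q, IsMinimalProj (center M) q → ∃ j : J, q = j.1.starProjection := by
    intro q hq
    obtain ⟨_, h2⟩ := isStarProjection_iff_eq_starProjection_range.1 hq.1.2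
    have hcl := ContinuousLinearMap.IsIdempotentElem.isClosed_range hq.1.2.isIdempotentElem
    have hc : CompleteSpace (q : H →ₗ[ℂ] H).range := hcl.completeSpace_coe
    exact ⟨⟨(q : H →ₗ[ℂ] H).range, hc, h2 ▸ hq⟩, h2⟩
  have hort : OrthogonalFamily ℂ (fun j : J => j.1) fun j => j.1.subtypeₗᵢ := by
    intro i j hij v w
    have hne : i.1.starProjection ≠ j.1.starProjection := fun h => hij (Subtype.ext (by
      rw [← i.1.range_starProjection, h, j.1.range_starProjection]))
    have h0 := (hmin i).mul_eq_zero (hmin j) hne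
    have hv : i.1.starProjection v = v := Submodule.starProjection_eq_self_iff.2 v.2
    have hw : j.1.starProjection w = w := Submodule.starProjection_eq_self_iff.2 w.2
    change inner ℂ (v : H) (w : H) = 0
    rw [← hv, ← hw, Submodule.inner_starProjection_left_eq_right, ← mul_apply_eq_comp, h0]
    simp
  have hd : ⊤ ≤ (⨆ j : J, j.1).topologicalClosure := by
    have he := starProjection_iSup_range_mem (center M) (fun j : J => j.1.starProjection)
      fun j => (hmin j).1.1
    simp only [Submodule.range_starProjection] at he
    set L := ⨆ j : J, j.1
    have hLp : IsProj (center M) (1 - L.topologicalClosure.starProjection) :=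
      IsProj.one_sub ⟨he, isStarProjection_starProjection⟩
    -- If nonzero, the central complement of the supremum would dominate a minimal projection, which
    -- also lies below the supremum.
    have h0 : 1 - L.topologicalClosure.starProjection = 0 := by
      by_contra hne
      obtain ⟨q, hq, hq0, hle, hqm⟩ := hat _ hLp hne
      obtain ⟨j, hj⟩ := hJ q ⟨hq, hq0, hqm⟩
      have h1 : L.topologicalClosure.starProjection * q = q := by
        ext ξ
        refine Submodule.starProjection_eq_self_iff.2 (L.le_topologicalClosure ?_)
        rw [hj]
        exact Submodule.mem_iSup_of_mem j (j.1.starProjection_apply_mem ξ)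
      have h2 := (hq.2.le_iff_mul_eq_right hLp.2).1 hle
      rw [sub_mul, one_mul, h1, sub_self] at h2
      exact hq0 h2.symm
    intro ξ _
    rw [← Submodule.starProjection_eq_self_iff, ← sub_eq_zero.1 h0]
    rfl
  refine ⟨J, fun j => j.1, inferInstance, inferInstance, hcomp,
    fun j => compression j.1 M (hmin j).1.1, fun j => ⟨?_, fun a ha => ?_⟩,
    nonempty_starAlgEquiv_cstarProduct _ hort hd⟩
  · rw [Submodule.nontrivial_iff_ne_bot]
    intro h
    refine (hmin j).2.1 ?_
    ext ξ
    exact (Submodule.mem_bot ℂ).1 (h.le (j.1.starProjection_apply_mem ξ))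
  · obtain ⟨c, hc⟩ := (hmin j).exists_mul_eq_smul Φ (extendZero_mem_center j.1 _ ha)
    refine ⟨c, extendZero_injective j.1 ?_⟩
    rw [extendZero_smul_one, ← hc, extendZero_mul_proj]

end Factors

/-! ### Products of factors have atomic center -/

section CentralIdempotents

variable {A B : Type*} [Ring A] [StarRing A] [Ring B] [StarRing B]

/-- A central self-adjoint idempotent. -/
def IsCentralProj (a : A) : Prop :=
  IsStarProjection a ∧ ∀ x, x * a = a * x

/-- Every nonzero central projection of the *-ring `A` dominates a minimal one. -/
def HasAtomicCenter (A : Type*) [Ring A] [StarRing A] : Prop :=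
  ∀ p : A, IsCentralProj p → p ≠ 0 → ∃ q, IsCentralProj q ∧ q ≠ 0 ∧ p * q = q ∧
    ∀ r, IsCentralProj r → q * r = r → r = 0 ∨ r = q

theorem IsCentralProj.map [Algebra ℂ A] [Algebra ℂ B] (e : A ≃⋆ₐ[ℂ] B) {a : A}
    (ha : IsCentralProj a) : IsCentralProj (e a) := by
  refine ⟨ha.1.map e, fun x => ?_⟩
  rw [← e.apply_symm_apply x, ← map_mul, ← map_mul, ha.2]

/-- Here the order is expressed by `p * q = q` instead of the operator order, so the property is
purely algebraic and passes along *-isomorphisms. -/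
theorem HasAtomicCenter.congr [Algebra ℂ A] [Algebra ℂ B] (e : A ≃⋆ₐ[ℂ] B)
    (h : HasAtomicCenter B) : HasAtomicCenter A := by
  intro p hp hp0
  obtain ⟨q, hq, hq0, hpq, hmin⟩ := h (e p) (hp.map e) ((map_ne_zero_iff e e.injective).2 hp0)
  refine ⟨e.symm q, hq.map e.symm, (map_ne_zero_iff e.symm e.symm.injective).2 hq0, ?_,
    fun r hr hqr => ?_⟩
  · rw [← e.symm_apply_apply p, ← map_mul, hpq]
  · have h1 : q * e r = e r := by
      rw [← e.apply_symm_apply q, ← map_mul, hqr]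
    rcases hmin _ (hr.map e) h1 with h2 | h2
    · exact .inl ((map_eq_zero_iff e e.injective).1 h2)
    · exact .inr (by rw [← h2, e.symm_apply_apply])

end CentralIdempotents

section CstarProductCenter

variable {J : Type u} {K : J → Type u} [∀ j, NormedAddCommGroup (K j)]
  [∀ j, InnerProductSpace ℂ (K j)] [∀ j, CompleteSpace (K j)] {N : ∀ j, VonNeumannAlgebra (K j)}

open Classical in
/-- The family with the single nonzero coordinate `c` at `j`. -/
noncomputable def cstarSingle (N : ∀ j, VonNeumannAlgebra (K j)) (j : J)
    (c : (N j).toStarSubalgebra) : cstarProduct N :=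
  ⟨Pi.single j c, ‖(c : K j →L[ℂ] K j)‖, fun i => by
    rcases eq_or_ne i j with rfl | h
    · simp
    · simp [h]⟩

theorem cstarSingle_same (j : J) (c : (N j).toStarSubalgebra) :
    (cstarSingle N j c).1 j = c := by
  simp [cstarSingle]

theorem cstarSingle_of_ne {i j : J} (h : i ≠ j) (c : (N j).toStarSubalgebra) :
    (cstarSingle N j c).1 i = 0 := by
  simp [cstarSingle, h]

theorem cstarProduct_ext' {a b : cstarProduct N} (h : ∀ j, a.1 j = b.1 j) : a = b :=
  Subtype.ext (funext h)

theorem cstarProduct_mul_apply (a b : cstarProduct N) (j : J) :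
    (a * b).1 j = a.1 j * b.1 j := rfl

theorem isCentralProj_cstarSingle_one (j : J) : IsCentralProj (cstarSingle N j 1) := by
  refine ⟨⟨cstarProduct_ext' fun i => ?_, cstarProduct_ext' fun i => ?_⟩,
    fun a => cstarProduct_ext' fun i => ?_⟩
  · rw [cstarProduct_mul_apply]
    rcases eq_or_ne i j with rfl | h
    · rw [cstarSingle_same, mul_one]
    · rw [cstarSingle_of_ne h, mul_zero]
  · change star ((cstarSingle N j 1).1 i) = _
    rcases eq_or_ne i j with rfl | h
    · rw [cstarSingle_same, star_one]
    · rw [cstarSingle_of_ne h, star_zero]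
  · rw [cstarProduct_mul_apply, cstarProduct_mul_apply]
    rcases eq_or_ne i j with rfl | h
    · rw [cstarSingle_same, mul_one, one_mul]
    · rw [cstarSingle_of_ne h, mul_zero, zero_mul]

/-- The coordinates of a central idempotent of a product of factors are `0` or `1`. -/
theorem coord_eq_zero_or_one (hN : ∀ j, IsFactor (N j)) {b : cstarProduct N}
    (hb : IsCentralProj b) (j : J) : b.1 j = 0 ∨ b.1 j = 1 := by
  have hcen : (b.1 j).1 ∈ center (N j) := by
    refine ⟨(b.1 j).2, VonNeumannAlgebra.mem_commutant_iff.2 fun m hm => ?_⟩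
    -- Commutation with families supported at the single coordinate `j` shows that this coordinate
    -- is central.
    have h := congrArg (fun d : cstarProduct N => d.1 j) (hb.2 (cstarSingle N j ⟨m, hm⟩))
    simp only [cstarProduct_mul_apply, cstarSingle_same] at h
    exact congrArg Subtype.val h
  obtain ⟨c, hcj⟩ := (hN j).2 _ hcen
  have hnt := (hN j).1
  have h2 : (b.1 j).1 * (b.1 j).1 = (b.1 j).1 :=
    congrArg (fun d : cstarProduct N => (d.1 j).1) hb.1.isIdempotentElem.eq
  rw [hcj, smul_mul_smul_comm, one_mul, ← sub_eq_zero, ← sub_smul, smul_eq_zero] at h2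
  have h3 : c * (c - 1) = 0 := by
    rw [mul_sub, mul_one]
    exact h2.resolve_right one_ne_zero
  rcases mul_eq_zero.1 h3 with h | h
  · left
    apply Subtype.ext
    rw [hcj, h, zero_smul]
    rfl
  · right
    apply Subtype.ext
    rw [hcj, sub_eq_zero.1 h, one_smul]
    rfl

/-- The center of a product of factors is atomic. -/
theorem hasAtomicCenter_cstarProduct (hN : ∀ j, IsFactor (N j)) :
    HasAtomicCenter (cstarProduct N) := by
  intro p hp hp0
  obtain ⟨j, hj⟩ : ∃ j, p.1 j ≠ 0 := by
    by_contra! hall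
    exact hp0 (cstarProduct_ext' hall)
  -- The minimal projection is the unit of a coordinate at which `p` does not vanish, hence equals
  -- 1.
  refine ⟨cstarSingle N j 1, isCentralProj_cstarSingle_one j, fun h0 => ?_,
    cstarProduct_ext' fun i => ?_, fun r hr hqr => ?_⟩
  · have h2 := congrArg (fun d : cstarProduct N => (d.1 j).1) h0
    simp only [cstarSingle_same] at h2
    have := (hN j).1
    exact one_ne_zero (α := K j →L[ℂ] K j) h2
  · rw [cstarProduct_mul_apply]
    rcases eq_or_ne i j with rfl | h
    · rw [(coord_eq_zero_or_one hN hp i).resolve_left hj, one_mul]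
    · rw [cstarSingle_of_ne h, mul_zero]
  · have hne : ∀ i ≠ j, r.1 i = 0 := by
      intro i h
      rw [← hqr, cstarProduct_mul_apply, cstarSingle_of_ne h, zero_mul]
    rcases coord_eq_zero_or_one hN hr j with h0 | h0
    · left
      refine cstarProduct_ext' fun i => ?_
      rcases eq_or_ne i j with rfl | h
      exacts [h0, hne i h]
    · right
      refine cstarProduct_ext' fun i => ?_
      rcases eq_or_ne i j with rfl | h
      · rw [h0, cstarSingle_same]
      · rw [hne i h, cstarSingle_of_ne h]

end CstarProductCenter

section Atomic

variable {H : Type u} [NormedAddCommGroup H] [InnerProductSpace ℂ H] [CompleteSpace H]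
variable {M : VonNeumannAlgebra H}

theorem isProj_center_iff (a : M.toStarSubalgebra) :
    IsProj (center M) a.1 ↔ IsCentralProj a := by
  refine ⟨fun h => ⟨⟨Subtype.ext h.2.isIdempotentElem.eq, Subtype.ext h.2.isSelfAdjoint.star_eq⟩,
    fun x => Subtype.ext (mul_comm_of_mem_center h.1 x.2)⟩, fun h => ⟨⟨a.2, ?_⟩,
      ⟨congrArg Subtype.val h.1.isIdempotentElem.eq,
        congrArg Subtype.val h.1.isSelfAdjoint.star_eq⟩⟩⟩
  exact VonNeumannAlgebra.mem_commutant_iff.2 fun m hm => congrArg Subtype.val (h.2 ⟨m, hm⟩)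

theorem isAtomicAlgebra_center_of_hasAtomicCenter (h : HasAtomicCenter M.toStarSubalgebra) :
    IsAtomicAlgebra (center M) := by
  intro p hp hp0
  obtain ⟨q, hq, hq0, hpq, hmin⟩ := h ⟨p, hp.1.1⟩ ((isProj_center_iff _).1 hp)
    fun h => hp0 (congrArg Subtype.val h)
  have hq' := (isProj_center_iff q).2 hq
  refine ⟨q.1, hq', fun h => hq0 (Subtype.ext h),
    (hq'.2.le_iff_mul_eq_right hp.2).2 (congrArg Subtype.val hpq), fun r hr hrq => ?_⟩
  have h1 : q * (⟨r, hr.1.1⟩ : M.toStarSubalgebra) = ⟨r, hr.1.1⟩ :=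
    Subtype.ext ((hr.2.le_iff_mul_eq_right hq'.2).1 hrq)
  exact (hmin _ ((isProj_center_iff _).1 hr) h1).imp (congrArg Subtype.val) (congrArg Subtype.val)

/-- The center of a von Neumann algebra that is isomorphic to a product of factors is atomic. -/
theorem isAtomicAlgebra_of_isProductOfFactors (h : IsProductOfFactors M) :
    IsAtomicAlgebra (center M) := by
  obtain ⟨J, K, _, _, _, N, hN, ⟨e⟩⟩ := h
  exact isAtomicAlgebra_center_of_hasAtomicCenter ((hasAtomicCenter_cstarProduct hN).congr e)

end Atomic

end CentralExtension

open CentralExtension in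
/-- For a von Neumann algebra `M` with center `Z(M) ≅ L^∞(Ω, Σ, μ)`, the topology `t_c(M)` is
locally convex iff `M` is *-isomorphic to a C*-product of factors iff `Z(M)` is atomic. -/
theorem proposition3p9 {H : Type u} [NormedAddCommGroup H] [InnerProductSpace ℂ H]
    [CompleteSpace H] (M : VonNeumannAlgebra H)
    {Ω : Type v} [MeasurableSpace Ω] (μ : Measure Ω)
    (hμ : HasDirectSumProperty μ) (hμ' : IsSemifiniteMeasure μ) (Φ : CenterIso M μ) :
    (IsLocallyConvexTopology (tc Φ) ↔ IsProductOfFactors M) ∧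
      (IsLocallyConvexTopology (tc Φ) ↔ IsAtomicAlgebra (center M)) := by
  have h : IsLocallyConvexTopology (tc Φ) ↔ IsAtomicAlgebra (center M) :=
    ⟨isAtomicAlgebra_of_isLocallyConvexTopology hμ', isLocallyConvexTopology_of_isAtomicAlgebra⟩
  exact ⟨⟨fun hlc => isProductOfFactors_of_isAtomicAlgebra Φ (h.1 hlc),
    fun hpr => h.2 (isAtomicAlgebra_of_isProductOfFactors hpr)⟩, h⟩
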